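/- Let $d\ge 1$, $T>0$, let $A\in\mathbb R^{d\times d}$ be symmetric and nonnegative definite, and let $\mu\ge 0$ be a Borel measure on $\mathbb R^d$ with $\int(1\wedge|z|^2)\,d\mu(z)<\infty$. Put $$\mathcal L\varphi(x)=\operatorname{div}(AD\varphi)(x)+\int_{\mathbb R^d}\big[\varphi(x+z)-\varphi(x)-\mathbf 1_{|z|<1}D\varphi(x)\cdot z\big]\,d\mu(z),$$ $$\psi(\xi)=\xi\cdot A\xi+\int_{\mathbb R^d}\big(1-e^{i\xi\cdot z}+i\xi\cdot z\,\mathbf 1_{|z|<1}\big)\,d\mu(z).$$ The heat kernel of $\mathcal L$ at time $t>0$ is the probability measure whose Fourier transform ($\int e^{-i\xi\cdot x}p_t(dx)$) is $e^{-t\psi(\xi)}$; its density is also denoted $p_t$ if it has one, and then $P_t\varphi(x)=\int p_t(x-y)\varphi(y)\,dy$. $C^1_b(\mathbb R^d)$ is the space of $C^1$ functions with finite norm $\|\varphi\|_\infty+\|D\varphi\|_\infty$. Let $\alpha\in(1,2]$, $\beta\in(0,1]$, $\alpha+\beta\notin\mathbb N$, and assume: (L1) for $t\in(0,T]$ the heat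 kernel has a density $p_t\in C_b^\infty(\mathbb R^d)$, and there is $c_0>0$ with $\int|Dp_t(y)|\,dy\le c_0t^{-1/\alpha}$ for all $t\in(0,T]$. (H$_p$) $H:[0,T]\times\mathbb R^d\times\mathbb R^d\to\mathbb R$ is continuous, and for each $R>0$ there are constants $H_0,L_R>0$ with $|H(t,x,0)|\le H_0$ and $|H(t,x,p)-H(t,x,q)|\le L_R|p-q|$ for all $t\in(0,T)$, $x\in\mathbb R^d$, $p,q\in B(0,R)$. (H$_x$) for each $R>0$ there is $M_R>0$ with $|H(t,x,p)-H(t,x',p)|\le M_R|x-x'|^\beta$ for all $t\in[0,T]$, $p\in B(0,R)$ and $x,x'\in\mathbb R^d$ with $|x-x'|<1$. (U$_0$) $u_0:\mathbb R^d\to\mathbb R$ is bounded and Lipschitz. Assume moreover that either $\alpha+\beta>2$, or (L2) $A=0$ and $\int(1\wedge|z|^\sigma)\,d\mu(z)<\infty$ for some $\sigma\in(\alpha,\alpha+\beta)$. Let $u\in C_b((0,T];C^1_b(\mathbb R^d))$ be a mild solution, that is, for all $t\in(0,T]$ and $x\in\mathbb R^d$, $$u(t,x)=P_t[u_0](x)+\int_0^tP_{t-s}\big[H(s,\cdot,Du(s,\cdot))\big](x)\,ds.$$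 Then $u$ is a classical solution of the viscous Hamilton--Jacobi equation: at every $(t,x)\in(0,T]\times\mathbb R^d$ the time derivative $\partial_tu(t,x)$ (one-sided at $t=T$) exists, $\mathcal Lu(t,x)$ is well defined ($ADu(t,\cdot)$ is differentiable at $x$ and the integral converges absolutely), and $$\partial_tu(t,x)-\mathcal Lu(t,x)-H(t,x,Du(t,x))=0;$$ moreover $u(t,x)\to u_0(x)$ as $t\to0^+$ for every $x\in\mathbb R^d$. -/

import Mathlib

namespace ViscousHJ

noncomputable section

open MeasureTheory Set Filter Topology
open scoped ContDiff

/-- The Euclidean space `ℝᵈ`. -/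
abbrev Rd (d : ℕ) : Type := EuclideanSpace ℝ (Fin d)

/-- `∂ᵢ φ (x)`. -/
def partialDeriv {d : ℕ} (i : Fin d) (φ : Rd d → ℝ) (x : Rd d) : ℝ :=
  fderiv ℝ φ x (EuclideanSpace.single i 1)

/-- A Borel measure with `∫ (1 ∧ |z|²) dμ < ∞`. (A mass at the origin plays no role below, since all
integrands vanish there.) -/
def IsLevyMeasure {d : ℕ} (μ : Measure (Rd d)) : Prop :=
  ∫⁻ z, ENNReal.ofReal (min 1 (‖z‖ ^ 2)) ∂μ < ⊤

/-- The `i`-th component of the vector field `A Dφ`. -/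
def flux {d : ℕ} (A : Matrix (Fin d) (Fin d) ℝ) (φ : Rd d → ℝ) (i : Fin d) (x : Rd d) : ℝ :=
  ∑ j, A i j * partialDeriv j φ x

/-- `φ(x+z) - φ(x) - 1_{|z|<1} Dφ(x)·z`. -/
def levyIntegrand {d : ℕ} (φ : Rd d → ℝ) (x z : Rd d) : ℝ :=
  φ (x + z) - φ x - (if ‖z‖ < 1 then inner ℝ (gradient φ x) z else 0)

/-- The Lévy operator
`𝓛φ(x) = div(A Dφ)(x) + ∫ [φ(x+z) - φ(x) - 1_{|z|<1} Dφ(x)·z] dμ(z)`. -/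
def levyOp {d : ℕ} (A : Matrix (Fin d) (Fin d) ℝ) (μ : Measure (Rd d))
    (φ : Rd d → ℝ) (x : Rd d) : ℝ :=
  (∑ i, partialDeriv i (flux A φ i) x) + ∫ z, levyIntegrand φ x z ∂μ

/-- `𝓛φ(x)` is well defined pointwise: `φ` and the vector field `A Dφ` are differentiable at `x`,
and the nonlocal integral converges absolutely. -/
def LevyOpDefinedAt {d : ℕ} (A : Matrix (Fin d) (Fin d) ℝ) (μ : Measure (Rd d))
    (φ : Rd d → ℝ) (x : Rd d) : Prop :=
  DifferentiableAt ℝ φ x ∧ (∀ i, DifferentiableAt ℝ (flux A φ i) x) ∧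
    Integrable (levyIntegrand φ x) μ

/-- The symbol `ξ·Aξ + ∫ (1 - e^{iξ·z} + iξ·z 1_{|z|<1}) dμ(z)` of `-𝓛`. -/
def levySymbol {d : ℕ} (A : Matrix (Fin d) (Fin d) ℝ) (μ : Measure (Rd d)) (ξ : Rd d) : ℂ :=
  ((∑ i, ∑ j, ξ i * A i j * ξ j : ℝ) : ℂ) +
    ∫ z, (1 - Complex.exp (Complex.I * ((inner ℝ ξ z : ℝ) : ℂ)) +
      (if ‖z‖ < 1 then Complex.I * ((inner ℝ ξ z : ℝ) : ℂ) else 0)) ∂μ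

/-- `p` is the continuous density of the probability measure whose Fourier transform
`ξ ↦ ∫ e^{-iξ·x} p(x) dx` is `e^{-t ψ}`, with `ψ` the symbol. (Total mass one is the
case `ξ = 0` of the last field.) -/
structure IsHeatKernel {d : ℕ} (A : Matrix (Fin d) (Fin d) ℝ) (μ : Measure (Rd d)) (t : ℝ)
    (p : Rd d → ℝ) : Prop where
  continuous : Continuous p
  nonneg : ∀ x, 0 ≤ p x
  integrable : Integrable p
  fourier : ∀ ξ : Rd d,
    ∫ x, Complex.exp (-(Complex.I * ((inner ℝ ξ x : ℝ) : ℂ))) * (p x : ℂ) =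
      Complex.exp (-((t : ℂ) * levySymbol A μ ξ))

/-- The defining properties determine the heat kernel. -/
theorem IsHeatKernel.uniq {d : ℕ} {A : Matrix (Fin d) (Fin d) ℝ} {μ : Measure (Rd d)} {t : ℝ}
    {p q : Rd d → ℝ} (hp : IsHeatKernel A μ t p) (hq : IsHeatKernel A μ t q) : p = q := by
  have key : ∀ {r : Rd d → ℝ}, IsHeatKernel A μ t r →
      IsFiniteMeasure (volume.withDensity fun x => ENNReal.ofReal (r x)) ∧
      ∀ ξ, charFun (volume.withDensity fun x => ENNReal.ofReal (r x)) ξ =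
        Complex.exp (-((t : ℂ) * levySymbol A μ (-ξ))) := by
    intro r hr
    have hf : IsFiniteMeasure (volume.withDensity fun x => ENNReal.ofReal (r x)) :=
      isFiniteMeasure_withDensity_ofReal hr.integrable.2
    refine ⟨hf, fun ξ => ?_⟩
    rw [← hr.fourier, charFun_apply, integral_withDensity_eq_integral_toReal_smul
      (by have := hr.continuous; fun_prop) (by simp)]
    congr 1; ext x
    rw [ENNReal.toReal_ofReal (hr.nonneg x)]
    simp only [Complex.real_smul, inner_neg_left, real_inner_comm]
    rw [mul_comm]; congr 2; push_cast; ring_nf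
  obtain ⟨h1, h2⟩ := key hp
  obtain ⟨h3, h4⟩ := key hq
  have := Measure.ext_of_charFun (funext fun ξ => (h2 ξ).trans (h4 ξ).symm)
  have h5 : (fun x => ENNReal.ofReal (p x)) =ᵐ[volume] fun x => ENNReal.ofReal (q x) := by
    refine (withDensity_eq_iff ?_ ?_ ?_).1 this
    · have := hp.continuous; fun_prop
    · have := hq.continuous; fun_prop
    · exact (hp.integrable.lintegral_lt_top).ne
  refine (Continuous.ae_eq_iff_eq volume hp.continuous hq.continuous).1 ?_
  filter_upwards [h5] with x hx
  exact (ENNReal.ofReal_eq_ofReal_iff (hp.nonneg x) (hq.nonneg x)).1 hx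

/-- The heat kernel `p_t` of `𝓛`: the unique function satisfying `IsHeatKernel A μ t`, whenever the
heat measure at time `t > 0` has a continuous density. -/
def heatKernel {d : ℕ} (A : Matrix (Fin d) (Fin d) ℝ) (μ : Measure (Rd d)) (t : ℝ) : Rd d → ℝ :=
  Classical.epsilon (IsHeatKernel A μ t)

/-- The heat semigroup `P_t φ (x) = ∫ p_t(x-y) φ(y) dy`, for `t > 0`. -/
def heatSemigroup {d : ℕ} (A : Matrix (Fin d) (Fin d) ℝ) (μ : Measure (Rd d)) (t : ℝ)
    (φ : Rd d → ℝ) (x : Rd d) : ℝ :=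
  ∫ y, heatKernel A μ t (x - y) * φ y

/-- `φ ∈ C_b^∞(ℝᵈ)`. -/
def MemCbInfty {d : ℕ} (φ : Rd d → ℝ) : Prop :=
  ContDiff ℝ ∞ φ ∧ ∀ n : ℕ, ∃ C : ℝ, ∀ x, ‖iteratedFDeriv ℝ n φ x‖ ≤ C

/-- Condition (L1) with exponent `α` on `(0,T]`: the heat measures have densities
`p_t ∈ C_b^∞(ℝᵈ)`, and `∫ |Dp_t| dy ≤ c₀ t^{-1/α}`. -/
def CondL1 {d : ℕ} (A : Matrix (Fin d) (Fin d) ℝ) (μ : Measure (Rd d)) (T α : ℝ) : Prop :=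
  (∀ t ∈ Ioc 0 T, (∃ p, IsHeatKernel A μ t p) ∧ MemCbInfty (heatKernel A μ t)) ∧
  ∃ c₀ : ℝ, 0 < c₀ ∧ ∀ t ∈ Ioc 0 T,
    Integrable (fun y => fderiv ℝ (heatKernel A μ t) y) ∧
    ∫ y, ‖fderiv ℝ (heatKernel A μ t) y‖ ≤ c₀ * t ^ (-(1 / α))

/-- Condition (L2): no second order part, and `∫ (1 ∧ |z|^σ) dμ < ∞` for some
`σ ∈ (α, α + β)`. -/
def CondL2 {d : ℕ} (A : Matrix (Fin d) (Fin d) ℝ) (μ : Measure (Rd d)) (α β : ℝ) : Prop :=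
  A = 0 ∧ ∃ σ ∈ Ioo α (α + β), ∫⁻ z, ENNReal.ofReal (min 1 (‖z‖ ^ σ)) ∂μ < ⊤

/-- Condition (H_p) on the Hamiltonian `H(t,x,p)`. -/
def CondHp {d : ℕ} (T : ℝ) (H : ℝ → Rd d → Rd d → ℝ) : Prop :=
  ContinuousOn (fun q : ℝ × Rd d × Rd d => H q.1 q.2.1 q.2.2) (Icc 0 T ×ˢ univ) ∧
  ∀ R : ℝ, 0 < R → ∃ H₀ L : ℝ, 0 < H₀ ∧ 0 < L ∧
    ∀ t ∈ Ioo 0 T, ∀ x, ∀ p ∈ Metric.ball (0 : Rd d) R, ∀ q ∈ Metric.ball (0 : Rd d) R,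
      |H t x 0| ≤ H₀ ∧ |H t x p - H t x q| ≤ L * ‖p - q‖

/-- Condition (H_x): `β`-Hölder continuity of `H` in `x`, locally uniformly in `p`. -/
def CondHx {d : ℕ} (T β : ℝ) (H : ℝ → Rd d → Rd d → ℝ) : Prop :=
  ∀ R : ℝ, 0 < R → ∃ M : ℝ, 0 < M ∧
    ∀ t ∈ Icc 0 T, ∀ p ∈ Metric.ball (0 : Rd d) R, ∀ x x' : Rd d, ‖x - x'‖ < 1 →
      |H t x p - H t x' p| ≤ M * ‖x - x'‖ ^ β

/-- Condition (U₀): `u₀` is bounded and Lipschitz. -/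
def CondU0 {d : ℕ} (u₀ : Rd d → ℝ) : Prop :=
  (∃ C : ℝ, ∀ x, |u₀ x| ≤ C) ∧ ∃ K : NNReal, LipschitzWith K u₀

/-- `‖φ‖_∞ + ‖Dφ‖_∞`, as an extended nonnegative number. -/
def c1Norm {d : ℕ} (φ : Rd d → ℝ) : ENNReal :=
  (⨆ x, ‖φ x‖ₑ) + ⨆ x, ‖fderiv ℝ φ x‖ₑ

/-- `φ ∈ C_b^1(ℝᵈ)`. -/
def MemCb1 {d : ℕ} (φ : Rd d → ℝ) : Prop :=
  ContDiff ℝ 1 φ ∧ c1Norm φ < ⊤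

/-- `u ∈ C((0,T]; C_b^1(ℝᵈ))`. -/
def MemCCb1 {d : ℕ} (T : ℝ) (u : ℝ → Rd d → ℝ) : Prop :=
  (∀ t ∈ Ioc 0 T, MemCb1 (u t)) ∧
  ∀ t ∈ Ioc 0 T, Tendsto (fun s => c1Norm (fun x => u s x - u t x)) (𝓝[Ioc 0 T] t) (𝓝 0)

/-- `u ∈ C_b((0,T]; C_b^1(ℝᵈ))`. -/
def MemCbCb1 {d : ℕ} (T : ℝ) (u : ℝ → Rd d → ℝ) : Prop :=
  MemCCb1 T u ∧ ∃ M : NNReal, ∀ t ∈ Ioc 0 T, c1Norm (u t) ≤ M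

/-- Mild solutions on `(0,T]`:
`u(t,x) = P_t[u₀](x) + ∫₀ᵗ P_{t-s}[H(s,·,Du(s,·))](x) ds`. -/
def IsMildSolution {d : ℕ} (A : Matrix (Fin d) (Fin d) ℝ) (μ : Measure (Rd d)) (T : ℝ)
    (H : ℝ → Rd d → Rd d → ℝ) (u₀ : Rd d → ℝ) (u : ℝ → Rd d → ℝ) : Prop :=
  MemCCb1 T u ∧ ∀ t ∈ Ioc 0 T, ∀ x,
    u t x = heatSemigroup A μ t u₀ x +
      ∫ s in (0 : ℝ)..t, heatSemigroup A μ (t - s) (fun y => H s y (gradient (u s) y)) x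

/-- Classical solutions on `(0,T]`: the equation `∂ₜu - 𝓛u - H(t,x,Du) = 0` holds at every point,
all terms being well defined, and `u(t,x) → u₀(x)` as `t → 0`. The time derivative is one-sided
at `t = T` and two-sided at `0 < t < T`. -/
structure IsClassicalSolution {d : ℕ} (A : Matrix (Fin d) (Fin d) ℝ) (μ : Measure (Rd d)) (T : ℝ)
    (H : ℝ → Rd d → Rd d → ℝ) (u₀ : Rd d → ℝ) (u : ℝ → Rd d → ℝ) : Prop where
  defined : ∀ t ∈ Ioc 0 T, ∀ x, LevyOpDefinedAt A μ (u t) x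
  equation : ∀ t ∈ Ioc 0 T, ∀ x,
    HasDerivWithinAt (fun s => u s x) (levyOp A μ (u t) x + H t x (gradient (u t) x)) (Ioc 0 T) t
  initial : ∀ x, Tendsto (fun t => u t x) (𝓝[>] 0) (𝓝 (u₀ x))

end

end ViscousHJ

open MeasureTheory ViscousHJ

open MeasureTheory Set Filter Topology
open scoped ContDiff

namespace ViscousHJ

/-! Put f(s,y) = H(s, y, Du(s,y)). Since u is bounded in C¹, f is bounded and continuous, and u
solves a linear heat equation with source f in Duhamel form. It remains to prove enough regularity
of u for 𝓛u to make sense, and then to differentiate Duhamel's formula.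

Regularity. The gradient bound in (L1), together with approximation of Hölder functions by Lipschitz
ones and the semigroup law, shows that P_r maps θ-Hölder functions to functions with δ-Hölder
gradient, with constant of order r^{-(1+δ-θ)/α} (`CondL1.exists_secondDiffBound_avg`). This is
integrable at r = 0 when 1+δ-θ < α, so in Duhamel's formula, restarted at a positive time, a
θ-Hölder source gives u(t) a δ-Hölder gradient (`IsDuhamelSolution.exists_secondDiffBound`). By
(H_p) and (H_x), a δ-Hölder gradient with δ ≤ β makes f δ-Hölder again. Each round can gain (α-1)/2,
so finitely many rounds, starting from mere boundedness, make f β-Hölder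
(`IsDuhamelSolution.locallyHolder`). One further use of the estimate gives a δ-Hölder gradient for
every δ ≤ 1 with 1+δ < α+β. If α+β > 2, one takes δ = 1; moreover u(t) differs from the twice
differentiable P_η u(t-η) by a term of small C^{1,1} seminorm, so second derivatives exist and are
continuous (`IsDuhamelSolution.hasContinuousHessian`). Under (L2), δ = σ-1 suffices for the nonlocal
integral and there is no local part.

The equation. Kolmogorov's equation is read off from characteristic functions: p_{τ+b} - p_τ is the
time integral over [0,b] of p_r * 𝓛p_τ (`CondL1.avg_sub_avg`). Hence P_τ u has right time derivative
𝓛P_τ u + P_τ f. Integrating in time and letting τ → 0 by dominated convergence gives u(b) - u(a) = ∫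
(𝓛u + f) over [a,b] (`IsLevyRegular.integral_eq_sub`), and the integrand is continuous in time.

Gradient regularity is expressed through second differences of u, which pass through averages and
time integrals without differentiating under the integral sign. -/

/-- The average `x ↦ ∫ g (x - y) dρ(y)` of `g` against a measure `ρ`. -/
noncomputable def avg {d : ℕ} (ρ : Measure (Rd d)) (g : Rd d → ℝ) (x : Rd d) : ℝ :=
  ∫ y, g (x - y) ∂ρ

/-! ### Averages of bounded functions against finite measures. -/

section avg

variable {d : ℕ} {ρ : Measure (Rd d)} {g h : Rd d → ℝ} {M N : ℝ}

theorem integrable_translate [IsFiniteMeasure ρ] (hg : Continuous g) (hM : ∀ x, |g x| ≤ M)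
    (x : Rd d) : Integrable (fun y => g (x - y)) ρ :=
  Integrable.of_bound (by fun_prop) M (.of_forall fun y => hM _)

theorem abs_avg_le [IsProbabilityMeasure ρ] (hM : ∀ x, |g x| ≤ M) (x : Rd d) :
    |avg ρ g x| ≤ M := by
  have := norm_integral_le_of_norm_le_const (μ := ρ) (f := fun y => g (x - y)) (C := M)
    (.of_forall fun y => hM (x - y))
  simpa [avg] using this

theorem continuous_avg [IsFiniteMeasure ρ] (hg : Continuous g) (hM : ∀ x, |g x| ≤ M) :
    Continuous (avg ρ g) := by
  refine continuous_of_dominated (bound := fun _ => M) (fun x => by fun_prop)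
    (fun x => .of_forall fun y => hM _) (integrable_const _) (.of_forall fun y => by fun_prop)

theorem avg_add [IsFiniteMeasure ρ] (hg : Continuous g) (hM : ∀ x, |g x| ≤ M)
    (hh : Continuous h) (hN : ∀ x, |h x| ≤ N) (x : Rd d) :
    avg ρ (fun y => g y + h y) x = avg ρ g x + avg ρ h x :=
  integral_add (integrable_translate hg hM x) (integrable_translate hh hN x)

theorem avg_sub [IsFiniteMeasure ρ] (hg : Continuous g) (hM : ∀ x, |g x| ≤ M)
    (hh : Continuous h) (hN : ∀ x, |h x| ≤ N) (x : Rd d) :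
    avg ρ (fun y => g y - h y) x = avg ρ g x - avg ρ h x :=
  integral_sub (integrable_translate hg hM x) (integrable_translate hh hN x)

theorem avg_shift (w x : Rd d) : avg ρ (fun y => g (y + w)) x = avg ρ g (x + w) := by
  simp only [avg]; congr 1; ext y; congr 1; abel

/-- Fubini in additive form; together with `CondL1.heatMeasure_conv` it yields the semigroup law for
averages. -/
theorem avg_conv {σ : Measure (Rd d)} [IsFiniteMeasure ρ] [IsFiniteMeasure σ]
    (hg : Continuous g) (hM : ∀ x, |g x| ≤ M) (x : Rd d) :
    avg (ρ.conv σ) g x = avg ρ (avg σ g) x := by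
  simp only [avg]
  rw [integral_conv (integrable_translate hg hM x)]
  simp only [sub_sub]

theorem avg_lipschitz [IsProbabilityMeasure ρ] (hg : Continuous g) (hM : ∀ x, |g x| ≤ M) {K : ℝ}
    (hK : ∀ x x', |g x - g x'| ≤ K * ‖x - x'‖) (x x' : Rd d) :
    |avg ρ g x - avg ρ g x'| ≤ K * ‖x - x'‖ := by
  rw [avg, avg, ← integral_sub (integrable_translate hg hM x) (integrable_translate hg hM x')]
  have := norm_integral_le_of_norm_le_const (μ := ρ) (f := fun y => g (x - y) - g (x' - y))
    (C := K * ‖x - x'‖) (.of_forall fun y => by simpa using hK (x - y) (x' - y))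
  simpa using this

/-- The derivative of an average of a bounded `C¹` function with bounded derivative. -/
theorem hasFDerivAt_avg [IsFiniteMeasure ρ] (hg : ContDiff ℝ 1 g) (hM : ∀ x, |g x| ≤ M)
    (hN : ∀ x, ‖fderiv ℝ g x‖ ≤ N) (x : Rd d) :
    HasFDerivAt (avg ρ g) (∫ y, fderiv ℝ g (x - y) ∂ρ) x := by
  have hc := hg.continuous
  have hc' := hg.continuous_fderiv one_ne_zero
  refine hasFDerivAt_integral_of_dominated_of_fderiv_le (F := fun x y => g (x - y))
    (F' := fun x y => fderiv ℝ g (x - y)) (bound := fun _ => N) univ_mem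
    (.of_forall fun x => by fun_prop) (integrable_translate hc hM x) (by fun_prop)
    (.of_forall fun y x _ => hN _) (integrable_const _) (.of_forall fun y x _ => ?_)
  exact (hasFDerivAt_comp_sub y).2 (hg.differentiable one_ne_zero).differentiableAt.hasFDerivAt

/-- The derivative falls on `g` here, and on the kernel in `CondL1.fderiv_avg_eq_kernel`. This form
keeps bounds on derivatives uniform as the heat time tends to zero. -/
theorem fderiv_avg_apply [IsFiniteMeasure ρ] (hg : ContDiff ℝ 1 g) (hM : ∀ x, |g x| ≤ M)
    (hN : ∀ x, ‖fderiv ℝ g x‖ ≤ N) (x v : Rd d) :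
    fderiv ℝ (avg ρ g) x v = avg ρ (fun y => fderiv ℝ g y v) x := by
  rw [(hasFDerivAt_avg hg hM hN x).fderiv, avg, ContinuousLinearMap.integral_apply]
  have hc' := hg.continuous_fderiv one_ne_zero
  exact Integrable.of_bound (by fun_prop) N (.of_forall fun y => hN _)

end avg

/-! ### Convolution of a bounded continuous function with an integrable kernel. -/

section kernel

variable {d : ℕ} {φ G : Rd d → ℝ} {M : ℝ}

theorem integrable_kernel_mul {F : Type*} [NormedAddCommGroup F] [NormedSpace ℝ F]
    {ψ : Rd d → F} (h : Integrable ψ) (hG : Continuous G) (hM : ∀ x, |G x| ≤ M) (x : Rd d) :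
    Integrable (fun y => G (x - y) • ψ y) :=
  h.bdd_smul M (φ := fun y => G (x - y)) (by fun_prop) (.of_forall fun y => hM _)

theorem continuous_kernel_mul {F : Type*} [NormedAddCommGroup F] [NormedSpace ℝ F]
    {ψ : Rd d → F} (h : Integrable ψ) (hG : Continuous G) (hM : ∀ x, |G x| ≤ M) :
    Continuous (fun x => ∫ y, G (x - y) • ψ y) := by
  refine continuous_of_dominated (bound := fun y => M * ‖ψ y‖)
    (fun x => (integrable_kernel_mul h hG hM x).aestronglyMeasurable)
    (fun x => .of_forall fun y => ?_) (h.norm.const_mul M) (.of_forall fun y => by fun_prop)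
  rw [norm_smul]
  exact mul_le_mul_of_nonneg_right (hM _) (norm_nonneg _)

theorem norm_kernel_mul_le {F : Type*} [NormedAddCommGroup F] [NormedSpace ℝ F]
    {ψ : Rd d → F} (h : Integrable ψ) (hM : ∀ x, |G x| ≤ M) (x : Rd d) :
    ‖∫ y, G (x - y) • ψ y‖ ≤ M * ∫ y, ‖ψ y‖ := by
  rw [← integral_const_mul]
  refine norm_integral_le_of_norm_le (h.norm.const_mul M) (.of_forall fun y => ?_)
  rw [norm_smul]
  exact mul_le_mul_of_nonneg_right (hM _) (norm_nonneg _)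

theorem fderiv_segment_integral (hφ : ContDiff ℝ 1 φ) (y h : Rd d) :
    φ (y + h) - φ y = ∫ θ in (0 : ℝ)..1, fderiv ℝ φ (y + θ • h) h := by
  have hc' := hφ.continuous_fderiv one_ne_zero
  have := intervalIntegral.integral_eq_sub_of_hasDerivAt (a := (0 : ℝ)) (b := 1)
    (f := fun θ : ℝ => φ (y + θ • h)) (f' := fun θ => fderiv ℝ φ (y + θ • h) h) ?_
    (Continuous.intervalIntegrable (by fun_prop) _ _)
  · rw [this]; simp
  · intro θ _
    have h1 : HasDerivAt (fun θ : ℝ => y + θ • h) h θ := by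
      simpa using ((hasDerivAt_id θ).smul_const h).const_add y
    exact ((hφ.differentiable one_ne_zero).differentiableAt.hasFDerivAt).comp_hasDerivAt θ h1

/-- `G` is only continuous, so the shift by `h` is moved onto `φ`, the increment of `φ` is written
as an integral of its derivative along the segment, Fubini is applied, and the shift by `θ • h` is
moved back onto `G`. -/
theorem kernel_increment (hφ : ContDiff ℝ 1 φ) (h1 : Integrable φ)
    (h2 : Integrable (fderiv ℝ φ)) (hG : Continuous G) (hM : ∀ x, |G x| ≤ M) (x h : Rd d) :
    (∫ y, G (x + h - y) • φ y) - ∫ y, G (x - y) • φ y =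
      ∫ θ in (0 : ℝ)..1, (∫ y, G (x + θ • h - y) • fderiv ℝ φ y) h := by
  have hc' := hφ.continuous_fderiv one_ne_zero
  have e1 : ∫ y, G (x + h - y) • φ y = ∫ y, G (x - y) • φ (y + h) := by
    rw [← integral_add_right_eq_self _ h]; congr 1; ext y; congr 2; abel
  have e2 : ∀ θ : ℝ, (∫ y, G (x + θ • h - y) • fderiv ℝ φ y) h =
      ∫ y, G (x - y) • fderiv ℝ φ (y + θ • h) h := by
    intro θ
    rw [ContinuousLinearMap.integral_apply (integrable_kernel_mul h2 hG hM _),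
      ← integral_add_right_eq_self _ (θ • h)]
    congr 1; ext y
    have : x + θ • h - (y + θ • h) = x - y := by abel
    simp [this]
  have h1' : Integrable (fun y => φ (y + h)) := h1.comp_add_right h
  rw [e1, ← integral_sub (integrable_kernel_mul h1' hG hM x) (integrable_kernel_mul h1 hG hM x)]
  simp_rw [e2, ← smul_sub, fderiv_segment_integral hφ, smul_eq_mul,
    ← intervalIntegral.integral_const_mul]
  simp_rw [intervalIntegral.integral_of_le zero_le_one]
  rw [integral_integral_swap]
  rw [integrable_prod_iff' (Continuous.aestronglyMeasurable (by fun_prop))]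
  have key : ∀ θ : ℝ, Integrable fun y => G (x - y) * fderiv ℝ φ (y + θ • h) h := fun θ =>
    integrable_kernel_mul (ψ := fun y => fderiv ℝ φ (y + θ • h) h)
      ((h2.comp_add_right (θ • h)).apply_continuousLinearMap h) hG hM x
  refine ⟨.of_forall key, ?_⟩
  refine Integrable.of_bound (C := ∫ y, M * (‖fderiv ℝ φ y‖ * ‖h‖)) ?_ (.of_forall fun θ => ?_)
  · exact (Continuous.aestronglyMeasurable (by fun_prop) : AEStronglyMeasurable
      (Function.uncurry fun (θ : ℝ) y => ‖G (x - y) * fderiv ℝ φ (y + θ • h) h‖)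
      ((volume.restrict (Ioc 0 1)).prod volume)).integral_prod_right'
  · rw [Real.norm_of_nonneg (by positivity),
      ← integral_add_right_eq_self (fun y => M * (‖fderiv ℝ φ y‖ * ‖h‖)) (θ • h)]
    refine integral_mono (key θ).norm
      (((h2.comp_add_right (θ • h)).norm.mul_const _).const_mul _) fun y => ?_
    simp only [Function.uncurry, norm_mul]
    exact mul_le_mul (hM _) (ContinuousLinearMap.le_opNorm _ _) (norm_nonneg _)
      ((abs_nonneg _).trans (hM 0))

/-- A convolution can be differentiated on a `W^{1,1}` kernel. -/
theorem hasFDerivAt_kernel (hφ : ContDiff ℝ 1 φ) (h1 : Integrable φ)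
    (h2 : Integrable (fderiv ℝ φ)) (hG : Continuous G) (hM : ∀ x, |G x| ≤ M) (x : Rd d) :
    HasFDerivAt (fun x => ∫ y, G (x - y) • φ y) (∫ y, G (x - y) • fderiv ℝ φ y) x := by
  have hℓ := continuous_kernel_mul h2 hG hM
  rw [hasFDerivAt_iff_isLittleO_nhds_zero, Asymptotics.isLittleO_iff]
  intro ε hε
  obtain ⟨δ, hδ, H⟩ := Metric.continuous_iff.1 hℓ x ε hε
  filter_upwards [Metric.ball_mem_nhds 0 hδ] with h hh
  rw [kernel_increment hφ h1 h2 hG hM]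
  set ℓ := fun x => ∫ y, G (x - y) • fderiv ℝ φ y
  have : ∫ θ in (0 : ℝ)..1, ℓ (x + θ • h) h = (∫ θ in (0 : ℝ)..1, (ℓ (x + θ • h) h - ℓ x h)) +
      ℓ x h := by
    rw [intervalIntegral.integral_sub (Continuous.intervalIntegrable (by fun_prop) _ _)
      (by simp)]
    simp
  change ‖(∫ θ in (0 : ℝ)..1, ℓ (x + θ • h) h) - ℓ x h‖ ≤ _
  rw [this, add_sub_cancel_right]
  have := intervalIntegral.norm_integral_le_of_norm_le_const (a := (0 : ℝ)) (b := 1)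
    (f := fun θ => ℓ (x + θ • h) h - ℓ x h) (C := ε * ‖h‖) ?_
  · simpa using this
  · intro θ hθ
    rw [uIoc_of_le zero_le_one] at hθ
    have h3 := H (x + θ • h) (by
      rw [dist_eq_norm, add_sub_cancel_left, norm_smul, Real.norm_of_nonneg hθ.1.le]
      have : ‖h‖ < δ := by simpa using hh
      nlinarith [hθ.2, norm_nonneg h])
    rw [← sub_apply]
    refine (ContinuousLinearMap.le_opNorm _ _).trans ?_
    rw [dist_eq_norm] at h3
    gcongr

end kernel

/-! ### Heat measures: characteristic functions, semigroup law, continuity of the kernel. -/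

/-- The heat measure of `𝓛` at time `t ≥ 0`; at time `0` it is the unit mass at the origin. -/
noncomputable def heatMeasure {d : ℕ} (A : Matrix (Fin d) (Fin d) ℝ) (μ : Measure (Rd d)) (t : ℝ) :
    Measure (Rd d) :=
  if t = 0 then Measure.dirac 0
  else volume.withDensity fun x => ENNReal.ofReal (heatKernel A μ t x)

section heat

variable {d : ℕ} {A : Matrix (Fin d) (Fin d) ℝ} {μ : Measure (Rd d)} {T α : ℝ}

theorem heatMeasure_of_pos {t : ℝ} (ht : 0 < t) : heatMeasure A μ t =
    volume.withDensity fun x => ENNReal.ofReal (heatKernel A μ t x) := if_neg ht.ne'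

theorem avg_heatMeasure_zero {g : Rd d → ℝ} (x : Rd d) :
    avg (heatMeasure A μ 0) g x = g x := by
  simp [heatMeasure, avg]

theorem CondL1.isHeatKernel (h : CondL1 A μ T α) {t : ℝ} (ht : t ∈ Ioc 0 T) :
    IsHeatKernel A μ t (heatKernel A μ t) := Classical.epsilon_spec (h.1 t ht).1

theorem levySymbol_zero : levySymbol A μ 0 = 0 := by simp [levySymbol]

/-- `charFun` uses the character with exponent +i while the heat kernel is normalised with -i; this
is why the symbol appears at `-ξ` throughout. -/
theorem charFun_withDensity_heatKernel {t : ℝ} {p : Rd d → ℝ} (hp : IsHeatKernel A μ t p)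
    (ξ : Rd d) : charFun (volume.withDensity fun x => ENNReal.ofReal (p x)) ξ =
      Complex.exp (-((t : ℂ) * levySymbol A μ (-ξ))) := by
  have := hp.continuous
  rw [← hp.fourier, charFun_apply, integral_withDensity_eq_integral_toReal_smul
    (by fun_prop) (by simp)]
  congr 1; ext x
  rw [ENNReal.toReal_ofReal (hp.nonneg x)]
  simp only [Complex.real_smul, inner_neg_left, real_inner_comm]
  rw [mul_comm]; congr 2; push_cast; ring_nf

theorem isProbabilityMeasure_of_charFun_zero {ρ : Measure (Rd d)} [IsFiniteMeasure ρ]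
    (h : charFun ρ 0 = 1) : IsProbabilityMeasure ρ := by
  rw [charFun_zero] at h
  exact isProbabilityMeasure_iff_real.2 (by exact_mod_cast h)

theorem CondL1.isFiniteMeasure_withDensity (h : CondL1 A μ T α) {t : ℝ} (ht : t ∈ Ioc 0 T) :
    IsFiniteMeasure (volume.withDensity fun x => ENNReal.ofReal (heatKernel A μ t x)) :=
  isFiniteMeasure_withDensity_ofReal (h.isHeatKernel ht).integrable.2

theorem CondL1.isProbabilityMeasure (h : CondL1 A μ T α) {t : ℝ} (ht : t ∈ Icc 0 T) :
    IsProbabilityMeasure (heatMeasure A μ t) := by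
  rcases ht.1.eq_or_lt with rfl | h0
  · rw [heatMeasure, if_pos rfl]; infer_instance
  · rw [heatMeasure_of_pos h0]
    have := h.isFiniteMeasure_withDensity ⟨h0, ht.2⟩
    refine isProbabilityMeasure_of_charFun_zero ?_
    rw [charFun_withDensity_heatKernel (h.isHeatKernel ⟨h0, ht.2⟩)]
    simp [levySymbol_zero]

theorem CondL1.charFun_heatMeasure (h : CondL1 A μ T α) {t : ℝ} (ht : t ∈ Icc 0 T) (ξ : Rd d) :
    charFun (heatMeasure A μ t) ξ = Complex.exp (-((t : ℂ) * levySymbol A μ (-ξ))) := by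
  rcases ht.1.eq_or_lt with rfl | h0
  · simp [heatMeasure]
  · rw [heatMeasure_of_pos h0, charFun_withDensity_heatKernel (h.isHeatKernel ⟨h0, ht.2⟩)]

/-- Characteristic functions determine finite measures, and here they are exponentials linear in
time. The Dirac mass at time zero makes the law hold up to the endpoints. -/
theorem CondL1.heatMeasure_conv (h : CondL1 A μ T α) {s t : ℝ} (hs : 0 ≤ s) (ht : 0 ≤ t)
    (hst : s + t ≤ T) : (heatMeasure A μ s).conv (heatMeasure A μ t) = heatMeasure A μ (s + t) := by
  have := h.isProbabilityMeasure (t := s) ⟨hs, by linarith⟩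
  have := h.isProbabilityMeasure (t := t) ⟨ht, by linarith⟩
  have := h.isProbabilityMeasure (t := s + t) ⟨by linarith, hst⟩
  refine Measure.ext_of_charFun (funext fun ξ => ?_)
  rw [charFun_conv, h.charFun_heatMeasure ⟨hs, by linarith⟩,
    h.charFun_heatMeasure ⟨ht, by linarith⟩, h.charFun_heatMeasure ⟨by linarith, hst⟩,
    ← Complex.exp_add]
  push_cast; ring_nf

theorem CondL1.avg_avg (h : CondL1 A μ T α) {s t : ℝ} (hs : 0 ≤ s) (ht : 0 ≤ t)
    (hst : s + t ≤ T) {g : Rd d → ℝ} {M : ℝ} (hg : Continuous g) (hM : ∀ x, |g x| ≤ M) (x : Rd d) :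
    avg (heatMeasure A μ s) (avg (heatMeasure A μ t) g) x = avg (heatMeasure A μ (s + t)) g x := by
  have := h.isProbabilityMeasure (t := s) ⟨hs, by linarith⟩
  have := h.isProbabilityMeasure (t := t) ⟨ht, by linarith⟩
  rw [← h.heatMeasure_conv hs ht hst, avg_conv hg hM]

/-- Lévy's continuity theorem: characteristic functions depend continuously on time, so the heat
measures do so weakly, down to time 0. -/
theorem CondL1.continuousOn_avg (h : CondL1 A μ T α) {g : Rd d → ℝ} {M : ℝ} (hg : Continuous g)
    (hM : ∀ x, |g x| ≤ M) (x : Rd d) :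
    ContinuousOn (fun r => avg (heatMeasure A μ r) g x) (Icc 0 T) := by
  rw [continuousOn_iff_continuous_domRestrict]
  rw [continuous_iff_seqContinuous]
  intro r r₀ hr
  let pm : Icc 0 T → ProbabilityMeasure (Rd d) := fun r =>
    ⟨heatMeasure A μ r, h.isProbabilityMeasure r.2⟩
  have key : Tendsto (fun n => pm (r n)) atTop (𝓝 (pm r₀)) := by
    refine ProbabilityMeasure.tendsto_of_tendsto_charFun fun ξ => ?_
    simp only [pm, ProbabilityMeasure.coe_mk, h.charFun_heatMeasure (Subtype.coe_prop _)]
    have : Continuous fun t : ℝ => Complex.exp (-((t : ℂ) * levySymbol A μ (-ξ))) := by fun_prop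
    exact (this.tendsto _).comp ((continuous_subtype_val.tendsto _).comp hr)
  rw [ProbabilityMeasure.tendsto_iff_forall_integral_tendsto] at key
  exact key (BoundedContinuousFunction.ofNormedAddCommGroup (fun y => g (x - y)) (by fun_prop) M
    fun y => hM _)

theorem heatSemigroup_eq_kernel_integral (t : ℝ) (g : Rd d → ℝ) (x : Rd d) :
    heatSemigroup A μ t g x = ∫ y, g (x - y) • heatKernel A μ t y := by
  rw [heatSemigroup, ← integral_sub_left_eq_self _ volume x]
  congr 1; ext y; simp [mul_comm]

theorem CondL1.avg_eq_kernel_integral (h : CondL1 A μ T α) {t : ℝ} (ht : t ∈ Ioc 0 T)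
    (g : Rd d → ℝ) (x : Rd d) :
    avg (heatMeasure A μ t) g x = ∫ y, g (x - y) • heatKernel A μ t y := by
  have := (h.isHeatKernel ht).continuous
  rw [avg, heatMeasure_of_pos ht.1, integral_withDensity_eq_integral_toReal_smul
    (by fun_prop) (by simp)]
  congr 1; ext y
  rw [ENNReal.toReal_ofReal ((h.isHeatKernel ht).nonneg y), smul_eq_mul, smul_eq_mul, mul_comm]

theorem CondL1.heatSemigroup_eq_avg (h : CondL1 A μ T α) {t : ℝ} (ht : t ∈ Ioc 0 T)
    (g : Rd d → ℝ) (x : Rd d) : heatSemigroup A μ t g x = avg (heatMeasure A μ t) g x := by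
  rw [h.avg_eq_kernel_integral ht, heatSemigroup_eq_kernel_integral]

theorem MemCbInfty.exists_bounds {φ : Rd d → ℝ} (h : MemCbInfty φ) :
    ∃ C, (∀ x, |φ x| ≤ C) ∧ (∀ x, ‖fderiv ℝ φ x‖ ≤ C) ∧
      ∀ x, ‖fderiv ℝ (fderiv ℝ φ) x‖ ≤ C := by
  obtain ⟨C₀, h₀⟩ := h.2 0
  obtain ⟨C₁, h₁⟩ := h.2 1
  obtain ⟨C₂, h₂⟩ := h.2 2
  refine ⟨max C₀ (max C₁ C₂), fun x => ?_, fun x => ?_, fun x => ?_⟩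
  · have := h₀ x
    rw [norm_iteratedFDeriv_zero] at this
    exact this.trans (le_max_left _ _)
  · have := h₁ x
    rw [norm_iteratedFDeriv_one] at this
    exact this.trans ((le_max_left _ _).trans (le_max_right _ _))
  · have := h₂ x
    rw [← norm_iteratedFDeriv_fderiv, norm_iteratedFDeriv_one] at this
    exact this.trans ((le_max_right _ _).trans (le_max_right _ _))

/-- The convolution is a continuous density with the Fourier transform required at time `a + b`;
uniqueness then turns the semigroup law for measures into a pointwise identity of densities. -/
theorem isHeatKernel_avg (h : CondL1 A μ T α) {a b : ℝ} (ha : 0 < a) (hb : 0 < b)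
    (hab : a + b ≤ T) :
    IsHeatKernel A μ (a + b) (avg (heatMeasure A μ a) (heatKernel A μ b)) := by
  have hb' : b ∈ Ioc 0 T := ⟨hb, by linarith⟩
  have ha' : a ∈ Icc 0 T := ⟨ha.le, by linarith⟩
  have hp := h.isHeatKernel hb'
  have := h.isProbabilityMeasure ha'
  obtain ⟨C, hC, -⟩ := (h.1 b hb').2.exists_bounds
  have hpc := hp.continuous
  have hint : Integrable (fun q : Rd d × Rd d => heatKernel A μ b (q.1 - q.2))
      (volume.prod (heatMeasure A μ a)) := by
    rw [integrable_prod_iff' (Continuous.aestronglyMeasurable (by fun_prop))]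
    refine ⟨.of_forall fun w => hp.integrable.comp_sub_right w, ?_⟩
    simp only [integral_sub_right_eq_self (fun y => ‖heatKernel A μ b y‖)]
    exact integrable_const _
  refine ⟨continuous_avg hpc hC, fun x => integral_nonneg fun y => hp.nonneg _,
    hint.integral_prod_left, fun ξ => ?_⟩
  have e : ∀ y : Rd d, Complex.exp (-(Complex.I * ((inner ℝ ξ y : ℝ) : ℂ))) *
      ((avg (heatMeasure A μ a) (heatKernel A μ b) y : ℝ) : ℂ) =
      ∫ w, Complex.exp (-(Complex.I * ((inner ℝ ξ y : ℝ) : ℂ))) *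
        ((heatKernel A μ b (y - w) : ℝ) : ℂ) ∂(heatMeasure A μ a) := by
    intro y
    rw [integral_const_mul, avg]
    congr 1; exact integral_ofReal.symm
  simp_rw [e]
  rw [integral_integral_swap]
  · have e2 : ∀ w : Rd d, ∫ y, Complex.exp (-(Complex.I * ((inner ℝ ξ y : ℝ) : ℂ))) *
        ((heatKernel A μ b (y - w) : ℝ) : ℂ) = Complex.exp ((inner ℝ w (-ξ) : ℝ) * Complex.I) *
          Complex.exp (-((b : ℂ) * levySymbol A μ ξ)) := by
      intro w
      rw [← hp.fourier ξ, ← integral_const_mul, ← integral_add_right_eq_self _ w]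
      congr 1; ext y
      rw [← mul_assoc, ← Complex.exp_add, add_sub_cancel_right]
      congr 2
      rw [inner_add_right, inner_neg_right, real_inner_comm ξ w]
      push_cast; ring
    simp_rw [e2]
    rw [integral_mul_const, ← charFun_apply, h.charFun_heatMeasure ha', ← Complex.exp_add, neg_neg]
    push_cast; ring_nf
  · refine (hint.ofReal (𝕜 := ℂ)).bdd_mul (c := 1) (Continuous.aestronglyMeasurable (by fun_prop))
      (.of_forall fun q => ?_)
    rw [← mul_neg, mul_comm, ← Complex.ofReal_neg, Complex.norm_exp_ofReal_mul_I]

theorem CondL1.heatKernel_eq_avg (h : CondL1 A μ T α) {a b : ℝ} (ha : 0 ≤ a) (hb : 0 < b)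
    (hab : a + b ≤ T) :
    heatKernel A μ (a + b) = avg (heatMeasure A μ a) (heatKernel A μ b) := by
  rcases ha.eq_or_lt with rfl | ha
  · ext x; rw [avg_heatMeasure_zero, zero_add]
  · exact (h.isHeatKernel ⟨by linarith, hab⟩).uniq (isHeatKernel_avg h ha hb hab)

theorem abs_sub_le_of_norm_fderiv_le {φ : Rd d → ℝ} {C : ℝ} (hφ : Differentiable ℝ φ)
    (hC : ∀ x, ‖fderiv ℝ φ x‖ ≤ C) (x y : Rd d) : |φ x - φ y| ≤ C * ‖x - y‖ :=
  convex_univ.norm_image_sub_le_of_norm_fderiv_le (fun x _ => hφ x) (fun x _ => hC x)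
    (mem_univ y) (mem_univ x)

/-- Near `r₀` the kernel is an average of the fixed smooth kernel at time `r₀ / 2`. Averaging
preserves its Lipschitz constant, so continuity in space is uniform in time, while continuity in
time at a fixed point is weak continuity of the heat measures. Joint continuity supplies
measurability for integrals over time and space. -/
theorem CondL1.continuousOn_heatKernel (h : CondL1 A μ T α) :
    ContinuousOn (fun q : ℝ × Rd d => heatKernel A μ q.1 q.2) (Ioc 0 T ×ˢ univ) := by
  rintro ⟨r₀, y₀⟩ ⟨hr₀, -⟩
  simp only at hr₀
  set b := r₀ / 2 with hb
  have hb0 : 0 < b := by have := hr₀.1; positivity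
  have hbT : b ∈ Ioc 0 T := ⟨hb0, by linarith [hr₀.2, hr₀.1]⟩
  obtain ⟨C, hC0, hC1, -⟩ := (h.1 b hbT).2.exists_bounds
  have hsm := (h.1 b hbT).2.1
  have hpc := hsm.continuous
  have key : ∀ r ∈ Ioc b T, ∀ y, heatKernel A μ r y =
      avg (heatMeasure A μ (r - b)) (heatKernel A μ b) y := by
    intro r hr y
    rw [← h.heatKernel_eq_avg (by linarith [hr.1]) hb0 (by linarith [hr.2]), sub_add_cancel]
  have hlip : ∀ r ∈ Ioc b T, ∀ y, |heatKernel A μ r y - heatKernel A μ r y₀| ≤ C * ‖y - y₀‖ := by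
    intro r hr y
    rw [key r hr, key r hr]
    have := h.isProbabilityMeasure (t := r - b) ⟨by linarith [hr.1], by linarith [hr.2]⟩
    exact avg_lipschitz hpc hC0
      (abs_sub_le_of_norm_fderiv_le (hsm.differentiable (by simp)) hC1) y y₀
  have hmem : ∀ᶠ q : ℝ × Rd d in 𝓝[Ioc 0 T ×ˢ univ] (r₀, y₀), q.1 ∈ Ioc b T := by
    have : ∀ᶠ q : ℝ × Rd d in 𝓝 (r₀, y₀), b < q.1 :=
      continuous_fst.continuousAt.eventually (lt_mem_nhds (by simp only; linarith [hr₀.1]))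
    filter_upwards [nhdsWithin_le_nhds this, self_mem_nhdsWithin] with q h1 h2
    exact ⟨h1, h2.1.2⟩
  have hfst : Tendsto (fun q : ℝ × Rd d => q.1 - b) (𝓝[Ioc 0 T ×ˢ univ] (r₀, y₀))
      (𝓝[Icc 0 T] (r₀ - b)) := by
    refine tendsto_nhdsWithin_iff.2 ⟨?_, ?_⟩
    · exact (Continuous.tendsto (by fun_prop : Continuous fun q : ℝ × Rd d => q.1 - b) _).mono_left
        nhdsWithin_le_nhds
    · filter_upwards [hmem] with q hq using ⟨by linarith [hq.1], by linarith [hq.2]⟩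
  have h1 : Tendsto (fun q : ℝ × Rd d => heatKernel A μ q.1 y₀) (𝓝[Ioc 0 T ×ˢ univ] (r₀, y₀))
      (𝓝 (heatKernel A μ r₀ y₀)) := by
    rw [key r₀ ⟨by linarith [hr₀.1], hr₀.2⟩]
    refine ((h.continuousOn_avg hpc hC0 y₀ (r₀ - b) ⟨by linarith [hr₀.1],
      by linarith [hr₀.2]⟩).tendsto.comp hfst).congr' ?_
    filter_upwards [hmem] with q hq
    rw [key _ hq]; rfl
  have h2 : Tendsto (fun q : ℝ × Rd d => heatKernel A μ q.1 q.2 - heatKernel A μ q.1 y₀)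
      (𝓝[Ioc 0 T ×ˢ univ] (r₀, y₀)) (𝓝 0) := by
    refine squeeze_zero_norm' (a := fun q : ℝ × Rd d => C * ‖q.2 - y₀‖) ?_ ?_
    · filter_upwards [hmem] with q hq using hlip _ hq _
    · refine (Continuous.tendsto' (by fun_prop) _ _ ?_).mono_left nhdsWithin_le_nhds
      simp
  simpa [ContinuousWithinAt] using h2.add h1

end heat

/-! ### Estimates in L¹ for increments, Taylor remainders and convolutions. -/

section L1

variable {d : ℕ} {φ : Rd d → ℝ}

/-- Minkowski's inequality for `∫₀¹`. -/
theorem integrable_integral_segment {F : ℝ → Rd d → ℝ} (hF : Continuous (Function.uncurry F))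
    {C : ℝ} (hi : ∀ θ ∈ Ioc (0 : ℝ) 1, Integrable (F θ))
    (hC : ∀ θ ∈ Ioc (0 : ℝ) 1, ∫ y, ‖F θ y‖ ≤ C) :
    Integrable (fun y => ∫ θ in (0 : ℝ)..1, F θ y) ∧
      ∫ y, ‖∫ θ in (0 : ℝ)..1, F θ y‖ ≤ C := by
  have hint : Integrable (Function.uncurry F) ((volume.restrict (Ioc (0 : ℝ) 1)).prod volume) := by
    rw [integrable_prod_iff hF.aestronglyMeasurable]
    refine ⟨(ae_restrict_iff' measurableSet_Ioc).2 (.of_forall fun θ hθ => hi θ hθ), ?_⟩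
    refine Integrable.of_bound (C := C) ?_
      ((ae_restrict_iff' measurableSet_Ioc).2 (.of_forall fun θ hθ => ?_))
    · exact (hF.norm.aestronglyMeasurable (μ := (volume.restrict (Ioc (0 : ℝ) 1)).prod
        volume)).integral_prod_right'
    · rw [Real.norm_of_nonneg (by positivity)]
      exact hC θ hθ
  simp_rw [intervalIntegral.integral_of_le zero_le_one]
  refine ⟨hint.integral_prod_right, ?_⟩
  calc ∫ y, ‖∫ θ in Ioc (0 : ℝ) 1, F θ y‖
      ≤ ∫ y, ∫ θ in Ioc (0 : ℝ) 1, ‖F θ y‖ :=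
        integral_mono hint.integral_prod_right.norm hint.norm.integral_prod_right
          fun y => norm_integral_le_integral_norm _
    _ = ∫ θ in Ioc (0 : ℝ) 1, ∫ y, ‖F θ y‖ :=
        (integral_integral_swap (f := fun θ y => ‖F θ y‖) hint.norm).symm
    _ ≤ ∫ θ in Ioc (0 : ℝ) 1, C :=
        setIntegral_mono_on hint.norm.integral_prod_left (by simp) measurableSet_Ioc hC
    _ = C := by simp

theorem integral_norm_increment_le (hφ : ContDiff ℝ 1 φ) (h2 : Integrable (fderiv ℝ φ))
    {C : ℝ} (hC : ∫ y, ‖fderiv ℝ φ y‖ ≤ C) (h : Rd d) :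
    ∫ y, ‖φ (y + h) - φ y‖ ≤ C * ‖h‖ := by
  have hc' := hφ.continuous_fderiv one_ne_zero
  simp_rw [fderiv_segment_integral hφ]
  have hi : ∀ θ : ℝ, Integrable fun y => fderiv ℝ φ (y + θ • h) h := fun θ =>
    (h2.comp_add_right (θ • h)).apply_continuousLinearMap h
  refine (integrable_integral_segment (F := fun θ y => fderiv ℝ φ (y + θ • h) h)
    (by fun_prop) (fun θ _ => hi θ) fun θ _ => ?_).2
  calc ∫ y, ‖fderiv ℝ φ (y + θ • h) h‖ ≤ ∫ y, ‖fderiv ℝ φ (y + θ • h)‖ * ‖h‖ :=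
        integral_mono (hi θ).norm ((h2.comp_add_right (θ • h)).norm.mul_const _)
          fun y => ContinuousLinearMap.le_opNorm _ _
    _ ≤ C * ‖h‖ := by
        rw [integral_mul_const, integral_add_right_eq_self (fun y => ‖fderiv ℝ φ y‖)]
        gcongr

/-- The first order Taylor remainder in `L¹`. -/
theorem integral_norm_taylor_le (hφ : ContDiff ℝ 2 φ)
    {z : Rd d} (hi : Integrable (fun y => fderiv ℝ φ y z))
    (h2 : Integrable (fderiv ℝ fun y => fderiv ℝ φ y z)) {C : ℝ}
    (hC : ∫ y, ‖fderiv ℝ (fun y => fderiv ℝ φ y z) y‖ ≤ C) :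
    Integrable (fun y => φ (y + z) - φ y - fderiv ℝ φ y z) ∧
    ∫ y, ‖φ (y + z) - φ y - fderiv ℝ φ y z‖ ≤ C * ‖z‖ := by
  have hc' := hφ.continuous_fderiv two_ne_zero
  have e : ∀ y, φ (y + z) - φ y - fderiv ℝ φ y z =
      ∫ θ in (0 : ℝ)..1, (fderiv ℝ φ (y + θ • z) z - fderiv ℝ φ y z) := by
    intro y
    rw [intervalIntegral.integral_sub (Continuous.intervalIntegrable (by fun_prop) _ _) (by simp),
      ← fderiv_segment_integral (hφ.of_le one_le_two)]
    simp
  have hC0 : 0 ≤ C := (integral_nonneg fun _ => norm_nonneg _).trans hC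
  simp_rw [e]
  refine integrable_integral_segment
    (F := fun θ y => fderiv ℝ φ (y + θ • z) z - fderiv ℝ φ y z) (by fun_prop)
    (fun θ _ => (hi.comp_add_right (θ • z)).sub hi) fun θ hθ => ?_
  have h1 : ContDiff ℝ 1 fun y => fderiv ℝ φ y z :=
    (hφ.fderiv_right (m := 1) (by norm_num)).clm_apply contDiff_const
  refine (integral_norm_increment_le h1 h2 hC (θ • z)).trans ?_
  rw [norm_smul, Real.norm_of_nonneg hθ.1.le]
  have := hθ.2
  have := norm_nonneg z
  gcongr
  nlinarith

/-- Young's inequality for the convolution of two integrable continuous functions. -/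
theorem integrable_conv_of_integrable {F : Type*} [NormedAddCommGroup F] [NormedSpace ℝ F]
    {G : Rd d → ℝ} {ψ : Rd d → F} (hG : Integrable G) (hψ : Integrable ψ)
    (hGc : Continuous G) (hψc : Continuous ψ) :
    Integrable (fun y => ∫ w, G (y - w) • ψ w) ∧
      ∫ y, ‖∫ w, G (y - w) • ψ w‖ ≤ (∫ y, ‖G y‖) * ∫ y, ‖ψ y‖ := by
  have hint : Integrable (fun q : Rd d × Rd d => G (q.1 - q.2) • ψ q.2)
      (volume.prod volume) := by
    rw [integrable_prod_iff' (Continuous.aestronglyMeasurable (by fun_prop))]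
    refine ⟨.of_forall fun w => (hG.comp_sub_right w).smul_const (ψ w), ?_⟩
    simp only [norm_smul, integral_mul_const, integral_sub_right_eq_self (fun y => ‖G y‖)]
    exact hψ.norm.const_mul _
  refine ⟨hint.integral_prod_left, ?_⟩
  calc ∫ y, ‖∫ w, G (y - w) • ψ w‖
      ≤ ∫ y, ∫ w, ‖G (y - w) • ψ w‖ :=
        integral_mono hint.integral_prod_left.norm hint.norm.integral_prod_left
          fun y => norm_integral_le_integral_norm _
    _ = ∫ w, ∫ y, ‖G (y - w) • ψ w‖ :=
        integral_integral_swap (f := fun y w => ‖G (y - w) • ψ w‖) hint.norm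
    _ = _ := by
        simp only [norm_smul, integral_mul_const, integral_sub_right_eq_self (fun y => ‖G y‖),
          integral_const_mul]

end L1

/-! ### Integrability of the Hessian and of 𝓛 applied to the heat kernel. -/

section heat

variable {d : ℕ} {A : Matrix (Fin d) (Fin d) ℝ} {μ : Measure (Rd d)} {T α : ℝ}

theorem CondL1.contDiff (h : CondL1 A μ T α) {t : ℝ} (ht : t ∈ Ioc 0 T) {n : ℕ} :
    ContDiff ℝ n (heatKernel A μ t) := (h.1 t ht).2.1.of_le (by exact_mod_cast le_top)

theorem CondL1.integrable_fderiv (h : CondL1 A μ T α) {t : ℝ} (ht : t ∈ Ioc 0 T) :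
    Integrable (fderiv ℝ (heatKernel A μ t)) := by
  obtain ⟨c, -, hc⟩ := h.2
  exact (hc t ht).1

theorem CondL1.integrable_fderiv_apply (h : CondL1 A μ T α) {t : ℝ} (ht : t ∈ Ioc 0 T) (v : Rd d) :
    Integrable (fun y => fderiv ℝ (heatKernel A μ t) y v) :=
  (h.integrable_fderiv ht).apply_continuousLinearMap v

theorem CondL1.contDiff_fderiv_apply (h : CondL1 A μ T α) {t : ℝ} (ht : t ∈ Ioc 0 T) (v : Rd d) :
    ContDiff ℝ 1 (fun y => fderiv ℝ (heatKernel A μ t) y v) :=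
  ((h.contDiff ht (n := 2)).fderiv_right (m := 1) (by norm_num)).clm_apply contDiff_const

/-- The Hessian of the heat kernel is integrable. -/
theorem CondL1.integrable_hessian (h : CondL1 A μ T α) {t : ℝ} (ht : t ∈ Ioc 0 T) :
    ∃ K, 0 ≤ K ∧ ∀ v, Integrable (fderiv ℝ fun y => fderiv ℝ (heatKernel A μ t) y v) ∧
      ∫ y, ‖fderiv ℝ (fun y => fderiv ℝ (heatKernel A μ t) y v) y‖ ≤ K * ‖v‖ := by
  -- The kernel at time `t` is the convolution of two copies of the kernel at time `t / 2`. Putting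
  -- one derivative on each copy, Young's inequality bounds the Hessian by a product of two
  -- first-order L¹ norms.
  have ha : t / 2 ∈ Ioc 0 T := ⟨by linarith [ht.1], by linarith [ht.1, ht.2]⟩
  set p := heatKernel A μ (t / 2) with hp
  obtain ⟨C, hC0, hC1, hC2⟩ := (h.1 _ ha).2.exists_bounds
  have hsm := h.contDiff ha (n := 1)
  have hpc : Continuous (fderiv ℝ p) := hsm.continuous_fderiv one_ne_zero
  have := h.isProbabilityMeasure (t := t / 2) ⟨ha.1.le, ha.2⟩
  refine ⟨(∫ y, ‖fderiv ℝ p y‖) * ∫ y, ‖fderiv ℝ p y‖, by positivity, fun v => ?_⟩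
  have hG : Continuous fun y => fderiv ℝ p y v := by fun_prop
  have hGb : ∀ y, |fderiv ℝ p y v| ≤ C * ‖v‖ := fun y =>
    (ContinuousLinearMap.le_opNorm (fderiv ℝ p y) v).trans (by have := hC1 y; gcongr)
  have e1 : (fun y => fderiv ℝ (heatKernel A μ t) y v) =
      fun y => ∫ w, fderiv ℝ p (y - w) v • p w := by
    ext y
    have : heatKernel A μ t = avg (heatMeasure A μ (t / 2)) p := by
      rw [← h.heatKernel_eq_avg ha.1.le ha.1 (by linarith [ht.2]), add_halves]
    rw [this, fderiv_avg_apply hsm hC0 hC1, h.avg_eq_kernel_integral ha]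
  have e2 : fderiv ℝ (fun y => fderiv ℝ (heatKernel A μ t) y v) =
      fun y => ∫ w, fderiv ℝ p (y - w) v • fderiv ℝ p w := by
    rw [e1]; ext1 y
    exact (hasFDerivAt_kernel hsm (h.isHeatKernel ha).integrable (h.integrable_fderiv ha)
      hG hGb y).fderiv
  rw [e2]
  obtain ⟨h1, h2⟩ := integrable_conv_of_integrable (h.integrable_fderiv_apply ha v)
    (h.integrable_fderiv ha) hG hpc
  refine ⟨h1, h2.trans ?_⟩
  rw [mul_right_comm]
  gcongr
  rw [← integral_mul_const]
  exact integral_mono (h.integrable_fderiv_apply ha v).norm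
    ((h.integrable_fderiv ha).norm.mul_const _) fun y => ContinuousLinearMap.le_opNorm _ _

theorem inner_gradient_eq {φ : Rd d → ℝ} (x z : Rd d) :
    inner ℝ (gradient φ x) z = fderiv ℝ φ x z := by
  simp [gradient, InnerProductSpace.toDual_symm_apply]

/-- For small jumps the first-order Taylor remainder in L¹ is quadratic in `z` by integrability of
the Hessian; for large jumps the triangle inequality is enough. The result is exactly the weight
that a Lévy measure integrates. -/
theorem CondL1.levyIntegrand_heatKernel (h : CondL1 A μ T α) {t : ℝ} (ht : t ∈ Ioc 0 T) :
    ∃ C, 0 ≤ C ∧ ∀ z, Integrable (fun y => levyIntegrand (heatKernel A μ t) y z) ∧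
      ∫ y, ‖levyIntegrand (heatKernel A μ t) y z‖ ≤ C * min 1 (‖z‖ ^ 2) := by
  obtain ⟨K, hK, hv⟩ := h.integrable_hessian ht
  have hp := h.isHeatKernel ht
  set p := heatKernel A μ t
  refine ⟨max K (2 * ∫ y, ‖p y‖), by positivity, fun z => ?_⟩
  by_cases hz : ‖z‖ < 1
  · simp only [levyIntegrand, hz, if_true, inner_gradient_eq]
    obtain ⟨h1, h2⟩ := integral_norm_taylor_le (h.contDiff ht (n := 2))
      (h.integrable_fderiv_apply ht z) (hv z).1 (hv z).2
    refine ⟨h1, h2.trans ?_⟩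
    rw [min_eq_right (by nlinarith [norm_nonneg z]), mul_assoc, ← sq]
    gcongr
    exact le_max_left _ _
  · simp only [levyIntegrand, hz, if_false, sub_zero]
    have hi := hp.integrable.comp_add_right z
    refine ⟨hi.sub hp.integrable, ?_⟩
    rw [min_eq_left (one_le_pow₀ (not_lt.1 hz)), mul_one]
    refine le_trans ?_ (le_max_right _ _)
    calc ∫ y, ‖p (y + z) - p y‖ ≤ ∫ y, (‖p (y + z)‖ + ‖p y‖) :=
          integral_mono (hi.sub hp.integrable).norm (hi.norm.add hp.integrable.norm)
            fun y => norm_sub_le _ _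
      _ = 2 * ∫ y, ‖p y‖ := by
          rw [integral_add hi.norm hp.integrable.norm,
            integral_add_right_eq_self (fun y => ‖p y‖)]
          ring

theorem IsLevyMeasure.integrable (hμ : IsLevyMeasure μ) :
    Integrable (fun z => min 1 (‖z‖ ^ 2)) μ := by
  refine ⟨Continuous.aestronglyMeasurable (by fun_prop), ?_⟩
  rw [hasFiniteIntegral_iff_ofReal (.of_forall fun z => by positivity)]
  exact hμ

/-- Needed for Fubini. The weight min(1,|z|²) vanishes only at the origin; elsewhere it can be
inverted, which exhibits the restriction as a density with respect to a finite measure. -/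
theorem IsLevyMeasure.sFinite_restrict (hμ : IsLevyMeasure μ) : SFinite (μ.restrict {0}ᶜ) := by
  have hm : Measurable fun z : Rd d => ENNReal.ofReal (min 1 (‖z‖ ^ 2)) := by fun_prop
  rw [← withDensity_inv_same (μ := μ.restrict {0}ᶜ) hm]
  · have : IsFiniteMeasure ((μ.restrict {0}ᶜ).withDensity
        fun z => ENNReal.ofReal (min 1 (‖z‖ ^ 2))) :=
      isFiniteMeasure_withDensity (ne_top_of_le_ne_top hμ.ne (setLIntegral_le_lintegral _ _))
    infer_instance
  · refine (ae_restrict_iff' (by measurability)).2 (.of_forall fun z hz => ?_)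
    have : 0 < ‖z‖ := norm_pos_iff.2 hz
    simp only [ne_eq, ENNReal.ofReal_eq_zero, not_le]
    positivity
  · simp

theorem integral_restrict_compl_zero {F : Type*} [NormedAddCommGroup F] [NormedSpace ℝ F]
    {f : Rd d → F} (hf : f 0 = 0) : ∫ z in {0}ᶜ, f z ∂μ = ∫ z, f z ∂μ :=
  setIntegral_eq_integral_of_forall_compl_eq_zero fun z hz => by
    simp only [mem_compl_iff, mem_singleton_iff, not_not] at hz
    rw [hz, hf]

theorem levyIntegrand_zero (φ : Rd d → ℝ) (x : Rd d) : levyIntegrand φ x 0 = 0 := by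
  simp [levyIntegrand]

theorem measurable_levyIntegrand {φ : Rd d → ℝ} (hφ : ContDiff ℝ 1 φ) :
    Measurable (fun q : Rd d × Rd d => levyIntegrand φ q.1 q.2) := by
  have hc' := hφ.continuous_fderiv one_ne_zero
  have hc := hφ.continuous
  simp only [levyIntegrand, inner_gradient_eq]
  refine Measurable.sub (by fun_prop) (Measurable.ite ?_ ?_ measurable_const)
  · exact (isOpen_lt (by fun_prop) continuous_const).measurableSet
  · exact Continuous.measurable (by fun_prop)

theorem CondL1.integrable_levyIntegrand_prod (h : CondL1 A μ T α) (hμ : IsLevyMeasure μ)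
    {t : ℝ} (ht : t ∈ Ioc 0 T) :
    Integrable (fun q : Rd d × Rd d => levyIntegrand (heatKernel A μ t) q.1 q.2)
      (volume.prod (μ.restrict {0}ᶜ)) := by
  have := hμ.sFinite_restrict
  obtain ⟨C, hC, hz⟩ := h.levyIntegrand_heatKernel ht
  have hm := (measurable_levyIntegrand (h.contDiff ht (n := 1))).aestronglyMeasurable
    (μ := volume.prod (μ.restrict {0}ᶜ))
  rw [integrable_prod_iff' hm]
  refine ⟨.of_forall fun z => (hz z).1, ?_⟩
  refine Integrable.mono' (hμ.integrable.restrict.const_mul C)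
    hm.norm.prod_swap.integral_prod_right' (.of_forall fun z => ?_)
  rw [Real.norm_of_nonneg (by positivity)]
  exact (hz z).2

theorem partialDeriv_flux {φ : Rd d → ℝ} (x : Rd d) (i : Fin d)
    (hφ : ∀ j, DifferentiableAt ℝ (fun y => fderiv ℝ φ y (EuclideanSpace.single j 1)) x) :
    partialDeriv i (flux A φ i) x = ∑ j, A i j *
      fderiv ℝ (fun y => fderiv ℝ φ y (EuclideanSpace.single j 1)) x
        (EuclideanSpace.single i 1) := by
  have : HasFDerivAt (flux A φ i) (∑ j, A i j •
      fderiv ℝ (fun y => fderiv ℝ φ y (EuclideanSpace.single j 1)) x) x := by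
    unfold flux partialDeriv
    exact HasFDerivAt.fun_sum fun j _ => (hφ j).hasFDerivAt.const_mul _
  rw [partialDeriv, this.fderiv]
  simp

/-- Testing `𝓛 p_t` against a bounded continuous function. -/
theorem CondL1.integral_levyOp_heatKernel (h : CondL1 A μ T α) (hμ : IsLevyMeasure μ)
    {t : ℝ} (ht : t ∈ Ioc 0 T) :
    Integrable (levyOp A μ (heatKernel A μ t)) ∧
    ∀ {F : Type} [NormedAddCommGroup F] [NormedSpace ℝ F] [CompleteSpace F]
      {g : Rd d → F} {M : ℝ}, Continuous g →
      (∀ x, ‖g x‖ ≤ M) → ∫ y, levyOp A μ (heatKernel A μ t) y • g y =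
        (∑ i, ∑ j, A i j • ∫ y, fderiv ℝ (fun y => fderiv ℝ (heatKernel A μ t) y
          (EuclideanSpace.single j 1)) y (EuclideanSpace.single i 1) • g y) +
        ∫ z in {0}ᶜ, (∫ y, levyIntegrand (heatKernel A μ t) y z • g y) ∂μ := by
  have := hμ.sFinite_restrict
  obtain ⟨K, hK, hv⟩ := h.integrable_hessian ht
  set p := heatKernel A μ t
  have e : levyOp A μ p = fun y => ∑ i, ∑ j, A i j * fderiv ℝ (fun y => fderiv ℝ p y
      (EuclideanSpace.single j 1)) y (EuclideanSpace.single i 1) +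
      ∫ z in {0}ᶜ, levyIntegrand p y z ∂μ := by
    ext y
    rw [levyOp, integral_restrict_compl_zero (levyIntegrand_zero _ _)]
    congr 2; ext i
    exact partialDeriv_flux y i fun j =>
      ((h.contDiff_fderiv_apply ht _).differentiable one_ne_zero).differentiableAt
  have hp2 := h.integrable_levyIntegrand_prod hμ ht
  have h1 : ∀ i j : Fin d, Integrable fun y => fderiv ℝ (fun y => fderiv ℝ p y
      (EuclideanSpace.single j 1)) y (EuclideanSpace.single i 1) := fun i j =>
    (hv _).1.apply_continuousLinearMap _
  rw [e]
  refine ⟨?_, ?_⟩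
  · exact (integrable_finsetSum _ fun i _ => integrable_finsetSum _ fun j _ =>
      (h1 i j).const_mul _).add hp2.integral_prod_left
  -- `F` is ℝ when 𝓛p_t acts on functions and ℂ when its characteristic function is computed.
  · intro F _ _ _ g M hg hM
    have h1g : ∀ i j : Fin d, Integrable fun y => fderiv ℝ (fun y => fderiv ℝ p y
        (EuclideanSpace.single j 1)) y (EuclideanSpace.single i 1) • g y := fun i j =>
      (h1 i j).smul_bdd M hg.aestronglyMeasurable (.of_forall hM)
    have hp2g : Integrable (fun q : Rd d × Rd d => levyIntegrand p q.1 q.2 • g q.1)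
        (volume.prod (μ.restrict {0}ᶜ)) :=
      hp2.smul_bdd M (f := fun q : Rd d × Rd d => g q.1)
        (hg.comp continuous_fst).aestronglyMeasurable (.of_forall fun q => hM _)
    simp_rw [add_smul, Finset.sum_smul, mul_smul, ← integral_smul_const]
    have hs : ∀ i : Fin d, Integrable fun y => ∑ j, A i j • fderiv ℝ (fun y => fderiv ℝ p y
        (EuclideanSpace.single j 1)) y (EuclideanSpace.single i 1) • g y := fun i =>
      integrable_finsetSum _ fun j _ => (h1g i j).fun_smul _
    rw [integral_add (integrable_finsetSum _ fun i _ => hs i) hp2g.integral_prod_left,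
      integral_finsetSum _ fun i _ => hs i]
    congr 1
    · refine Finset.sum_congr rfl fun i _ => ?_
      rw [integral_finsetSum _ fun j _ => (h1g i j).fun_smul _]
      simp_rw [integral_smul]
    · exact integral_integral_swap (f := fun y z => levyIntegrand p y z • g y) hp2g

end heat

/-! ### The operator 𝓛 on smoothed functions, and the Fourier transform of 𝓛p_t. -/

section heat

variable {d : ℕ} {A : Matrix (Fin d) (Fin d) ℝ} {μ : Measure (Rd d)} {T α : ℝ}

theorem CondL1.hasFDerivAt_avg (h : CondL1 A μ T α) {t : ℝ} (ht : t ∈ Ioc 0 T)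
    {g : Rd d → ℝ} {M : ℝ} (hg : Continuous g) (hM : ∀ x, |g x| ≤ M) (x : Rd d) :
    HasFDerivAt (avg (heatMeasure A μ t) g)
      (∫ y, g (x - y) • fderiv ℝ (heatKernel A μ t) y) x := by
  have e : avg (heatMeasure A μ t) g = fun x => ∫ y, g (x - y) • heatKernel A μ t y :=
    funext fun x => h.avg_eq_kernel_integral ht g x
  rw [e]
  exact hasFDerivAt_kernel (h.contDiff ht (n := 1)) (h.isHeatKernel ht).integrable
    (h.integrable_fderiv ht) hg hM x

theorem CondL1.fderiv_avg (h : CondL1 A μ T α) {t : ℝ} (ht : t ∈ Ioc 0 T)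
    {g : Rd d → ℝ} {M : ℝ} (hg : Continuous g) (hM : ∀ x, |g x| ≤ M) :
    fderiv ℝ (avg (heatMeasure A μ t) g) =
      fun x => ∫ y, g (x - y) • fderiv ℝ (heatKernel A μ t) y :=
  funext fun x => (h.hasFDerivAt_avg ht hg hM x).fderiv

theorem CondL1.contDiff_avg (h : CondL1 A μ T α) {t : ℝ} (ht : t ∈ Ioc 0 T)
    {g : Rd d → ℝ} {M : ℝ} (hg : Continuous g) (hM : ∀ x, |g x| ≤ M) :
    ContDiff ℝ 1 (avg (heatMeasure A μ t) g) := by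
  rw [contDiff_one_iff_fderiv]
  refine ⟨fun x => (h.hasFDerivAt_avg ht hg hM x).differentiableAt, ?_⟩
  rw [h.fderiv_avg ht hg hM]
  exact continuous_kernel_mul (h.integrable_fderiv ht) hg hM

theorem CondL1.fderiv_avg_eq_kernel (h : CondL1 A μ T α) {t : ℝ} (ht : t ∈ Ioc 0 T)
    {g : Rd d → ℝ} {M : ℝ} (hg : Continuous g) (hM : ∀ x, |g x| ≤ M) (x v : Rd d) :
    fderiv ℝ (avg (heatMeasure A μ t) g) x v =
      ∫ y, g (x - y) • fderiv ℝ (heatKernel A μ t) y v := by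
  rw [h.fderiv_avg ht hg hM, ContinuousLinearMap.integral_apply
    (integrable_kernel_mul (h.integrable_fderiv ht) hg hM x)]
  simp

theorem CondL1.hasFDerivAt_fderiv_avg (h : CondL1 A μ T α) {t : ℝ} (ht : t ∈ Ioc 0 T)
    {g : Rd d → ℝ} {M : ℝ} (hg : Continuous g) (hM : ∀ x, |g x| ≤ M) (x v : Rd d) :
    HasFDerivAt (fun x => fderiv ℝ (avg (heatMeasure A μ t) g) x v)
      (∫ y, g (x - y) • fderiv ℝ (fun y => fderiv ℝ (heatKernel A μ t) y v) y) x := by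
  obtain ⟨K, hK, hv⟩ := h.integrable_hessian ht
  simp_rw [h.fderiv_avg_eq_kernel ht hg hM]
  exact hasFDerivAt_kernel (h.contDiff_fderiv_apply ht v) (h.integrable_fderiv_apply ht v)
    (hv v).1 hg hM x

theorem CondL1.fderiv_fderiv_avg (h : CondL1 A μ T α) {t : ℝ} (ht : t ∈ Ioc 0 T)
    {g : Rd d → ℝ} {M : ℝ} (hg : Continuous g) (hM : ∀ x, |g x| ≤ M) (x v w : Rd d) :
    fderiv ℝ (fun x => fderiv ℝ (avg (heatMeasure A μ t) g) x v) x w =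
      ∫ y, g (x - y) • fderiv ℝ (fun y => fderiv ℝ (heatKernel A μ t) y v) y w := by
  obtain ⟨K, hK, hv⟩ := h.integrable_hessian ht
  rw [(h.hasFDerivAt_fderiv_avg ht hg hM x v).fderiv, ContinuousLinearMap.integral_apply
    (integrable_kernel_mul (hv v).1 hg hM x)]
  simp

/-- The operator `𝓛` applied to `P_t g` is given by the kernel `𝓛 p_t`. -/
theorem CondL1.levyOp_avg (h : CondL1 A μ T α) (hμ : IsLevyMeasure μ) {t : ℝ} (ht : t ∈ Ioc 0 T)
    {g : Rd d → ℝ} {M : ℝ} (hg : Continuous g) (hM : ∀ x, |g x| ≤ M) (x : Rd d) :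
    levyOp A μ (avg (heatMeasure A μ t) g) x =
      ∫ y, g (x - y) • levyOp A μ (heatKernel A μ t) y := by
  have e : ∀ y, g (x - y) • levyOp A μ (heatKernel A μ t) y =
      levyOp A μ (heatKernel A μ t) y • g (x - y) := fun y => by
    simp only [smul_eq_mul]; ring
  simp_rw [e]
  rw [(h.integral_levyOp_heatKernel hμ ht).2 (g := fun y => g (x - y)) (by fun_prop)
    (fun y => hM _), levyOp]
  congr 1
  · refine Finset.sum_congr rfl fun i _ => ?_
    rw [partialDeriv_flux x i fun j => (h.hasFDerivAt_fderiv_avg ht hg hM x _).differentiableAt]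
    refine Finset.sum_congr rfl fun j _ => ?_
    rw [h.fderiv_fderiv_avg ht hg hM, smul_eq_mul]
    congr 2; ext y; simp only [smul_eq_mul]; ring
  · rw [← integral_restrict_compl_zero (levyIntegrand_zero _ _)]
    congr 1; ext z
    have hp := (h.isHeatKernel ht).integrable
    have e1 : avg (heatMeasure A μ t) g (x + z) = ∫ y, g (x - y) • heatKernel A μ t (y + z) := by
      rw [h.avg_eq_kernel_integral ht, ← integral_add_right_eq_self _ z]
      congr 1; ext y; congr 2; abel
    have i1 := integrable_kernel_mul (hp.comp_add_right z) hg hM x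
    have i0 := integrable_kernel_mul hp hg hM x
    have i10 : Integrable fun y => g (x - y) • heatKernel A μ t (y + z) -
        g (x - y) • heatKernel A μ t y := i1.sub i0
    simp only [levyIntegrand, inner_gradient_eq]
    rw [e1, h.avg_eq_kernel_integral ht, h.fderiv_avg_eq_kernel ht hg hM, ← integral_sub i1 i0]
    by_cases hz : ‖z‖ < 1
    · simp only [hz, if_true]
      rw [← integral_sub i10 (integrable_kernel_mul (h.integrable_fderiv_apply ht z) hg hM x)]
      congr 1; ext y; simp only [smul_eq_mul]; ring
    · simp only [hz, if_false, sub_zero]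
      congr 1; ext y; simp only [smul_eq_mul]; ring

theorem norm_exp_inner_mul_I (y ξ : Rd d) : ‖Complex.exp (((inner ℝ y ξ : ℝ) : ℂ) * Complex.I)‖ = 1 :=
  Complex.norm_exp_ofReal_mul_I _

/-- Integration by parts against a character: no boundary term appears, because `φ` and its
directional derivative are integrable and the character is bounded with bounded derivatives. -/
theorem integral_fderiv_smul_exp {φ : Rd d → ℝ} (hφ : ContDiff ℝ 1 φ) (h1 : Integrable φ)
    (v : Rd d) (h2 : Integrable fun y => fderiv ℝ φ y v) (ξ : Rd d) :
    ∫ y, fderiv ℝ φ y v • Complex.exp (((inner ℝ y ξ : ℝ) : ℂ) * Complex.I) =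
      -(((inner ℝ v ξ : ℝ) : ℂ) * Complex.I) *
        ∫ y, φ y • Complex.exp (((inner ℝ y ξ : ℝ) : ℂ) * Complex.I) := by
  have hE : ∀ y : Rd d, HasFDerivAt
      (fun y : Rd d => Complex.exp (((inner ℝ y ξ : ℝ) : ℂ) * Complex.I))
      (Complex.exp (((inner ℝ y ξ : ℝ) : ℂ) * Complex.I) •
        ((Complex.ofRealCLM.comp (innerSL ℝ ξ)).smulRight Complex.I)) y := by
    intro y
    have h0 : HasFDerivAt (fun y : Rd d => ((inner ℝ y ξ : ℝ) : ℂ) * Complex.I)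
        ((Complex.ofRealCLM.comp (innerSL ℝ ξ)).smulRight Complex.I) y := by
      have := ((Complex.ofRealCLM.comp (innerSL ℝ ξ)).smulRight Complex.I).hasFDerivAt (x := y)
      refine this.congr_of_eventuallyEq (.of_forall fun y => ?_)
      simp [real_inner_comm]
    exact h0.cexp
  have hEc : Continuous fun y : Rd d => Complex.exp (((inner ℝ y ξ : ℝ) : ℂ) * Complex.I) := by
    fun_prop
  have hd : ∀ y : Rd d, fderiv ℝ
      (fun y : Rd d => Complex.exp (((inner ℝ y ξ : ℝ) : ℂ) * Complex.I)) y v =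
      (((inner ℝ v ξ : ℝ) : ℂ) * Complex.I) *
        Complex.exp (((inner ℝ y ξ : ℝ) : ℂ) * Complex.I) := by
    intro y
    rw [(hE y).fderiv]
    simp [real_inner_comm]
    ring
  have key := integral_bilinear_fderiv_right_eq_neg_left_of_integrable (μ := volume)
    (f := φ) (g := fun y : Rd d => Complex.exp (((inner ℝ y ξ : ℝ) : ℂ) * Complex.I)) (v := v)
    (B := ContinuousLinearMap.lsmul ℝ ℝ)
    (h2.smul_bdd 1 hEc.aestronglyMeasurable (.of_forall fun y => (norm_exp_inner_mul_I y ξ).le))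
    ?_ (h1.smul_bdd 1 hEc.aestronglyMeasurable
      (.of_forall fun y => (norm_exp_inner_mul_I y ξ).le))
    (fun x _ => hφ.differentiable one_ne_zero x) (fun x _ => (hE x).differentiableAt)
  · simp only [ContinuousLinearMap.lsmul_apply] at key
    rw [← neg_eq_iff_eq_neg] at key
    rw [← key, neg_mul, ← integral_const_mul]
    congr 2; ext y
    rw [hd, Complex.real_smul, Complex.real_smul]; ring
  · simp only [ContinuousLinearMap.lsmul_apply, hd]
    refine h1.smul_bdd ‖((inner ℝ v ξ : ℝ) : ℂ) * Complex.I‖ (f := fun y : Rd d =>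
      (((inner ℝ v ξ : ℝ) : ℂ) * Complex.I) *
        Complex.exp (((inner ℝ y ξ : ℝ) : ℂ) * Complex.I)) (by fun_prop) (.of_forall fun y => ?_)
    rw [norm_mul, norm_exp_inner_mul_I, mul_one]

theorem integral_translate_smul_exp (φ : Rd d → ℝ) (z ξ : Rd d) :
    ∫ y, φ (y + z) • Complex.exp (((inner ℝ y ξ : ℝ) : ℂ) * Complex.I) =
      Complex.exp (-(((inner ℝ z ξ : ℝ) : ℂ) * Complex.I)) *
        ∫ y, φ y • Complex.exp (((inner ℝ y ξ : ℝ) : ℂ) * Complex.I) := by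
  rw [← integral_const_mul,
    ← integral_add_right_eq_self (fun y => Complex.exp (-(((inner ℝ z ξ : ℝ) : ℂ) * Complex.I)) *
      φ y • Complex.exp (((inner ℝ y ξ : ℝ) : ℂ) * Complex.I)) z]
  congr 1; ext y
  rw [mul_smul_comm, ← Complex.exp_add, inner_add_left]
  push_cast; ring_nf

/-- The Fourier transform of `𝓛 p_t`. -/
theorem CondL1.integral_levyOp_smul_exp (h : CondL1 A μ T α) (hμ : IsLevyMeasure μ) {t : ℝ}
    (ht : t ∈ Ioc 0 T) (ξ : Rd d) :
    ∫ y, levyOp A μ (heatKernel A μ t) y • Complex.exp (((inner ℝ y ξ : ℝ) : ℂ) * Complex.I) =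
      -levySymbol A μ (-ξ) * Complex.exp (-((t : ℂ) * levySymbol A μ (-ξ))) := by
  have hp := (h.isHeatKernel ht).integrable
  obtain ⟨K, hK, hv⟩ := h.integrable_hessian ht
  have hphat : ∫ y, heatKernel A μ t y • Complex.exp (((inner ℝ y ξ : ℝ) : ℂ) * Complex.I) =
      Complex.exp (-((t : ℂ) * levySymbol A μ (-ξ))) := by
    rw [← (h.isHeatKernel ht).fourier]
    congr 1; ext y
    rw [Complex.real_smul, mul_comm, inner_neg_left, real_inner_comm]
    congr 2; push_cast; ring
  have hEc : Continuous fun y : Rd d => Complex.exp (((inner ℝ y ξ : ℝ) : ℂ) * Complex.I) := by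
    fun_prop
  have hi : ∀ {f : Rd d → ℝ}, Integrable f → Integrable fun y =>
      f y • Complex.exp (((inner ℝ y ξ : ℝ) : ℂ) * Complex.I) := fun hf =>
    hf.smul_bdd 1 hEc.aestronglyMeasurable (.of_forall fun y => (norm_exp_inner_mul_I y ξ).le)
  rw [(h.integral_levyOp_heatKernel hμ ht).2 hEc (fun y => (norm_exp_inner_mul_I y ξ).le)]
  have e1 : ∀ i j : Fin d, ∫ y, fderiv ℝ (fun y => fderiv ℝ (heatKernel A μ t) y
      (EuclideanSpace.single j 1)) y (EuclideanSpace.single i 1) •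
        Complex.exp (((inner ℝ y ξ : ℝ) : ℂ) * Complex.I) =
      -((ξ i * ξ j : ℝ) : ℂ) * Complex.exp (-((t : ℂ) * levySymbol A μ (-ξ))) := by
    intro i j
    rw [integral_fderiv_smul_exp (h.contDiff_fderiv_apply ht _) (h.integrable_fderiv_apply ht _) _
      ((hv _).1.apply_continuousLinearMap _), integral_fderiv_smul_exp (h.contDiff ht (n := 1)) hp _
      (h.integrable_fderiv_apply ht _), hphat, EuclideanSpace.inner_single_left,
      EuclideanSpace.inner_single_left]
    simp only [map_one, one_mul]
    push_cast
    linear_combination (ξ i * ξ j * Complex.exp (-((t : ℂ) * levySymbol A μ (-ξ)))) *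
      Complex.I_mul_I
  have e2 : ∀ z : Rd d, ∫ y, levyIntegrand (heatKernel A μ t) y z •
      Complex.exp (((inner ℝ y ξ : ℝ) : ℂ) * Complex.I) =
      -(1 - Complex.exp (Complex.I * ((inner ℝ (-ξ) z : ℝ) : ℂ)) +
      (if ‖z‖ < 1 then Complex.I * ((inner ℝ (-ξ) z : ℝ) : ℂ) else 0)) *
        Complex.exp (-((t : ℂ) * levySymbol A μ (-ξ))) := by
    intro z
    have hc : inner ℝ (-ξ) z = -inner ℝ z ξ := by rw [inner_neg_left, real_inner_comm]
    have i1 := hi (hp.comp_add_right z)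
    have i0 := hi hp
    have i10 : Integrable fun y =>
        heatKernel A μ t (y + z) • Complex.exp (((inner ℝ y ξ : ℝ) : ℂ) * Complex.I) -
        heatKernel A μ t y • Complex.exp (((inner ℝ y ξ : ℝ) : ℂ) * Complex.I) := i1.sub i0
    rw [hc, Complex.ofReal_neg, mul_neg, mul_comm Complex.I]
    simp only [levyIntegrand, inner_gradient_eq]
    by_cases hz : ‖z‖ < 1
    · simp only [hz, if_true, sub_smul]
      rw [integral_sub i10 (hi (h.integrable_fderiv_apply ht z)), integral_sub i1 i0,
        integral_translate_smul_exp, integral_fderiv_smul_exp (h.contDiff ht (n := 1)) hp z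
        (h.integrable_fderiv_apply ht z), hphat]
      ring
    · simp only [hz, if_false, sub_zero, sub_smul]
      rw [integral_sub i1 i0, integral_translate_smul_exp, hphat]
      ring
  simp_rw [e1, e2]
  rw [integral_mul_const, integral_neg, integral_restrict_compl_zero (by simp), levySymbol,
    neg_add, add_mul]
  congr 1
  rw [← neg_mul_eq_neg_mul, Complex.ofReal_sum, Finset.sum_mul, ← Finset.sum_neg_distrib]
  refine Finset.sum_congr rfl fun i _ => ?_
  rw [Complex.ofReal_sum, Finset.sum_mul, ← Finset.sum_neg_distrib]
  refine Finset.sum_congr rfl fun j _ => ?_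
  rw [Complex.real_smul]
  simp only [PiLp.neg_apply]
  push_cast; ring

end heat

/-! ### Kolmogorov's equation for the heat semigroup. -/

section heat

variable {d : ℕ} {A : Matrix (Fin d) (Fin d) ℝ} {μ : Measure (Rd d)} {T α : ℝ}

theorem CondL1.integral_heatMeasure (h : CondL1 A μ T α) {t : ℝ} (ht : t ∈ Ioc 0 T)
    {F : Type} [NormedAddCommGroup F] [NormedSpace ℝ F] (g : Rd d → F) :
    ∫ y, g y ∂(heatMeasure A μ t) = ∫ y, heatKernel A μ t y • g y := by
  have := (h.isHeatKernel ht).continuous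
  rw [heatMeasure_of_pos ht.1, integral_withDensity_eq_integral_toReal_smul
    (by fun_prop) (by simp)]
  congr 1; ext y
  rw [ENNReal.toReal_ofReal ((h.isHeatKernel ht).nonneg y)]

theorem CondL1.integral_heatKernel (h : CondL1 A μ T α) {t : ℝ} (ht : t ∈ Ioc 0 T) :
    ∫ y, heatKernel A μ t y = 1 := by
  have := h.isProbabilityMeasure (t := t) ⟨ht.1.le, ht.2⟩
  have e := h.integral_heatMeasure ht fun _ => (1 : ℝ)
  simpa using e.symm

/-- The integral in time of the heat measures. -/
theorem CondL1.exists_integral_heatMeasure (h : CondL1 A μ T α) {b : ℝ} (hb : 0 ≤ b) (hbT : b ≤ T) :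
    ∃ ν : Measure (Rd d), IsFiniteMeasure ν ∧
      ∀ {F : Type} [NormedAddCommGroup F] [NormedSpace ℝ F] [CompleteSpace F]
        {g : Rd d → F} {M : ℝ}, Continuous g → (∀ x, ‖g x‖ ≤ M) →
        ∫ y, g y ∂ν = ∫ r in (0 : ℝ)..b, ∫ y, g y ∂(heatMeasure A μ r) := by
  set m := (volume.restrict (Ioc 0 b)).prod (volume : Measure (Rd d))
  have hsm : AEStronglyMeasurable (fun q : ℝ × Rd d => heatKernel A μ q.1 q.2) m := by
    have e : m = (volume.prod volume).restrict (Ioc 0 b ×ˢ univ) := by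
      rw [← Measure.prod_restrict, Measure.restrict_univ]
    rw [e]
    exact (h.continuousOn_heatKernel.mono (prod_mono (Ioc_subset_Ioc_right hbT)
      subset_rfl)).aestronglyMeasurable (measurableSet_Ioc.prod MeasurableSet.univ)
  have hmem : ∀ r ∈ Ioc 0 b, r ∈ Ioc 0 T := fun r hr => ⟨hr.1, hr.2.trans hbT⟩
  have hnn : ∀ᵐ q ∂m, 0 ≤ heatKernel A μ q.1 q.2 := by
    have : ∀ᵐ q ∂m, q.1 ∈ Ioc 0 b :=
      (Measure.quasiMeasurePreserving_fst).ae (ae_restrict_mem measurableSet_Ioc)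
    filter_upwards [this] with q hq using (h.isHeatKernel (hmem _ hq)).nonneg _
  have hint : Integrable (fun q : ℝ × Rd d => heatKernel A μ q.1 q.2) m := by
    rw [integrable_prod_iff hsm]
    refine ⟨(ae_restrict_iff' measurableSet_Ioc).2
      (.of_forall fun r hr => (h.isHeatKernel (hmem _ hr)).integrable), ?_⟩
    refine Integrable.of_bound (C := 1) hsm.norm.integral_prod_right'
      ((ae_restrict_iff' measurableSet_Ioc).2 (.of_forall fun r hr => ?_))
    have : ∀ y, ‖heatKernel A μ r y‖ = heatKernel A μ r y := fun y =>
      Real.norm_of_nonneg ((h.isHeatKernel (hmem _ hr)).nonneg _)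
    simp [this, h.integral_heatKernel (hmem _ hr)]
  have hfin : IsFiniteMeasure (m.withDensity fun q => ENNReal.ofReal (heatKernel A μ q.1 q.2)) :=
    isFiniteMeasure_withDensity_ofReal hint.2
  -- The measure is the space marginal of the measure on (0,b] × ℝᵈ with density p_r(y).
  refine ⟨(m.withDensity fun q => ENNReal.ofReal (heatKernel A μ q.1 q.2)).map Prod.snd,
    inferInstance, ?_⟩
  intro F _ _ _ g M hg hM
  rw [integral_map measurable_snd.aemeasurable hg.aestronglyMeasurable,
    integral_withDensity_eq_integral_toReal_smul₀ hsm.aemeasurable.ennreal_ofReal (by simp)]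
  have e : ∫ q, (ENNReal.ofReal (heatKernel A μ q.1 q.2)).toReal • g q.2 ∂m =
      ∫ q, heatKernel A μ q.1 q.2 • g q.2 ∂m := by
    refine integral_congr_ae ?_
    filter_upwards [hnn] with q hq
    rw [ENNReal.toReal_ofReal hq]
  have hint2 : Integrable (fun q : ℝ × Rd d => heatKernel A μ q.1 q.2 • g q.2) m :=
    hint.smul_bdd M (hg.comp continuous_snd).aestronglyMeasurable (.of_forall fun q => hM _)
  rw [e, integral_prod _ hint2, intervalIntegral.integral_of_le hb]
  exact setIntegral_congr_fun measurableSet_Ioc fun r hr =>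
    (h.integral_heatMeasure (hmem _ hr) g).symm

theorem charFun_add_measure {ρ σ : Measure (Rd d)} [IsFiniteMeasure ρ] [IsFiniteMeasure σ]
    (ξ : Rd d) : charFun (ρ + σ) ξ = charFun ρ ξ + charFun σ ξ := by
  have : ∀ (ν : Measure (Rd d)) [IsFiniteMeasure ν],
      Integrable (fun y : Rd d => Complex.exp (((inner ℝ y ξ : ℝ) : ℂ) * Complex.I)) ν :=
    fun ν _ => Integrable.of_bound (by fun_prop) 1
      (.of_forall fun y => (norm_exp_inner_mul_I y ξ).le)
  simp only [charFun_apply]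
  rw [integral_add_measure (this ρ) (this σ)]

/-- The signed density `k`, split into two finite measures. -/
theorem integral_ofReal_sub_integral_ofReal_neg {k : Rd d → ℝ} (hk : Integrable k)
    {F : Type} [NormedAddCommGroup F] [NormedSpace ℝ F] {g : Rd d → F} {M : ℝ}
    (hg : Continuous g) (hM : ∀ x, ‖g x‖ ≤ M) :
    (∫ y, g y ∂(volume.withDensity fun y => ENNReal.ofReal (k y))) -
      ∫ y, g y ∂(volume.withDensity fun y => ENNReal.ofReal (-k y)) = ∫ y, k y • g y := by
  rw [integral_withDensity_eq_integral_toReal_smul₀ hk.aemeasurable.ennreal_ofReal (by simp),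
    integral_withDensity_eq_integral_toReal_smul₀ (f := fun y => ENNReal.ofReal (-k y))
      hk.aemeasurable.neg.ennreal_ofReal (by simp),
    ← integral_sub]
  · congr 1; ext y
    rw [← sub_smul]
    congr 1
    rw [ENNReal.toReal_ofReal', ENNReal.toReal_ofReal']
    exact max_zero_sub_max_neg_zero_eq_self (k y)
  · simp only [ENNReal.toReal_ofReal']
    exact hk.pos_part.smul_bdd M hg.aestronglyMeasurable (.of_forall hM)
  · simp only [ENNReal.toReal_ofReal']
    exact hk.neg_part.smul_bdd M hg.aestronglyMeasurable (.of_forall hM)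

/-- Fourier side of p_{τ+b} - p_τ = ∫₀ᵇ p_r * 𝓛p_τ dr, with `c` the value of the symbol. Leaving the
integral unevaluated avoids a division by `c`, which may vanish. -/
theorem exp_sub_exp_eq (τ b : ℝ) (c : ℂ) :
    Complex.exp (-(((τ + b : ℝ) : ℂ) * c)) - Complex.exp (-((τ : ℂ) * c)) =
      (∫ r in (0 : ℝ)..b, Complex.exp (-((r : ℂ) * c))) * (-c * Complex.exp (-((τ : ℂ) * c))) := by
  have hd : ∀ r : ℝ, HasDerivAt (fun r : ℝ => Complex.exp (-((r : ℂ) * c)))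
      (Complex.exp (-((r : ℂ) * c)) * -c) r := fun r => by
    have h1 : HasDerivAt (fun r : ℝ => -((r : ℂ) * c)) (-c) r := by
      simpa using ((Complex.ofRealCLM.hasDerivAt (x := r)).mul_const c).fun_neg
    exact h1.cexp
  have := intervalIntegral.integral_eq_sub_of_hasDerivAt (a := 0) (b := b) (fun r _ => hd r)
    (Continuous.intervalIntegrable (by fun_prop) _ _)
  rw [← mul_assoc, ← intervalIntegral.integral_mul_const, this, sub_mul, ← Complex.exp_add]
  simp only [Complex.ofReal_zero, zero_mul, neg_zero, Complex.exp_zero, one_mul]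
  congr 2; push_cast; ring

variable {g : Rd d → ℝ} {M : ℝ}

theorem CondL1.levyOp_avg_bounds (h : CondL1 A μ T α) (hμ : IsLevyMeasure μ) {t : ℝ}
    (ht : t ∈ Ioc 0 T) (hg : Continuous g) (hM : ∀ x, |g x| ≤ M) :
    Continuous (levyOp A μ (avg (heatMeasure A μ t) g)) ∧
    ∀ x, |levyOp A μ (avg (heatMeasure A μ t) g) x| ≤
      M * ∫ y, ‖levyOp A μ (heatKernel A μ t) y‖ := by
  have hk := (h.integral_levyOp_heatKernel hμ ht).1
  rw [show levyOp A μ (avg (heatMeasure A μ t) g) = _ from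
    funext fun x => h.levyOp_avg hμ ht hg hM x]
  exact ⟨continuous_kernel_mul hk hg hM, fun x => norm_kernel_mul_le hk hM x⟩

theorem CondL1.intervalIntegrable_avg (h : CondL1 A μ T α) {b : ℝ} (hb : 0 ≤ b) (hbT : b ≤ T)
    (hg : Continuous g) (hM : ∀ x, |g x| ≤ M) (x : Rd d) :
    IntervalIntegrable (fun r => avg (heatMeasure A μ r) g x) volume 0 b :=
  ContinuousOn.intervalIntegrable_of_Icc hb
    ((h.continuousOn_avg hg hM x).mono (Icc_subset_Icc_right hbT))

/-- Kolmogorov's equation, integrated in time. -/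
theorem CondL1.avg_sub_avg (h : CondL1 A μ T α) (hμ : IsLevyMeasure μ) {τ b : ℝ} (hτ : 0 < τ)
    (hb : 0 ≤ b) (hbT : τ + b ≤ T) (hg : Continuous g) (hM : ∀ x, |g x| ≤ M) (x : Rd d) :
    avg (heatMeasure A μ (τ + b)) g x - avg (heatMeasure A μ τ) g x =
      ∫ r in (0 : ℝ)..b, avg (heatMeasure A μ r)
        (levyOp A μ (avg (heatMeasure A μ τ) g)) x := by
  have hτT : τ ∈ Ioc 0 T := ⟨hτ, by linarith⟩
  obtain ⟨R, hR, hRi⟩ := h.exists_integral_heatMeasure hb (by linarith)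
  have hk := (h.integral_levyOp_heatKernel hμ hτT).1
  set k := levyOp A μ (heatKernel A μ τ) with hkdef
  set κp := volume.withDensity fun y => ENNReal.ofReal (k y) with hκp
  set κm := volume.withDensity fun y => ENNReal.ofReal (-k y) with hκm
  have : IsFiniteMeasure κp := isFiniteMeasure_withDensity_ofReal hk.2
  have : IsFiniteMeasure κm := isFiniteMeasure_withDensity_ofReal hk.neg.2
  have := h.isProbabilityMeasure (t := τ) ⟨hτ.le, hτT.2⟩
  have := h.isProbabilityMeasure (t := τ + b) ⟨by linarith, hbT⟩
  have hEc : ∀ ξ : Rd d, Continuous fun y : Rd d =>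
    Complex.exp (((inner ℝ y ξ : ℝ) : ℂ) * Complex.I) := fun ξ => by fun_prop
  -- This is p_{τ+b} - p_τ = R * 𝓛p_τ, with the negative part of 𝓛p_τ carried to the other side so
  -- that both members are finite positive measures and characteristic functions decide the
  -- equality.
  have hmeas : heatMeasure A μ (τ + b) + R.conv κm = heatMeasure A μ τ + R.conv κp := by
    refine Measure.ext_of_charFun (funext fun ξ => ?_)
    have eR : charFun R ξ =
        ∫ r in (0 : ℝ)..b, Complex.exp (-((r : ℂ) * levySymbol A μ (-ξ))) := by
      rw [charFun_apply, hRi (hEc ξ) (fun y => (norm_exp_inner_mul_I y ξ).le)]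
      refine intervalIntegral.integral_congr fun r hr => ?_
      rw [uIcc_of_le hb] at hr
      exact h.charFun_heatMeasure ⟨hr.1, by linarith [hr.2]⟩ ξ
    have ek : charFun κp ξ - charFun κm ξ =
        -levySymbol A μ (-ξ) * Complex.exp (-((τ : ℂ) * levySymbol A μ (-ξ))) := by
      rw [← h.integral_levyOp_smul_exp hμ hτT, charFun_apply, charFun_apply,
        integral_ofReal_sub_integral_ofReal_neg hk (hEc ξ)
          (fun y => (norm_exp_inner_mul_I y ξ).le)]
    rw [charFun_add_measure, charFun_add_measure, charFun_conv, charFun_conv,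
      h.charFun_heatMeasure ⟨hτ.le, hτT.2⟩, h.charFun_heatMeasure ⟨by linarith, hbT⟩, eR]
    have := exp_sub_exp_eq τ b (levySymbol A μ (-ξ))
    rw [← ek] at this
    linear_combination this
  have hbd : ∀ (κ : Measure (Rd d)) [IsFiniteMeasure κ], ∀ x, |avg κ g x| ≤ M * κ.real univ :=
    fun κ _ x => norm_integral_le_of_norm_le_const (f := fun y => g (x - y))
      (.of_forall fun y => hM _)
  have hconv : ∀ (κ : Measure (Rd d)) [IsFiniteMeasure κ], ∫ y, g (x - y) ∂(R.conv κ) =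
      ∫ r in (0 : ℝ)..b, avg (heatMeasure A μ r) (avg κ g) x := by
    intro κ _
    have := avg_conv (ρ := R) (σ := κ) hg hM x
    rw [avg] at this
    rw [this, avg, hRi (g := fun y => avg κ g (x - y))
      ((continuous_avg hg hM).comp (by fun_prop)) (fun y => hbd κ _)]
    rfl
  have key := congrArg (fun ν : Measure (Rd d) => ∫ y, g (x - y) ∂ν) hmeas
  rw [integral_add_measure (integrable_translate hg hM x) (integrable_translate hg hM x),
    integral_add_measure (integrable_translate hg hM x) (integrable_translate hg hM x),
    hconv, hconv] at key
  have hbT' : b ≤ T := by linarith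
  have e : ∫ r in (0 : ℝ)..b, avg (heatMeasure A μ r) (levyOp A μ (avg (heatMeasure A μ τ) g)) x =
      (∫ r in (0 : ℝ)..b, avg (heatMeasure A μ r) (avg κp g) x) -
        ∫ r in (0 : ℝ)..b, avg (heatMeasure A μ r) (avg κm g) x := by
    rw [← intervalIntegral.integral_sub
      (h.intervalIntegrable_avg hb hbT' (continuous_avg hg hM) (hbd κp) x)
      (h.intervalIntegrable_avg hb hbT' (continuous_avg hg hM) (hbd κm) x)]
    refine intervalIntegral.integral_congr fun r hr => ?_
    rw [uIcc_of_le hb] at hr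
    have := h.isProbabilityMeasure (t := r) ⟨hr.1, by linarith [hr.2]⟩
    rw [← avg_sub (continuous_avg hg hM) (hbd κp) (continuous_avg hg hM) (hbd κm)]
    congr 1; ext y
    rw [h.levyOp_avg hμ hτT hg hM, avg, avg, integral_ofReal_sub_integral_ofReal_neg hk
      (g := fun z => g (y - z)) (by fun_prop) (fun z => hM _)]
    congr 1; ext z; simp only [smul_eq_mul]; ring
  rw [e]
  simp only [avg] at key ⊢
  linarith

/-- The heat semigroup is Lipschitz in time, away from time `0`. -/
theorem CondL1.exists_avg_time_lipschitz (h : CondL1 A μ T α) (hμ : IsLevyMeasure μ) {τ : ℝ}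
    (hτ : 0 < τ) (hτT : τ ≤ T) (M : ℝ) :
    ∃ C, 0 ≤ C ∧ ∀ r ∈ Icc τ T, ∀ s ∈ Icc τ T, ∀ g : Rd d → ℝ, Continuous g →
      (∀ x, |g x| ≤ M) → ∀ x, |avg (heatMeasure A μ r) g x - avg (heatMeasure A μ s) g x| ≤
        C * |r - s| := by
  set C := |M| * ∫ y, ‖levyOp A μ (heatKernel A μ τ) y‖
  have hC : 0 ≤ C := mul_nonneg (abs_nonneg _) (by positivity)
  have main : ∀ g : Rd d → ℝ, Continuous g → (∀ x, |g x| ≤ M) → ∀ x, ∀ b, 0 ≤ b → τ + b ≤ T →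
      |avg (heatMeasure A μ (τ + b)) g x - avg (heatMeasure A μ τ) g x| ≤ C * b := by
    intro g hg hM x b hb hbT
    rw [h.avg_sub_avg hμ hτ hb hbT hg hM]
    have := intervalIntegral.norm_integral_le_of_norm_le_const (a := (0 : ℝ)) (b := b) (C := C)
      (f := fun r => avg (heatMeasure A μ r) (levyOp A μ (avg (heatMeasure A μ τ) g)) x) ?_
    · simpa [abs_of_nonneg hb] using this
    · intro r hr
      rw [uIoc_of_le hb] at hr
      have := h.isProbabilityMeasure (t := r) ⟨hr.1.le, by linarith [hr.2]⟩
      refine abs_avg_le (fun y => ((h.levyOp_avg_bounds hμ ⟨hτ, hτT⟩ hg hM).2 y).trans ?_) x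
      exact mul_le_mul_of_nonneg_right (le_abs_self _) (by positivity)
  -- The flow from time τ to time `s` averages against a probability measure and so contracts the
  -- supremum norm; this reduces the increment from `s` to `r` to one that starts at τ.
  have main2 : ∀ g : Rd d → ℝ, Continuous g → (∀ x, |g x| ≤ M) → ∀ x, ∀ r ∈ Icc τ T,
      ∀ s ∈ Icc τ T, s ≤ r →
      |avg (heatMeasure A μ r) g x - avg (heatMeasure A μ s) g x| ≤ C * (r - s) := by
    intro g hg hM x r hr s hs hsr
    have := h.isProbabilityMeasure (t := s - τ) ⟨by linarith [hs.1], by linarith [hs.2]⟩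
    have := h.isProbabilityMeasure (t := τ) ⟨hτ.le, hτT⟩
    have := h.isProbabilityMeasure (t := τ + (r - s)) ⟨by linarith, by linarith [hs.1, hr.2]⟩
    have e1 : avg (heatMeasure A μ r) g x =
        avg (heatMeasure A μ (s - τ)) (avg (heatMeasure A μ (τ + (r - s))) g) x := by
      rw [h.avg_avg (by linarith [hs.1]) (by linarith) (by linarith [hr.2]) hg hM]
      congr 2; ring
    have e2 : avg (heatMeasure A μ s) g x =
        avg (heatMeasure A μ (s - τ)) (avg (heatMeasure A μ τ) g) x := by
      rw [h.avg_avg (by linarith [hs.1]) (by linarith) (by linarith [hs.2]) hg hM]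
      congr 2; ring
    rw [e1, e2, ← avg_sub (continuous_avg hg hM) (abs_avg_le hM) (continuous_avg hg hM)
      (abs_avg_le hM)]
    exact abs_avg_le (fun y => main g hg hM y (r - s) (by linarith) (by linarith [hs.1, hr.2])) x
  refine ⟨C, hC, fun r hr s hs g hg hM x => ?_⟩
  rcases le_total s r with hsr | hsr
  · rw [abs_of_nonneg (sub_nonneg.2 hsr)]
    exact main2 g hg hM x r hr s hs hsr
  · rw [abs_sub_comm, abs_sub_comm r, abs_of_nonneg (sub_nonneg.2 hsr)]
    exact main2 g hg hM x s hs r hr hsr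

/-- Kolmogorov's equation, as a right derivative. -/
theorem CondL1.hasDerivWithinAt_avg (h : CondL1 A μ T α) (hμ : IsLevyMeasure μ) {τ : ℝ}
    (hτ : 0 < τ) (hτT : τ < T) (hg : Continuous g) (hM : ∀ x, |g x| ≤ M) (x : Rd d) :
    HasDerivWithinAt (fun r => avg (heatMeasure A μ (τ + r)) g x)
      (levyOp A μ (avg (heatMeasure A μ τ) g) x) (Ici 0) 0 := by
  obtain ⟨hLc, hLb⟩ := h.levyOp_avg_bounds hμ ⟨hτ, hτT.le⟩ hg hM
  set G := levyOp A μ (avg (heatMeasure A μ τ) g)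
  have hcont := h.continuousOn_avg hLc hLb x
  have h0T : (0 : ℝ) < T - τ := by linarith
  have h1 : HasDerivWithinAt (fun b => ∫ r in (0 : ℝ)..b, avg (heatMeasure A μ r) G x)
      (avg (heatMeasure A μ 0) G x) (Ici 0) 0 := by
    refine intervalIntegral.integral_hasDerivWithinAt_right (by simp) (t := Ioi 0) ?_ ?_
    · refine ⟨Icc 0 T, ?_, (hcont.aestronglyMeasurable measurableSet_Icc)⟩
      exact mem_of_superset (Ioc_mem_nhdsGT (by linarith)) Ioc_subset_Icc_self
    · have := (hcont 0 ⟨le_rfl, by linarith⟩)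
      refine ContinuousWithinAt.mono_of_mem_nhdsWithin this ?_
      exact mem_of_superset (Ioc_mem_nhdsGT (by linarith)) Ioc_subset_Icc_self
  rw [avg_heatMeasure_zero] at h1
  have h2 := h1.const_add (avg (heatMeasure A μ τ) g x)
  refine h2.congr_of_eventuallyEq ?_ (by simp)
  filter_upwards [Icc_mem_nhdsGE h0T] with b hb
  rw [← h.avg_sub_avg hμ hτ hb.1 (by linarith [hb.2]) hg hM]
  ring

end heat

/-! ### Smoothing estimates between Hölder classes. -/

/-- `g` is `θ`-Hölder continuous with constant `B`. -/
def HolderBound {d : ℕ} (g : Rd d → ℝ) (θ B : ℝ) : Prop :=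
  ∀ x x', |g x - g x'| ≤ B * ‖x - x'‖ ^ θ

/-- A bound for the second differences of `g`, which for differentiable `g` amounts to the
`δ`-Hölder continuity of the gradient. -/
def SecondDiffBound {d : ℕ} (g : Rd d → ℝ) (c δ : ℝ) : Prop :=
  ∀ x x' w, |g (x + w) - g x - (g (x' + w) - g x')| ≤ c * ‖w‖ * ‖x - x'‖ ^ δ

section estimates

variable {d : ℕ} {g : Rd d → ℝ} {M : ℝ}

/-- Splits the modulus ρ^θ at scale ε: a constant error below ε, a line through the origin above it.
-/
theorem rpow_le_rpow_add_rpow_mul {θ ε ρ : ℝ} (h0 : 0 ≤ θ) (h1 : θ ≤ 1) (hε : 0 < ε)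
    (hρ : 0 ≤ ρ) : ρ ^ θ ≤ ε ^ θ + ε ^ (θ - 1) * ρ := by
  rcases le_or_gt ρ ε with h | h
  · exact (Real.rpow_le_rpow hρ h h0).trans (le_add_of_nonneg_right (by positivity))
  · have hρ' : 0 < ρ := hε.trans h
    have e : ρ ^ θ = ρ ^ (θ - 1) * ρ := by
      rw [← Real.rpow_add_one hρ'.ne', sub_add_cancel]
    rw [e]
    refine le_add_of_nonneg_of_le (by positivity) ?_
    exact mul_le_mul_of_nonneg_right
      (Real.rpow_le_rpow_of_nonpos hε h.le (by linarith)) hρ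

/-- A bounded Hölder function is uniformly close to a Lipschitz function. -/
theorem HolderBound.exists_lipschitz_approx {θ B ε : ℝ} (hg : HolderBound g θ B)
    (hM : ∀ x, |g x| ≤ M) (h0 : 0 ≤ θ) (h1 : θ ≤ 1) (hε : 0 < ε) (hB : 0 ≤ B) :
    ∃ q : Rd d → ℝ, (∀ x, |g x - q x| ≤ B * ε ^ θ) ∧
      ∀ x x', |q x - q x'| ≤ B * ε ^ (θ - 1) * ‖x - x'‖ := by
  set K := B * ε ^ (θ - 1) with hK
  have hK0 : 0 ≤ K := by positivity
  have hbdd : ∀ x, BddBelow (range fun y => g y + K * ‖x - y‖) := by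
    intro x
    refine ⟨-M, ?_⟩
    rintro _ ⟨y, rfl⟩
    have : 0 ≤ K * ‖x - y‖ := by positivity
    linarith [neg_le_of_abs_le (hM y)]
  have hle : ∀ x y, (⨅ y, g y + K * ‖x - y‖) ≤ g y + K * ‖x - y‖ := fun x y => ciInf_le (hbdd x) y
  -- Inf-convolution of `g` with a cone of slope `K`. The slope is chosen so that the Hölder modulus
  -- exceeds the cone by at most B ε^θ.
  refine ⟨fun x => ⨅ y, g y + K * ‖x - y‖, fun x => ?_, ?_⟩
  · rw [abs_of_nonneg]
    · have : g x - B * ε ^ θ ≤ ⨅ y, g y + K * ‖x - y‖ := by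
        refine le_ciInf fun y => ?_
        have e1 := hg x y
        have e2 := mul_le_mul_of_nonneg_left
          (rpow_le_rpow_add_rpow_mul h0 h1 hε (norm_nonneg (x - y))) hB
        rw [mul_add, ← mul_assoc] at e2
        linarith [le_of_abs_le e1]
      linarith
    · have := hle x x
      simp only [sub_self, norm_zero, mul_zero, add_zero] at this
      linarith
  · have key : ∀ x x', (⨅ y, g y + K * ‖x - y‖) - (⨅ y, g y + K * ‖x' - y‖) ≤ K * ‖x - x'‖ := by
      intro x x'
      rw [sub_le_iff_le_add, ← sub_le_iff_le_add']
      refine le_ciInf fun y => ?_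
      have := hle x y
      have h2 : ‖x - y‖ ≤ ‖x - x'‖ + ‖x' - y‖ := by
        simpa using norm_add_le (x - x') (x' - y)
      nlinarith
    intro x x'
    rw [abs_le]
    have := key x' x
    rw [norm_sub_rev] at this
    exact ⟨by linarith, key x x'⟩

/-- Exponent 0 encodes mere boundedness; it is the starting point of the bootstrap and the class
used for the restarted initial value. -/
theorem HolderBound.of_abs_le (hM : ∀ x, |g x| ≤ M) : HolderBound g 0 (2 * M) := fun x x' => by
  rw [Real.rpow_zero, mul_one]
  have := abs_sub (g x) (g x')
  linarith [hM x, hM x']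

theorem continuous_of_lipschitz_bound {q : Rd d → ℝ} {K : ℝ}
    (h : ∀ x x', |q x - q x'| ≤ K * ‖x - x'‖) : Continuous q := by
  refine (LipschitzWith.of_dist_le_mul (K := K.toNNReal) fun x x' => ?_).continuous
  rw [dist_eq_norm, dist_eq_norm]
  exact (h x x').trans (mul_le_mul_of_nonneg_right (Real.le_coe_toNNReal K) (norm_nonneg _))

variable {A : Matrix (Fin d) (Fin d) ℝ} {μ : Measure (Rd d)} {T α : ℝ}

theorem CondL1.exists_avg_lipschitz (h : CondL1 A μ T α) : ∃ c₀, 0 < c₀ ∧ ∀ r ∈ Ioc 0 T,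
    ∀ (g : Rd d → ℝ) (M : ℝ), Continuous g → (∀ x, |g x| ≤ M) → ∀ x x',
      |avg (heatMeasure A μ r) g x - avg (heatMeasure A μ r) g x'| ≤
        c₀ * r ^ (-(1 / α)) * M * ‖x - x'‖ := by
  obtain ⟨c₀, hc, H⟩ := h.2
  refine ⟨c₀, hc, fun r hr g M hg hM x x' => ?_⟩
  refine abs_sub_le_of_norm_fderiv_le
    (fun x => (h.hasFDerivAt_avg hr hg hM x).differentiableAt) (fun x => ?_) x x'
  rw [(h.hasFDerivAt_avg hr hg hM x).fderiv]
  refine (norm_kernel_mul_le (h.integrable_fderiv hr) hM x).trans ?_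
  rw [mul_comm]
  exact mul_le_mul_of_nonneg_right (H r hr).2 ((abs_nonneg _).trans (hM 0))

/-- Write g = (g - q) + q with q a Lipschitz approximation at scale r^{1/α}. The gradient bound on
the uniformly small part and the Lipschitz constant of q are then of the same order B r^{(θ-1)/α}.
-/
theorem CondL1.exists_avg_lipschitz_of_holder (h : CondL1 A μ T α) :
    ∃ c, 0 < c ∧ ∀ r ∈ Ioc 0 T, ∀ (g : Rd d → ℝ) (M θ B : ℝ), Continuous g →
      (∀ x, |g x| ≤ M) → 0 ≤ θ → θ ≤ 1 → 0 ≤ B → HolderBound g θ B → ∀ x x',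
      |avg (heatMeasure A μ r) g x - avg (heatMeasure A μ r) g x'| ≤
        c * B * r ^ ((θ - 1) / α) * ‖x - x'‖ := by
  obtain ⟨c₀, hc₀, H⟩ := h.exists_avg_lipschitz
  refine ⟨c₀ + 1, by positivity, fun r hr g M θ B hg hM h0 h1 hB hgB x x' => ?_⟩
  have hr0 := hr.1
  have := h.isProbabilityMeasure (t := r) ⟨hr.1.le, hr.2⟩
  obtain ⟨q, hq1, hq2⟩ := hgB.exists_lipschitz_approx hM h0 h1 (ε := r ^ (1 / α))
    (by positivity) hB
  have e1 : (r ^ (1 / α)) ^ θ = r ^ (θ / α) := by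
    rw [← Real.rpow_mul hr0.le]; congr 1; ring
  have e2 : (r ^ (1 / α)) ^ (θ - 1) = r ^ ((θ - 1) / α) := by
    rw [← Real.rpow_mul hr0.le]; congr 1; ring
  rw [e1] at hq1
  rw [e2] at hq2
  have hqc := continuous_of_lipschitz_bound hq2
  have hqM : ∀ x, |q x| ≤ M + B * r ^ (θ / α) := fun x => by
    have := abs_sub_abs_le_abs_sub (q x) (g x)
    rw [abs_sub_comm] at this
    linarith [hM x, hq1 x]
  have b1 := H r hr (fun y => g y - q y) _ (by fun_prop) hq1 x x'
  have b2 := avg_lipschitz (ρ := heatMeasure A μ r) hqc hqM hq2 x x'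
  rw [avg_sub hg hM hqc hqM, avg_sub hg hM hqc hqM] at b1
  have e3 : c₀ * r ^ (-(1 / α)) * (B * r ^ (θ / α)) = c₀ * B * r ^ ((θ - 1) / α) := by
    have : r ^ ((θ - 1) / α) = r ^ (-(1 / α)) * r ^ (θ / α) := by
      rw [← Real.rpow_add hr0]; congr 1; ring
    rw [this]; ring
  rw [e3] at b1
  set a := avg (heatMeasure A μ r) g x
  set a' := avg (heatMeasure A μ r) g x'
  set e := avg (heatMeasure A μ r) q x
  set e' := avg (heatMeasure A μ r) q x'
  have : a - a' = (a - e - (a' - e')) + (e - e') := by ring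
  rw [this]
  refine (abs_add_le _ _).trans ((add_le_add b1 b2).trans (le_of_eq ?_))
  ring

/-- Interpolation: combines a bound without decay in x - x' with one that is linear in it. -/
theorem min_one_le_rpow {X δ : ℝ} (hX : 0 ≤ X) (h0 : 0 ≤ δ) (h1 : δ ≤ 1) : min 1 X ≤ X ^ δ := by
  rcases le_or_gt 1 X with h | h
  · exact (min_le_left _ _).trans (Real.one_le_rpow h h0)
  · refine (min_le_right _ _).trans ?_
    rcases hX.eq_or_lt with rfl | hX
    · exact Real.rpow_nonneg le_rfl _
    · simpa using Real.rpow_le_rpow_of_exponent_ge hX h.le h1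

/-- The smoothing estimate between Hölder spaces. -/
theorem CondL1.exists_secondDiffBound_avg (h : CondL1 A μ T α) (hα : 1 < α) :
    ∃ C, 0 < C ∧ ∀ r ∈ Ioc 0 T, ∀ (g : Rd d → ℝ) (M θ δ B : ℝ), Continuous g →
      (∀ x, |g x| ≤ M) → 0 ≤ θ → θ ≤ 1 → 0 ≤ δ → δ ≤ 1 → 0 ≤ B → HolderBound g θ B →
      SecondDiffBound (avg (heatMeasure A μ r) g) (C * B * r ^ (-((1 + δ - θ) / α))) δ := by
  obtain ⟨c₀, hc₀, H0⟩ := h.exists_avg_lipschitz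
  obtain ⟨c₁, hc₁, H1⟩ := h.exists_avg_lipschitz_of_holder
  refine ⟨max (2 * c₁) (4 * c₀ * c₁), by positivity, ?_⟩
  intro r hr g M θ δ B hg hM hθ0 hθ1 hδ0 hδ1 hB hgB x x' w
  set P := avg (heatMeasure A μ r) g
  have hr0 := hr.1
  have hr2 : r / 2 ∈ Ioc 0 T := ⟨by linarith, by linarith [hr.2]⟩
  have := h.isProbabilityMeasure (t := r) ⟨hr.1.le, hr.2⟩
  have := h.isProbabilityMeasure (t := r / 2) ⟨hr2.1.le, hr2.2⟩
  set C := max (2 * c₁) (4 * c₀ * c₁)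
  have b1 : |P (x + w) - P x - (P (x' + w) - P x')| ≤ C * B * r ^ ((θ - 1) / α) * ‖w‖ := by
    have i1 := H1 r hr g M θ B hg hM hθ0 hθ1 hB hgB (x + w) x
    have i2 := H1 r hr g M θ B hg hM hθ0 hθ1 hB hgB (x' + w) x'
    rw [add_sub_cancel_left] at i1 i2
    calc _ ≤ _ := abs_sub _ _
      _ ≤ _ := add_le_add i1 i2
      _ = (2 * c₁) * B * r ^ ((θ - 1) / α) * ‖w‖ := by ring
      _ ≤ _ := by gcongr; exact le_max_left _ _
  -- Half of the time bounds the increments of `Q` by ‖w‖; the other half applies the gradient bound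
  -- to the increment function itself. The factor 4 dominates 2^{(2-θ)/α}, as α > 1 and θ ≥ 0.
  have b2 : |P (x + w) - P x - (P (x' + w) - P x')| ≤
      C * B * r ^ ((θ - 1) / α) * ‖w‖ * (r ^ (-(1 / α)) * ‖x - x'‖) := by
    set Q := avg (heatMeasure A μ (r / 2)) g
    have hQc : Continuous Q := continuous_avg hg hM
    have hQM : ∀ x, |Q x| ≤ M := abs_avg_le hM
    have hPQ : ∀ x, P x = avg (heatMeasure A μ (r / 2)) Q x := fun x => by
      rw [h.avg_avg hr2.1.le hr2.1.le (by linarith [hr.2]) hg hM, add_halves]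
    have hdiff : ∀ x, P (x + w) - P x =
        avg (heatMeasure A μ (r / 2)) (fun y => Q (y + w) - Q y) x := fun x => by
      rw [avg_sub (by fun_prop) (fun x => hQM (x + w)) hQc hQM, avg_shift, hPQ, hPQ]
    have i1 : ∀ y, |Q (y + w) - Q y| ≤ c₁ * B * (r / 2) ^ ((θ - 1) / α) * ‖w‖ := fun y => by
      have := H1 _ hr2 g M θ B hg hM hθ0 hθ1 hB hgB (y + w) y
      rwa [add_sub_cancel_left] at this
    have i2 := H0 _ hr2 (fun y => Q (y + w) - Q y) _ (by fun_prop) i1 x x'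
    rw [hdiff, hdiff]
    refine i2.trans ?_
    have e : (r / 2) ^ (-(1 / α)) * (r / 2) ^ ((θ - 1) / α) ≤
        4 * (r ^ (-(1 / α)) * r ^ ((θ - 1) / α)) := by
      rw [← Real.rpow_add hr2.1, ← Real.rpow_add hr0, Real.div_rpow hr0.le zero_le_two,
        div_eq_mul_inv, ← Real.rpow_neg zero_le_two, mul_comm]
      gcongr
      calc (2 : ℝ) ^ (-(-(1 / α) + (θ - 1) / α)) ≤ 2 ^ (2 : ℝ) := by
            refine Real.rpow_le_rpow_of_exponent_le one_le_two ?_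
            have : -(-(1 / α) + (θ - 1) / α) = (2 - θ) / α := by ring
            rw [this, div_le_iff₀ (by linarith)]
            linarith
        _ = 4 := by norm_num
    calc c₀ * (r / 2) ^ (-(1 / α)) * (c₁ * B * (r / 2) ^ ((θ - 1) / α) * ‖w‖) * ‖x - x'‖
        = c₀ * c₁ * B * ‖w‖ * ‖x - x'‖ * ((r / 2) ^ (-(1 / α)) * (r / 2) ^ ((θ - 1) / α)) := by
          ring
      _ ≤ c₀ * c₁ * B * ‖w‖ * ‖x - x'‖ * (4 * (r ^ (-(1 / α)) * r ^ ((θ - 1) / α))) := by gcongr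
      _ = (4 * c₀ * c₁) * B * r ^ ((θ - 1) / α) * ‖w‖ * (r ^ (-(1 / α)) * ‖x - x'‖) := by ring
      _ ≤ _ := by gcongr; exact le_max_right _ _
  have hX : 0 ≤ r ^ (-(1 / α)) * ‖x - x'‖ := by positivity
  have hY : 0 ≤ C * B * r ^ ((θ - 1) / α) * ‖w‖ := by positivity
  calc |P (x + w) - P x - (P (x' + w) - P x')|
      ≤ C * B * r ^ ((θ - 1) / α) * ‖w‖ * min 1 (r ^ (-(1 / α)) * ‖x - x'‖) := by
        rw [mul_min_of_nonneg _ _ hY, mul_one]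
        exact le_min b1 b2
    _ ≤ C * B * r ^ ((θ - 1) / α) * ‖w‖ * (r ^ (-(1 / α)) * ‖x - x'‖) ^ δ := by
        gcongr
        exact min_one_le_rpow hX hδ0 hδ1
    _ = C * B * r ^ (-((1 + δ - θ) / α)) * ‖w‖ * ‖x - x'‖ ^ δ := by
        have e : r ^ (-((1 + δ - θ) / α)) = r ^ ((θ - 1) / α) * (r ^ (-(1 / α))) ^ δ := by
          rw [← Real.rpow_mul hr0.le, ← Real.rpow_add hr0]; congr 1; ring
        rw [e, Real.mul_rpow (by positivity) (norm_nonneg _)]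
        ring

theorem SecondDiffBound.add {h : Rd d → ℝ} {c c' δ : ℝ} (hg : SecondDiffBound g c δ)
    (hh : SecondDiffBound h c' δ) : SecondDiffBound (fun x => g x + h x) (c + c') δ := by
  intro x x' w
  have e : g (x + w) + h (x + w) - (g x + h x) - (g (x' + w) + h (x' + w) - (g x' + h x')) =
      (g (x + w) - g x - (g (x' + w) - g x')) + (h (x + w) - h x - (h (x' + w) - h x')) := by ring
  rw [e, add_mul, add_mul]
  exact (abs_add_le _ _).trans (add_le_add (hg _ _ _) (hh _ _ _))

theorem SecondDiffBound.mono {c c' δ : ℝ} (hg : SecondDiffBound g c δ) (hc : c ≤ c') :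
    SecondDiffBound g c' δ := fun x x' w => (hg x x' w).trans (by gcongr)

theorem SecondDiffBound.avg {ρ : Measure (Rd d)} [IsProbabilityMeasure ρ] {c δ : ℝ}
    (hg : SecondDiffBound g c δ) (hgc : Continuous g) (hM : ∀ x, |g x| ≤ M) :
    SecondDiffBound (avg ρ g) c δ := by
  intro x x' w
  have i := fun x => integrable_translate (ρ := ρ) hgc hM x
  have j : ∀ x x', Integrable (fun y => g (x - y) - g (x' - y)) ρ := fun x x' => (i x).sub (i x')
  simp only [ViscousHJ.avg]
  rw [← integral_sub (i _) (i _), ← integral_sub (i _) (i _), ← integral_sub (j _ _) (j _ _)]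
  have := norm_integral_le_of_norm_le_const (μ := ρ) (f := fun y => g (x + w - y) - g (x - y) -
    (g (x' + w - y) - g (x' - y))) (C := c * ‖w‖ * ‖x - x'‖ ^ δ) (.of_forall fun y => ?_)
  · simpa using this
  · have := hg (x - y) (x' - y) w
    rw [sub_add_eq_add_sub, sub_add_eq_add_sub, sub_sub_sub_cancel_right] at this
    exact this

/-- Second difference bounds for differentiable functions. -/
theorem SecondDiffBound.abs_fderiv_sub_le {c δ : ℝ} (hg : SecondDiffBound g c δ) (hd : Differentiable ℝ g)
    (x x' v : Rd d) : |fderiv ℝ g x v - fderiv ℝ g x' v| ≤ c * ‖v‖ * ‖x - x'‖ ^ δ := by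
  have hl : ∀ x : Rd d, HasDerivAt (fun s : ℝ => g (x + s • v)) (fderiv ℝ g x v) 0 := by
    intro x
    have h1 : HasDerivAt (fun s : ℝ => x + s • v) v 0 := by
      simpa using ((hasDerivAt_id (0 : ℝ)).smul_const v).const_add x
    have h2 : HasFDerivAt g (fderiv ℝ g x) (x + (0 : ℝ) • v) := by
      simpa using (hd x).hasFDerivAt
    exact h2.comp_hasDerivAt 0 h1
  have hs := ((hl x).sub (hl x')).tendsto_slope_zero_right
  simp only [Pi.sub_apply, zero_add, zero_smul, add_zero, smul_eq_mul] at hs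
  refine le_of_tendsto hs.abs ?_
  filter_upwards [self_mem_nhdsWithin] with s hs
  have hs0 : (0 : ℝ) < s := hs
  have := hg x x' (s • v)
  rw [norm_smul, Real.norm_of_nonneg hs0.le] at this
  rw [abs_mul, abs_of_pos (inv_pos.2 hs0), inv_mul_le_iff₀ hs0]
  calc _ = |g (x + s • v) - g x - (g (x' + s • v) - g x')| := by congr 1; ring
    _ ≤ _ := this
    _ = _ := by ring

/-- The mean value theorem on the segment replaces the increment by a derivative at an intermediate
point, which is compared with the derivative at `x`. -/
theorem SecondDiffBound.taylor {c δ : ℝ} (hg : SecondDiffBound g c δ) (hd : Differentiable ℝ g)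
    (hδ : 0 < δ) (hc : 0 ≤ c) (x z : Rd d) :
    |g (x + z) - g x - fderiv ℝ g x z| ≤ c * ‖z‖ ^ (1 + δ) := by
  obtain ⟨s, hs, he⟩ := exists_hasDerivAt_eq_slope (fun s : ℝ => g (x + s • z))
    (fun s => fderiv ℝ g (x + s • z) z) zero_lt_one
    (Continuous.continuousOn (by have := hd.continuous; fun_prop)) fun s _ => by
      have h1 : HasDerivAt (fun s : ℝ => x + s • z) z s := by
        simpa using ((hasDerivAt_id s).smul_const z).const_add x
      exact (hd _).hasFDerivAt.comp_hasDerivAt s h1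
  simp only [one_smul, zero_smul, add_zero, sub_zero, div_one] at he
  rw [← he]
  refine (hg.abs_fderiv_sub_le hd _ _ _).trans ?_
  rw [add_sub_cancel_left, norm_smul, Real.norm_of_nonneg hs.1.le, Real.rpow_add' (norm_nonneg _)
    (by linarith), Real.rpow_one, ← mul_assoc]
  have h0 := hs.1
  gcongr
  nlinarith [hs.2, norm_nonneg z]

end estimates

/-! ### The Duhamel integral: continuity, commutation with the semigroup, regularity. -/

section duhamel

variable {d : ℕ} {A : Matrix (Fin d) (Fin d) ℝ} {μ : Measure (Rd d)} {T α : ℝ}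
  {f : ℝ → Rd d → ℝ} {M : ℝ}

theorem continuous_slice
    (hf : ContinuousOn (fun q : ℝ × Rd d => f q.1 q.2) (Ioc 0 T ×ˢ univ)) {s : ℝ}
    (hs : s ∈ Ioc 0 T) : Continuous (f s) := by
  rw [← continuousOn_univ]
  exact hf.comp (f := fun y => (s, y)) (by fun_prop) fun y _ => ⟨hs, mem_univ _⟩

theorem tendsto_avg_slice
    (hf : ContinuousOn (fun q : ℝ × Rd d => f q.1 q.2) (Ioc 0 T ×ˢ univ))
    (hM : ∀ s ∈ Ioc 0 T, ∀ y, |f s y| ≤ M) (ρ : Measure (Rd d)) [IsFiniteMeasure ρ] {s₀ : ℝ}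
    (hs₀ : s₀ ∈ Ioc 0 T) (x₀ : Rd d) :
    Tendsto (fun q : ℝ × Rd d => avg ρ (f q.1) q.2) (𝓝[Ioc 0 T ×ˢ univ] (s₀, x₀))
      (𝓝 (avg ρ (f s₀) x₀)) := by
  refine tendsto_integral_filter_of_dominated_convergence (fun _ => M) ?_ ?_
    (integrable_const _) (.of_forall fun y => ?_)
  · filter_upwards [self_mem_nhdsWithin] with q hq
    have := continuous_slice hf hq.1
    fun_prop
  · filter_upwards [self_mem_nhdsWithin] with q hq
    exact .of_forall fun y => hM _ hq.1 _
  · refine (hf (s₀, x₀ - y) ⟨hs₀, mem_univ _⟩).tendsto.comp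
      (f := fun q : ℝ × Rd d => (q.1, q.2 - y)) ?_
    refine tendsto_nhdsWithin_iff.2 ⟨?_, ?_⟩
    · exact (Continuous.tendsto (by fun_prop : Continuous fun q : ℝ × Rd d => (q.1, q.2 - y))
        (s₀, x₀)).mono_left nhdsWithin_le_nhds
    · filter_upwards [self_mem_nhdsWithin] with q hq using ⟨hq.1, mem_univ _⟩

/-- The Lipschitz constant in the heat time depends only on the common bound `M`, so that variable
can be frozen uniformly over the slices; the others are then handled by dominated convergence.
Positive heat times are essential to this argument. -/
theorem CondL1.continuousOn_avg_slice (h : CondL1 A μ T α) (hμ : IsLevyMeasure μ)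
    (hf : ContinuousOn (fun q : ℝ × Rd d => f q.1 q.2) (Ioc 0 T ×ˢ univ))
    (hM : ∀ s ∈ Ioc 0 T, ∀ y, |f s y| ≤ M) :
    ContinuousOn (fun q : ℝ × ℝ × Rd d => avg (heatMeasure A μ q.1) (f q.2.1) q.2.2)
      (Ioc 0 T ×ˢ (Ioc 0 T ×ˢ univ)) := by
  rintro ⟨r₀, s₀, x₀⟩ ⟨hr₀, hs₀, -⟩
  simp only at hr₀ hs₀
  have hr2 : 0 < r₀ / 2 := by linarith [hr₀.1]
  obtain ⟨C, hC, H⟩ := h.exists_avg_time_lipschitz hμ hr2 (by linarith [hr₀.2]) M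
  have := h.isProbabilityMeasure (t := r₀) ⟨hr₀.1.le, hr₀.2⟩
  have t1 : Tendsto (fun q : ℝ × ℝ × Rd d => avg (heatMeasure A μ r₀) (f q.2.1) q.2.2)
      (𝓝[Ioc 0 T ×ˢ (Ioc 0 T ×ˢ univ)] (r₀, s₀, x₀)) (𝓝 (avg (heatMeasure A μ r₀) (f s₀) x₀)) := by
    refine (tendsto_avg_slice hf hM (heatMeasure A μ r₀) hs₀ x₀).comp
      (f := fun q : ℝ × ℝ × Rd d => q.2) ?_
    refine tendsto_nhdsWithin_iff.2 ⟨?_, ?_⟩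
    · exact (continuous_snd.tendsto _).mono_left nhdsWithin_le_nhds
    · filter_upwards [self_mem_nhdsWithin] with q hq using hq.2
  have t2 : Tendsto (fun q : ℝ × ℝ × Rd d => avg (heatMeasure A μ q.1) (f q.2.1) q.2.2 -
      avg (heatMeasure A μ r₀) (f q.2.1) q.2.2)
      (𝓝[Ioc 0 T ×ˢ (Ioc 0 T ×ˢ univ)] (r₀, s₀, x₀)) (𝓝 0) := by
    refine squeeze_zero_norm' (a := fun q : ℝ × ℝ × Rd d => C * |q.1 - r₀|) ?_ ?_
    · have : ∀ᶠ q : ℝ × ℝ × Rd d in 𝓝 (r₀, s₀, x₀), r₀ / 2 < q.1 :=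
        continuous_fst.continuousAt.eventually (lt_mem_nhds (by simp only; linarith))
      filter_upwards [nhdsWithin_le_nhds this, self_mem_nhdsWithin] with q h1 h2
      exact H q.1 ⟨h1.le, h2.1.2⟩ r₀ ⟨by linarith, hr₀.2⟩ _ (continuous_slice hf h2.2.1)
        (hM _ h2.2.1) _
    · refine (Continuous.tendsto' (by fun_prop) _ _ ?_).mono_left nhdsWithin_le_nhds
      simp
  simpa [ContinuousWithinAt] using t2.add t1

/-- `c` is the time of an extra heat flow applied after the integral. The endpoints are excluded
because the heat time may vanish at s = b, and `f` is not controlled at s = 0. -/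
theorem CondL1.continuousOn_duhamel (h : CondL1 A μ T α) (hμ : IsLevyMeasure μ)
    (hf : ContinuousOn (fun q : ℝ × Rd d => f q.1 q.2) (Ioc 0 T ×ˢ univ))
    (hM : ∀ s ∈ Ioc 0 T, ∀ y, |f s y| ≤ M) {a b c : ℝ} (ha : 0 ≤ a) (hb : b ≤ T)
    (hc : 0 ≤ c) (hcT : c + b - a ≤ T) :
    ContinuousOn (fun q : ℝ × Rd d => avg (heatMeasure A μ (c + b - q.1)) (f q.1) q.2)
      (Ioo a b ×ˢ univ) := by
  refine (h.continuousOn_avg_slice hμ hf hM).comp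
    (f := fun q : ℝ × Rd d => (c + b - q.1, q.1, q.2)) (by fun_prop) ?_
  rintro ⟨s, x⟩ ⟨hs, -⟩
  exact ⟨⟨by simp only; linarith [hs.2], by simp only; linarith [hs.1]⟩,
    ⟨by simp only; linarith [hs.1], by simp only; linarith [hs.2]⟩, mem_univ _⟩

theorem CondL1.abs_duhamel_le (h : CondL1 A μ T α)
    (hM : ∀ s ∈ Ioc 0 T, ∀ y, |f s y| ≤ M) {a b c : ℝ} (ha : 0 ≤ a) (hb : b ≤ T)
    (hc : 0 ≤ c) (hcT : c + b - a ≤ T) {s : ℝ} (hs : s ∈ Ioc a b) (x : Rd d) :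
    |avg (heatMeasure A μ (c + b - s)) (f s) x| ≤ M := by
  have := h.isProbabilityMeasure (t := c + b - s) ⟨by linarith [hs.2], by linarith [hs.1]⟩
  exact abs_avg_le (hM s ⟨by linarith [hs.1], by linarith [hs.2]⟩) x

theorem CondL1.intervalIntegrable_duhamel (h : CondL1 A μ T α) (hμ : IsLevyMeasure μ)
    (hf : ContinuousOn (fun q : ℝ × Rd d => f q.1 q.2) (Ioc 0 T ×ˢ univ))
    (hM : ∀ s ∈ Ioc 0 T, ∀ y, |f s y| ≤ M) {a b c : ℝ} (ha : 0 ≤ a) (hab : a ≤ b) (hb : b ≤ T)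
    (hc : 0 ≤ c) (hcT : c + b - a ≤ T) (x : Rd d) :
    IntervalIntegrable (fun s => avg (heatMeasure A μ (c + b - s)) (f s) x) volume a b := by
  rw [intervalIntegrable_iff_integrableOn_Ioo_of_le hab enorm_ne_top enorm_ne_top]
  refine Integrable.of_bound (C := M) ?_
    ((ae_restrict_iff' measurableSet_Ioo).2 (.of_forall fun s hs =>
      h.abs_duhamel_le hM ha hb hc hcT ⟨hs.1, hs.2.le⟩ x))
  refine ContinuousOn.aestronglyMeasurable (s := Ioo a b) ?_ measurableSet_Ioo
  exact (h.continuousOn_duhamel hμ hf hM ha hb hc hcT).comp (f := fun s => (s, x)) (by fun_prop)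
    fun s hs => ⟨hs, mem_univ _⟩

theorem CondL1.continuous_duhamel (h : CondL1 A μ T α) (hμ : IsLevyMeasure μ)
    (hf : ContinuousOn (fun q : ℝ × Rd d => f q.1 q.2) (Ioc 0 T ×ˢ univ))
    (hM : ∀ s ∈ Ioc 0 T, ∀ y, |f s y| ≤ M) {a b c : ℝ} (ha : 0 ≤ a) (hab : a ≤ b) (hb : b ≤ T)
    (hc : 0 ≤ c) (hcT : c + b - a ≤ T) :
    Continuous (fun x => ∫ s in a..b, avg (heatMeasure A μ (c + b - s)) (f s) x) := by
  refine intervalIntegral.continuous_of_dominated_interval (bound := fun _ => M)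
    (fun x => ?_) (fun x => .of_forall fun s hs => ?_) (by simp) (.of_forall fun s hs => ?_)
  · exact ((intervalIntegrable_iff.1 (h.intervalIntegrable_duhamel hμ hf hM ha hab hb hc
      hcT x))).aestronglyMeasurable
  · rw [uIoc_of_le hab] at hs
    exact h.abs_duhamel_le hM ha hb hc hcT hs x
  · rw [uIoc_of_le hab] at hs
    have hs' : s ∈ Ioc 0 T := ⟨by linarith [hs.1], by linarith [hs.2]⟩
    have := h.isProbabilityMeasure (t := c + b - s) ⟨by linarith [hs.2], by linarith [hs.1]⟩
    exact continuous_avg (continuous_slice hf hs') (hM s hs')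

/-- The heat semigroup commutes with the time integral in Duhamel's formula. -/
theorem CondL1.avg_duhamel (h : CondL1 A μ T α) (hμ : IsLevyMeasure μ)
    (hf : ContinuousOn (fun q : ℝ × Rd d => f q.1 q.2) (Ioc 0 T ×ˢ univ))
    (hM : ∀ s ∈ Ioc 0 T, ∀ y, |f s y| ≤ M) {a b c : ℝ} (ha : 0 ≤ a) (hab : a ≤ b) (hb : b ≤ T)
    (hc : 0 ≤ c) (hcT : c + b - a ≤ T) (x : Rd d) :
    avg (heatMeasure A μ c) (fun y => ∫ s in a..b, avg (heatMeasure A μ (b - s)) (f s) y) x =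
      ∫ s in a..b, avg (heatMeasure A μ (c + b - s)) (f s) x := by
  rcases hab.eq_or_lt with rfl | hab'
  · simp [avg]
  have hcI : c ∈ Icc 0 T := ⟨hc, by linarith⟩
  have := h.isProbabilityMeasure hcI
  have hcon := h.continuousOn_duhamel hμ hf hM (c := 0) ha hb le_rfl (by linarith)
  simp only [zero_add] at hcon
  simp only [intervalIntegral.integral_of_le hab, integral_Ioc_eq_integral_Ioo]
  rw [avg, integral_integral_swap]
  · refine setIntegral_congr_fun measurableSet_Ioo fun s hs => ?_
    have hs' : s ∈ Ioc 0 T := ⟨by linarith [hs.1], by linarith [hs.2]⟩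
    rw [add_sub_assoc, ← h.avg_avg hc (by linarith [hs.2]) (by linarith [hs.1])
      (continuous_slice hf hs') (hM s hs')]
    rfl
  · refine Integrable.of_bound (C := M) ?_ ?_
    · have e : (heatMeasure A μ c).prod (volume.restrict (Ioo a b)) =
          ((heatMeasure A μ c).prod volume).restrict (univ ×ˢ Ioo a b) := by
        rw [← Measure.prod_restrict, Measure.restrict_univ]
      rw [e]
      refine ContinuousOn.aestronglyMeasurable ?_ (MeasurableSet.univ.prod measurableSet_Ioo)
      refine hcon.comp (f := fun q : Rd d × ℝ => (q.2, x - q.1)) (by fun_prop) ?_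
      rintro ⟨y, s⟩ ⟨-, hs⟩
      exact ⟨hs, mem_univ _⟩
    · have : ∀ᵐ q ∂((heatMeasure A μ c).prod (volume.restrict (Ioo a b))), q.2 ∈ Ioo a b :=
        Measure.quasiMeasurePreserving_snd.ae (ae_restrict_mem measurableSet_Ioo)
      filter_upwards [this] with q hq
      have := h.abs_duhamel_le hM ha hb le_rfl (by linarith) ⟨hq.1, hq.2.le⟩ (x - q.1)
      rw [zero_add] at this
      exact this

theorem integral_sub_rpow_neg {a b κ : ℝ} (hκ : κ < 1) :
    IntervalIntegrable (fun s => (b - s) ^ (-κ)) volume a b ∧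
      ∫ s in a..b, (b - s) ^ (-κ) = (b - a) ^ (1 - κ) / (1 - κ) := by
  have hi : IntervalIntegrable (fun s : ℝ => s ^ (-κ)) volume (b - a) 0 :=
    (intervalIntegral.intervalIntegrable_rpow' (by linarith))
  constructor
  · have := hi.comp_sub_left b
    simpa using this
  · rw [intervalIntegral.integral_comp_sub_left (fun s : ℝ => s ^ (-κ)), sub_self,
      integral_rpow (Or.inl (by linarith)), Real.zero_rpow (by linarith), sub_zero]
    rw [neg_add_eq_sub]

/-- The slice at time `s` contributes a singularity (b-s)^{-(1+δ-θ)/α}, integrable by the assumption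
on exponents. A delay `c` only lengthens the smoothing time, so the constant does not depend on it.
-/
theorem CondL1.exists_secondDiffBound_duhamel (h : CondL1 A μ T α) (hμ : IsLevyMeasure μ)
    (hα : 1 < α) : ∃ C, 0 < C ∧ ∀ (f : ℝ → Rd d → ℝ) (M : ℝ),
    ContinuousOn (fun q : ℝ × Rd d => f q.1 q.2) (Ioc 0 T ×ˢ univ) →
    (∀ s ∈ Ioc 0 T, ∀ y, |f s y| ≤ M) → ∀ a b c θ δ B : ℝ, 0 ≤ a → a ≤ b → b ≤ T → 0 ≤ c →
    c + b - a ≤ T → 0 ≤ θ → θ ≤ 1 → 0 ≤ δ → δ ≤ 1 → 1 + δ - θ < α → 0 ≤ B →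
    (∀ s ∈ Ioo a b, HolderBound (f s) θ B) →
    SecondDiffBound (fun x => ∫ s in a..b, avg (heatMeasure A μ (c + b - s)) (f s) x)
      (C * B * ((b - a) ^ (1 - (1 + δ - θ) / α) / (1 - (1 + δ - θ) / α))) δ := by
  obtain ⟨C, hC, H⟩ := h.exists_secondDiffBound_avg hα
  refine ⟨C, hC, ?_⟩
  intro f M hf hM a b c θ δ B ha hab hb hc hcT hθ0 hθ1 hδ0 hδ1 hlt hB hfB x x' w
  have hκ : (1 + δ - θ) / α < 1 := by rw [div_lt_one (by linarith)]; exact hlt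
  have hκ0 : 0 ≤ (1 + δ - θ) / α := div_nonneg (by linarith) (by linarith)
  have i := fun x => h.intervalIntegrable_duhamel hμ hf hM ha hab hb hc hcT x
  obtain ⟨j1, j2⟩ := integral_sub_rpow_neg (a := a) (b := b) hκ
  rw [← intervalIntegral.integral_sub (i _) (i _), ← intervalIntegral.integral_sub (i _) (i _),
    ← intervalIntegral.integral_sub ((i _).sub (i _)) ((i _).sub (i _))]
  rw [← Real.norm_eq_abs]
  calc _ ≤ ∫ s in a..b, C * B * (b - s) ^ (-((1 + δ - θ) / α)) * (‖w‖ * ‖x - x'‖ ^ δ) := by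
        refine intervalIntegral.norm_integral_le_of_norm_le (μ := volume)
          (g := fun s => C * B * (b - s) ^ (-((1 + δ - θ) / α)) * (‖w‖ * ‖x - x'‖ ^ δ)) hab ?_
          ((j1.const_mul _).mul_const _)
        have hne : ∀ᵐ s : ℝ, s ≠ b := by simp [ae_iff]
        filter_upwards [hne] with s hsb hs
        have hsI : s ∈ Ioo a b := ⟨hs.1, lt_of_le_of_ne hs.2 hsb⟩
        have hs' : s ∈ Ioc 0 T := ⟨by linarith [hs.1], by linarith [hs.2]⟩
        have hbs : 0 < b - s := by linarith [hsI.2]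
        have := H (c + b - s) ⟨by linarith, by linarith [hs.1]⟩ (f s) M θ δ B
          (continuous_slice hf hs') (hM s hs') hθ0 hθ1 hδ0 hδ1 hB (hfB s hsI) x x' w
        rw [← mul_assoc]
        refine this.trans ?_
        gcongr ?_ * _ * _
        gcongr C * B * ?_
        exact Real.rpow_le_rpow_of_nonpos hbs (by linarith) (by linarith)
    _ = _ := by
        rw [intervalIntegral.integral_mul_const, intervalIntegral.integral_const_mul, j2]
        ring

end duhamel

/-! ### Reduction to a linear equation with source, and the Hölder bootstrap. -/

/-- Bounded `C¹` solutions of Duhamel's formula with a bounded continuous source term `f`. -/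
structure IsDuhamelSolution {d : ℕ} (A : Matrix (Fin d) (Fin d) ℝ) (μ : Measure (Rd d)) (T M : ℝ)
    (u₀ : Rd d → ℝ) (u f : ℝ → Rd d → ℝ) : Prop where
  contDiff : ∀ t ∈ Ioc 0 T, ContDiff ℝ 1 (u t)
  bound : ∀ t ∈ Ioc 0 T, ∀ x, |u t x| ≤ M
  fderiv_bound : ∀ t ∈ Ioc 0 T, ∀ x, ‖fderiv ℝ (u t) x‖ ≤ M
  close : ∀ t ∈ Ioc 0 T, ∀ ε : ℝ, 0 < ε → ∀ᶠ s in 𝓝[Ioc 0 T] t, ∀ x,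
    |u s x - u t x| ≤ ε ∧ ‖fderiv ℝ (u s) x - fderiv ℝ (u t) x‖ ≤ ε
  source_continuousOn : ContinuousOn (fun q : ℝ × Rd d => f q.1 q.2) (Ioc 0 T ×ˢ univ)
  source_bound : ∀ s ∈ Ioc 0 T, ∀ y, |f s y| ≤ M
  initial_continuous : Continuous u₀
  initial_bound : ∀ x, |u₀ x| ≤ M
  duhamel : ∀ t ∈ Ioc 0 T, ∀ x, u t x = avg (heatMeasure A μ t) u₀ x +
    ∫ s in (0 : ℝ)..t, avg (heatMeasure A μ (t - s)) (f s) x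

section

variable {d : ℕ} {A : Matrix (Fin d) (Fin d) ℝ} {μ : Measure (Rd d)} {T α β M : ℝ}
  {u₀ : Rd d → ℝ} {u f : ℝ → Rd d → ℝ}

theorem IsDuhamelSolution.abs_integral_le (S : IsDuhamelSolution A μ T M u₀ u f)
    (h : CondL1 A μ T α) {a b c : ℝ} (ha : 0 ≤ a) (hab : a ≤ b) (hb : b ≤ T)
    (hc : 0 ≤ c) (hcT : c + b - a ≤ T) (x : Rd d) :
    |∫ s in a..b, avg (heatMeasure A μ (c + b - s)) (f s) x| ≤ M * (b - a) := by
  have := intervalIntegral.norm_integral_le_of_norm_le_const (a := a) (b := b) (C := M)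
    (f := fun s => avg (heatMeasure A μ (c + b - s)) (f s) x) fun s hs => by
      rw [uIoc_of_le hab] at hs
      exact h.abs_duhamel_le S.source_bound ha hb hc hcT hs x
  rwa [abs_of_nonneg (sub_nonneg.2 hab)] at this

/-- Duhamel's formula can be restarted at a positive time. -/
theorem IsDuhamelSolution.restart (S : IsDuhamelSolution A μ T M u₀ u f) (h : CondL1 A μ T α)
    (hμ : IsLevyMeasure μ) {a t : ℝ} (ha : 0 < a) (hat : a ≤ t) (ht : t ≤ T) (x : Rd d) :
    u t x = avg (heatMeasure A μ (t - a)) (u a) x +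
      ∫ s in a..t, avg (heatMeasure A μ (t - s)) (f s) x := by
  have hba : 0 ≤ t - a := by linarith
  have haT : a ≤ T := by linarith
  have := h.isProbabilityMeasure (t := t - a) ⟨hba, by linarith⟩
  have := h.isProbabilityMeasure (t := a) ⟨ha.le, haT⟩
  have hcont := h.continuous_duhamel hμ S.source_continuousOn S.source_bound (a := 0) (b := a)
    (c := 0) le_rfl ha.le haT le_rfl (by linarith)
  have hbd := S.abs_integral_le h (a := 0) (b := a) (c := 0) le_rfl ha.le haT le_rfl (by linarith)
  simp only [zero_add] at hcont hbd
  have e1 : u a = fun x => avg (heatMeasure A μ a) u₀ x +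
      ∫ s in (0 : ℝ)..a, avg (heatMeasure A μ (a - s)) (f s) x :=
    funext fun x => S.duhamel a ⟨ha, haT⟩ x
  have e2 := h.avg_duhamel hμ S.source_continuousOn S.source_bound (a := 0) (b := a) (c := t - a)
    le_rfl ha.le haT hba (by linarith) x
  rw [sub_add_cancel] at e2
  rw [e1, avg_add (continuous_avg S.initial_continuous S.initial_bound)
    (abs_avg_le S.initial_bound) hcont hbd, h.avg_avg hba ha.le (by linarith) S.initial_continuous
    S.initial_bound, e2, sub_add_cancel, S.duhamel t ⟨by linarith, ht⟩, add_assoc]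
  congr 1
  have i := h.intervalIntegrable_duhamel hμ S.source_continuousOn S.source_bound (a := 0) (b := t)
    (c := 0) le_rfl (by linarith) ht le_rfl (by linarith) x
  simp only [zero_add] at i
  refine (intervalIntegral.integral_add_adjacent_intervals
    (i.mono_set ?_) (i.mono_set ?_)).symm
  · rw [uIcc_of_le ha.le, uIcc_of_le (by linarith)]; exact Icc_subset_Icc_right hat
  · rw [uIcc_of_le hat, uIcc_of_le (by linarith)]; exact Icc_subset_Icc_left ha.le

/-- The source is `θ`-Hölder in space, locally uniformly in positive times. -/
def LocallyHolder {d : ℕ} (T θ : ℝ) (f : ℝ → Rd d → ℝ) : Prop :=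
  ∀ ε ∈ Ioo 0 T, ∃ B, 0 ≤ B ∧ ∀ s ∈ Icc ε T, HolderBound (f s) θ B

/-- Restarting at ε/2 forgets the initial datum: for t ≥ ε the heat flow has at least ε/2 to smooth
the bounded function u(ε/2), and on the remaining interval the source is θ-Hölder with a single
constant. -/
theorem IsDuhamelSolution.exists_secondDiffBound (S : IsDuhamelSolution A μ T M u₀ u f)
    (h : CondL1 A μ T α) (hμ : IsLevyMeasure μ) (hα : 1 < α) {θ δ : ℝ} (hθ0 : 0 ≤ θ) (hθ1 : θ ≤ 1)
    (hδ0 : 0 ≤ δ) (hδ1 : δ ≤ 1) (hlt : 1 + δ - θ < α) (hf : LocallyHolder T θ f) {ε : ℝ}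
    (hε : ε ∈ Ioo 0 T) : ∃ c, 0 ≤ c ∧ ∀ t ∈ Icc ε T, SecondDiffBound (u t) c δ := by
  obtain ⟨C₁, hC₁, H₁⟩ := h.exists_secondDiffBound_avg hα
  obtain ⟨C₂, hC₂, H₂⟩ := h.exists_secondDiffBound_duhamel hμ hα
  have hη : ε / 2 ∈ Ioo 0 T := ⟨by linarith [hε.1], by linarith [hε.1, hε.2]⟩
  have hη' : ε / 2 ∈ Ioc 0 T := ⟨hη.1, hη.2.le⟩
  obtain ⟨B, hB, hfB⟩ := hf _ hη
  have hM : 0 ≤ M := (abs_nonneg _).trans (S.initial_bound 0)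
  have hκ : 0 < 1 - (1 + δ - θ) / α := by
    rw [sub_pos, div_lt_one (by linarith)]; exact hlt
  have hT : 0 < T := hε.1.trans hε.2
  have hη0 := hη.1
  refine ⟨C₁ * (2 * M) * (ε / 2) ^ (-((1 + δ - 0) / α)) +
    C₂ * B * (T ^ (1 - (1 + δ - θ) / α) / (1 - (1 + δ - θ) / α)), by positivity, fun t ht => ?_⟩
  have ht1 := ht.1
  have ht2 := ht.2
  have e : u t = fun x => avg (heatMeasure A μ (t - ε / 2)) (u (ε / 2)) x +
      ∫ s in (ε / 2)..t, avg (heatMeasure A μ (t - s)) (f s) x :=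
    funext fun x => S.restart h hμ hη.1 (by linarith) ht2 x
  rw [e]
  refine SecondDiffBound.add ?_ ?_
  · refine (H₁ (t - ε / 2) ⟨by linarith, by linarith⟩ (u (ε / 2)) M 0 δ (2 * M)
      (S.contDiff _ hη').continuous (S.bound _ hη') le_rfl zero_le_one hδ0 hδ1 (by linarith)
      (HolderBound.of_abs_le (S.bound _ hη'))).mono ?_
    gcongr C₁ * (2 * M) * ?_
    refine Real.rpow_le_rpow_of_nonpos hη.1 (by linarith) ?_
    rw [neg_nonpos]
    exact div_nonneg (by linarith) (by linarith)
  · have := H₂ f M S.source_continuousOn S.source_bound (ε / 2) t 0 θ δ B hη.1.le (by linarith) ht2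
      le_rfl (by linarith) hθ0 hθ1 hδ0 hδ1 hlt hB fun s hs => hfB s ⟨hs.1.le, by linarith [hs.2]⟩
    simp only [zero_add] at this
    refine this.mono ?_
    have : 0 ≤ t - ε / 2 := by linarith
    gcongr
    linarith

theorem IsDuhamelSolution.locallyHolder_zero (S : IsDuhamelSolution A μ T M u₀ u f) :
    LocallyHolder T 0 f := by
  have hM : 0 ≤ M := (abs_nonneg _).trans (S.initial_bound 0)
  exact fun ε hε => ⟨2 * M, by linarith, fun s hs =>
    HolderBound.of_abs_le (S.source_bound s ⟨by linarith [hs.1, hε.1], hs.2⟩)⟩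

/-- Bootstrapping: if the regularity of `Du` passes to the source, up to order `β`, then the source
is `β`-Hölder. -/
theorem IsDuhamelSolution.locallyHolder (S : IsDuhamelSolution A μ T M u₀ u f)
    (h : CondL1 A μ T α) (hμ : IsLevyMeasure μ) (hα : 1 < α) (hβ0 : 0 < β) (hβ1 : β ≤ 1)
    (hsrc : ∀ δ, 0 ≤ δ → δ ≤ β → (∀ ε ∈ Ioo 0 T, ∃ c, 0 ≤ c ∧
      ∀ t ∈ Icc ε T, SecondDiffBound (u t) c δ) → LocallyHolder T δ f) : LocallyHolder T β f := by
  -- Any gain below α - 1 keeps 1+δ-θ < α; half of it is taken, and β is reached once n k ≥ β.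
  set k := (α - 1) / 2 with hk
  have hk0 : 0 < k := by rw [hk]; linarith
  have key : ∀ n : ℕ, LocallyHolder T (min β (n * k)) f := by
    intro n
    induction n with
    | zero => simpa [hβ0.le] using S.locallyHolder_zero
    | succ n ih =>
      have h0 : 0 ≤ min β (n * k) := le_min hβ0.le (by positivity)
      have h1 : min β (((n + 1 : ℕ) : ℝ) * k) ≤ min β (n * k) + k := by
        push_cast
        rcases min_choice β (n * k) with e | e <;> rw [e]
        · exact (min_le_left _ _).trans (by linarith)
        · exact (min_le_right _ _).trans (by linarith)
      refine hsrc _ (le_min hβ0.le (by positivity)) (min_le_left _ _) fun ε hε => ?_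
      exact S.exists_secondDiffBound h hμ hα h0 ((min_le_left _ _).trans hβ1)
        (le_min hβ0.le (by positivity)) ((min_le_left _ _).trans hβ1)
        (by linarith) ih hε
  obtain ⟨n, hn⟩ := exists_nat_ge (β / k)
  have := key n
  rwa [min_eq_left ((div_le_iff₀ hk0).1 hn)] at this

theorem norm_gradient_sub (φ ψ : Rd d → ℝ) (x y : Rd d) :
    ‖gradient φ x - gradient ψ y‖ = ‖fderiv ℝ φ x - fderiv ℝ ψ y‖ := by
  rw [gradient, gradient, ← map_sub, LinearIsometryEquiv.norm_map]

theorem norm_gradient (φ : Rd d → ℝ) (x : Rd d) : ‖gradient φ x‖ = ‖fderiv ℝ φ x‖ := by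
  rw [gradient, LinearIsometryEquiv.norm_map]

variable {H : ℝ → Rd d → Rd d → ℝ}

/-- (H_p) bounds `H` on the open time interval only; continuity of `H` up to `T` extends the bounds
to the closed endpoint. -/
theorem CondHp.bounds (hH : CondHp T H) (hT : 0 < T) {R : ℝ} (hR : 0 < R) :
    ∃ H₀ L : ℝ, 0 < H₀ ∧ 0 < L ∧ ∀ t ∈ Ioc 0 T, ∀ x, ∀ p ∈ Metric.ball (0 : Rd d) R,
      ∀ q ∈ Metric.ball (0 : Rd d) R, |H t x 0| ≤ H₀ ∧ |H t x p - H t x q| ≤ L * ‖p - q‖ := by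
  obtain ⟨hc, hb⟩ := hH
  obtain ⟨H₀, L, h0, hL, hh⟩ := hb R hR
  refine ⟨H₀, L, h0, hL, fun t ht x p hp q hq => ?_⟩
  rcases ht.2.lt_or_eq with h | rfl
  · exact hh t ⟨ht.1, h⟩ x p hp q hq
  have hlim : ∀ p, Tendsto (fun s => H s x p) (𝓝[Ioo 0 t] t) (𝓝 (H t x p)) := by
    intro p
    have h1 := hc (t, x, p) ⟨⟨hT.le, le_rfl⟩, mem_univ _⟩
    refine h1.tendsto.comp (f := fun s : ℝ => (s, x, p)) (tendsto_nhdsWithin_iff.2 ⟨?_, ?_⟩)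
    · exact (Continuous.tendsto (by fun_prop : Continuous fun s : ℝ => (s, x, p)) t).mono_left
        nhdsWithin_le_nhds
    · filter_upwards [self_mem_nhdsWithin] with s hs using ⟨⟨hs.1.le, hs.2.le⟩, mem_univ _⟩
  have : (𝓝[Ioo 0 t] t).NeBot := right_nhdsWithin_Ioo_neBot hT
  constructor
  · exact le_of_tendsto (hlim 0).abs (by
      filter_upwards [self_mem_nhdsWithin] with s hs using (hh s hs x p hp q hq).1)
  · exact le_of_tendsto ((hlim p).sub (hlim q)).abs (by
      filter_upwards [self_mem_nhdsWithin] with s hs using (hh s hs x p hp q hq).2)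

theorem abs_le_of_c1Norm_le {φ : Rd d → ℝ} {ε : ℝ} (hε : 0 ≤ ε)
    (h : c1Norm φ ≤ ENNReal.ofReal ε) (x : Rd d) : |φ x| ≤ ε ∧ ‖fderiv ℝ φ x‖ ≤ ε := by
  have h1 : ‖φ x‖ₑ ≤ ENNReal.ofReal ε :=
    ((le_iSup (fun x => ‖φ x‖ₑ) x).trans (le_self_add)).trans h
  have h2 : ‖fderiv ℝ φ x‖ₑ ≤ ENNReal.ofReal ε :=
    ((le_iSup (fun x => ‖fderiv ℝ φ x‖ₑ) x).trans (le_add_self)).trans h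
  rw [← ofReal_norm, ENNReal.ofReal_le_ofReal_iff hε] at h1 h2
  exact ⟨h1, h2⟩

theorem abs_hamiltonian_le {H₀ L R : ℝ} {t : ℝ} {x p : Rd d} (hR : 0 < R)
    (hh : ∀ p ∈ Metric.ball (0 : Rd d) R, ∀ q ∈ Metric.ball (0 : Rd d) R,
      |H t x 0| ≤ H₀ ∧ |H t x p - H t x q| ≤ L * ‖p - q‖) (hL : 0 ≤ L) (hp : ‖p‖ < R) :
    |H t x p| ≤ H₀ + L * R := by
  have h1 := hh p (by simpa using hp) 0 (by simpa using hR)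
  rw [sub_zero] at h1
  have : |H t x p| ≤ |H t x 0| + |H t x p - H t x 0| := by
    have := abs_add_le (H t x 0) (H t x p - H t x 0)
    simpa using this
  nlinarith [h1.1, h1.2]

/-- From here on the nonlinearity is hidden in a bounded continuous source. The radius N + 1 puts
every gradient value strictly inside an open ball on which (H_p) applies, and one constant dominates
all the bounds. -/
theorem isDuhamelSolution_of_mild (h : CondL1 A μ T α) (hT : 0 < T) (hHp : CondHp T H)
    (hu₀ : CondU0 u₀) (hu : MemCbCb1 T u) (hmild : IsMildSolution A μ T H u₀ u) :
    ∃ M, 0 < M ∧ IsDuhamelSolution A μ T M u₀ u (fun s y => H s y (gradient (u s) y)) := by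
  obtain ⟨⟨hC, hclose⟩, N, hN⟩ := hu
  obtain ⟨⟨C₀, hC₀⟩, K, hK⟩ := hu₀
  have hb : ∀ t ∈ Ioc 0 T, ∀ x, |u t x| ≤ N ∧ ‖fderiv ℝ (u t) x‖ ≤ N := fun t ht x =>
    abs_le_of_c1Norm_le N.2 (by simpa using hN t ht) x
  have hR : (0 : ℝ) < N + 1 := by positivity
  obtain ⟨H₀, L, h0, hL, hh⟩ := hHp.bounds hT hR
  have hgR : ∀ t ∈ Ioc 0 T, ∀ x, ‖gradient (u t) x‖ < N + 1 := fun t ht x => by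
    rw [norm_gradient]; linarith [(hb t ht x).2]
  have hcl : ∀ t ∈ Ioc 0 T, ∀ ε : ℝ, 0 < ε → ∀ᶠ s in 𝓝[Ioc 0 T] t, ∀ x,
      |u s x - u t x| ≤ ε ∧ ‖fderiv ℝ (u s) x - fderiv ℝ (u t) x‖ ≤ ε := by
    intro t ht ε hε
    have := (hclose t ht).eventually (ge_mem_nhds (ENNReal.ofReal_pos.2 hε))
    filter_upwards [this, self_mem_nhdsWithin] with s hs hsT x
    have h1 := abs_le_of_c1Norm_le hε.le hs x
    rwa [fderiv_fun_sub ((hC s hsT).1.differentiable one_ne_zero _)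
      ((hC t ht).1.differentiable one_ne_zero _)] at h1
  -- Joint continuity: convergence in time is uniform in space, and each slice is continuous.
  have hgc : ContinuousOn (fun q : ℝ × Rd d => gradient (u q.1) q.2) (Ioc 0 T ×ˢ univ) := by
    rintro ⟨t, x⟩ ⟨ht, -⟩
    simp only at ht
    rw [ContinuousWithinAt, tendsto_iff_norm_sub_tendsto_zero]
    have t1 : Tendsto (fun q : ℝ × Rd d => ‖fderiv ℝ (u t) q.2 - fderiv ℝ (u t) x‖)
        (𝓝[Ioc 0 T ×ˢ univ] (t, x)) (𝓝 0) := by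
      have := (hC t ht).1.continuous_fderiv one_ne_zero
      refine (Continuous.tendsto' (by fun_prop) _ _ ?_).mono_left nhdsWithin_le_nhds
      simp
    have hfst : Tendsto (fun q : ℝ × Rd d => q.1) (𝓝[Ioc 0 T ×ˢ univ] (t, x)) (𝓝[Ioc 0 T] t) := by
      refine tendsto_nhdsWithin_iff.2 ⟨?_, ?_⟩
      · exact (continuous_fst.tendsto _).mono_left nhdsWithin_le_nhds
      · filter_upwards [self_mem_nhdsWithin] with q hq using hq.1
    rw [Metric.tendsto_nhds] at t1 ⊢
    intro ε hε
    filter_upwards [t1 (ε / 2) (by positivity), hfst.eventually (hcl t ht (ε / 2) (by positivity))]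
      with q h1 h2
    rw [norm_gradient_sub]
    simp only [dist_zero_right, norm_norm] at h1 ⊢
    calc ‖fderiv ℝ (u q.1) q.2 - fderiv ℝ (u t) x‖
        ≤ ‖fderiv ℝ (u q.1) q.2 - fderiv ℝ (u t) q.2‖ +
          ‖fderiv ℝ (u t) q.2 - fderiv ℝ (u t) x‖ := norm_sub_le_norm_sub_add_norm_sub _ _ _
      _ < ε := by linarith [(h2 q.2).2]
  have hC₀' : 0 ≤ C₀ := (abs_nonneg _).trans (hC₀ 0)
  refine ⟨N + C₀ + (H₀ + L * (N + 1)), by positivity, fun t ht => (hC t ht).1, fun t ht x => ?_,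
    fun t ht x => ?_, hcl, ?_, fun s hs y => ?_, hK.continuous, fun x => ?_, fun t ht x => ?_⟩
  · have : 0 ≤ L * (N + 1 : ℝ) := by positivity
    linarith [(hb t ht x).1]
  · have : 0 ≤ L * (N + 1 : ℝ) := by positivity
    linarith [(hb t ht x).2]
  · refine hHp.1.comp (f := fun q : ℝ × Rd d => (q.1, q.2, gradient (u q.1) q.2)) ?_ ?_
    · exact continuousOn_fst.prodMk (continuousOn_snd.prodMk hgc)
    · rintro ⟨t, x⟩ ⟨ht, -⟩
      exact ⟨⟨ht.1.le, ht.2⟩, mem_univ _⟩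
  · have := abs_hamiltonian_le hR (fun p hp q hq => hh s hs y p hp q hq) hL.le (hgR s hs y)
    have h2 : (0 : ℝ) ≤ N := N.2
    linarith
  · have : 0 ≤ L * (N + 1 : ℝ) := by positivity
    have h2 : (0 : ℝ) ≤ N := N.2
    linarith [hC₀ x]
  · rw [hmild.2 t ht x, h.heatSemigroup_eq_avg ht]
    congr 1
    -- The endpoint s = t is dropped: at heat time 0 `heatMeasure` is a Dirac mass by convention,
    -- which says nothing about `heatSemigroup`.
    simp only [intervalIntegral.integral_of_le ht.1.le, integral_Ioc_eq_integral_Ioo]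
    exact setIntegral_congr_fun measurableSet_Ioo fun s hs =>
      h.heatSemigroup_eq_avg ⟨by linarith [hs.2], by linarith [hs.1, ht.2]⟩ _ _

/-- Hölder regularity of `Du` passes to the source term of the Hamilton-Jacobi equation. -/
theorem locallyHolder_hamiltonian (hT : 0 < T) (hHp : CondHp T H) (hHx : CondHx T β H) {δ : ℝ}
    (hδ0 : 0 ≤ δ) (hδβ : δ ≤ β)
    (S : IsDuhamelSolution A μ T M u₀ u (fun s y => H s y (gradient (u s) y)))
    (hsd : ∀ ε ∈ Ioo 0 T, ∃ c, 0 ≤ c ∧ ∀ t ∈ Icc ε T, SecondDiffBound (u t) c δ) :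
    LocallyHolder T δ (fun s y => H s y (gradient (u s) y)) := by
  have hM : 0 ≤ M := (abs_nonneg _).trans (S.initial_bound 0)
  have hR : 0 < M + 1 := by linarith
  obtain ⟨H₀, L, h0, hL, hh⟩ := hHp.bounds hT hR
  obtain ⟨K, hK, hx⟩ := hHx _ hR
  intro ε hε
  obtain ⟨c, hc, hcb⟩ := hsd ε hε
  -- `K` accounts for the dependence of `H` on x, `L * c` for the variation of the gradient, and `2
  -- * M` for points at distance at least 1, where only boundedness is used.
  refine ⟨K + L * c + 2 * M, by positivity, fun s hs x x' => ?_⟩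
  have hs' : s ∈ Ioc 0 T := ⟨by linarith [hε.1, hs.1], hs.2⟩
  have hb : ∀ y, gradient (u s) y ∈ Metric.ball (0 : Rd d) (M + 1) := fun y => by
    rw [mem_ball_zero_iff, norm_gradient]; linarith [S.fderiv_bound s hs' y]
  have hr : 0 ≤ ‖x - x'‖ ^ δ := by positivity
  simp only
  by_cases hlt : ‖x - x'‖ < 1
  · have h1 := hx s ⟨hs'.1.le, hs'.2⟩ _ (hb x) x x' hlt
    have h2 := (hh s hs' x' _ (hb x) _ (hb x')).2
    have h3 : ‖gradient (u s) x - gradient (u s) x'‖ ≤ c * ‖x - x'‖ ^ δ := by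
      rw [norm_gradient_sub]
      refine ContinuousLinearMap.opNorm_le_bound _ (by positivity) fun v => ?_
      have := (hcb s hs).abs_fderiv_sub_le ((S.contDiff s hs').differentiable one_ne_zero) x x' v
      rw [mul_right_comm] at this
      exact this
    have h4 : ‖x - x'‖ ^ β ≤ ‖x - x'‖ ^ δ := by
      rcases (norm_nonneg (x - x')).eq_or_lt with e | e
      · rcases hδ0.eq_or_lt with rfl | hδ
        · rw [Real.rpow_zero]; exact Real.rpow_le_one (norm_nonneg _) hlt.le hδβ
        · rw [← e, Real.zero_rpow hδ.ne', Real.zero_rpow (hδ.trans_le hδβ).ne']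
      · exact Real.rpow_le_rpow_of_exponent_ge e hlt.le hδβ
    have h5 : |H s x (gradient (u s) x) - H s x' (gradient (u s) x')| ≤
        |H s x (gradient (u s) x) - H s x' (gradient (u s) x)| +
        |H s x' (gradient (u s) x) - H s x' (gradient (u s) x')| := abs_sub_le _ _ _
    have h6 : K * ‖x - x'‖ ^ β ≤ K * ‖x - x'‖ ^ δ := by gcongr
    have h7 : L * ‖gradient (u s) x - gradient (u s) x'‖ ≤ L * (c * ‖x - x'‖ ^ δ) := by gcongr
    nlinarith
  · have h1 : 1 ≤ ‖x - x'‖ ^ δ := Real.one_le_rpow (not_lt.1 hlt) hδ0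
    have h2 := abs_sub (H s x (gradient (u s) x)) (H s x' (gradient (u s) x'))
    have h3 := S.source_bound s hs' x
    have h4 := S.source_bound s hs' x'
    have h5 : 0 ≤ (K + L * c) * ‖x - x'‖ ^ δ := by positivity
    nlinarith

end

/-! ### C¹ regularity from approximation in the Lipschitz seminorm. -/

section approx

variable {d : ℕ} {G g : Rd d → ℝ}

theorem norm_fderiv_sub_le_of_lipschitz {c : ℝ} {x : Rd d} {G' g' : Rd d →L[ℝ] ℝ} (hc : 0 ≤ c)
    (hG : HasFDerivAt G G' x) (hg : HasFDerivAt g g' x)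
    (h : ∀ x x', |G x - g x - (G x' - g x')| ≤ c * ‖x - x'‖) : ‖G' - g'‖ ≤ c :=
  (hG.fun_sub hg).le_of_lip' hc (.of_forall fun y => h y x)

/-- A function which is approximated by `C¹` functions in the Lipschitz seminorm is `C¹`. -/
theorem contDiff_one_of_lipschitz_approx
    (h : ∀ γ : ℝ, 0 < γ → ∃ g : Rd d → ℝ, ContDiff ℝ 1 g ∧
      ∀ x x', |G x - g x - (G x' - g x')| ≤ γ * ‖x - x'‖) : ContDiff ℝ 1 G := by
  choose! g hg hl using h
  have hd : ∀ γ : ℝ, 0 < γ → ∀ x, HasFDerivAt (g γ) (fderiv ℝ (g γ) x) x := fun γ hγ x =>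
    ((hg γ hγ).differentiable one_ne_zero x).hasFDerivAt
  have hcl : ∀ γ γ' : ℝ, 0 < γ → 0 < γ' → ∀ x,
      ‖fderiv ℝ (g γ) x - fderiv ℝ (g γ') x‖ ≤ γ + γ' := by
    intro γ γ' hγ hγ' x
    refine norm_fderiv_sub_le_of_lipschitz (by positivity) (hd γ hγ x) (hd γ' hγ' x)
      fun y y' => ?_
    have h1 := hl γ hγ y y'
    have h2 := hl γ' hγ' y y'
    have e : g γ y - g γ' y - (g γ y' - g γ' y') =
      (G y - g γ' y - (G y' - g γ' y')) - (G y - g γ y - (G y' - g γ y')) := by ring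
    rw [e, add_mul]
    exact (abs_sub _ _).trans (by linarith)
  -- Lipschitz closeness makes the derivatives uniformly Cauchy; their limits are the candidates for
  -- the derivative of `G`.
  have hlim : ∀ x, ∃ ℓ : Rd d →L[ℝ] ℝ, ∀ γ : ℝ, 0 < γ → ‖fderiv ℝ (g γ) x - ℓ‖ ≤ γ := by
    intro x
    have hcauchy : CauchySeq fun n : ℕ => fderiv ℝ (g (1 / ((n : ℝ) + 1))) x := by
      rw [Metric.cauchySeq_iff']
      intro ε hε
      obtain ⟨N, hN⟩ := exists_nat_one_div_lt (half_pos hε)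
      refine ⟨N, fun n hn => ?_⟩
      rw [dist_eq_norm]
      refine (hcl _ _ (by positivity) (by positivity) x).trans_lt ?_
      have : 1 / ((n : ℝ) + 1) ≤ 1 / ((N : ℝ) + 1) := Nat.one_div_le_one_div hn
      linarith
    obtain ⟨ℓ, hℓ⟩ := cauchySeq_tendsto_of_complete hcauchy
    refine ⟨ℓ, fun γ hγ => ?_⟩
    have t1 : Tendsto (fun n : ℕ => ‖fderiv ℝ (g γ) x - fderiv ℝ (g (1 / ((n : ℝ) + 1))) x‖) atTop
        (𝓝 ‖fderiv ℝ (g γ) x - ℓ‖) := (tendsto_const_nhds.sub hℓ).norm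
    have t2 : Tendsto (fun n : ℕ => γ + 1 / ((n : ℝ) + 1)) atTop (𝓝 γ) := by
      simpa using (tendsto_const_nhds (x := γ)).add
        (tendsto_one_div_add_atTop_nhds_zero_nat (𝕜 := ℝ))
    exact le_of_tendsto_of_tendsto' t1 t2 fun n => hcl _ _ hγ (by positivity) x
  choose ℓ hℓ using hlim
  have hG : ∀ x, HasFDerivAt G (ℓ x) x := by
    intro x
    rw [hasFDerivAt_iff_isLittleO_nhds_zero, Asymptotics.isLittleO_iff]
    intro ε hε
    have h3 : 0 < ε / 3 := by positivity
    have := (hasFDerivAt_iff_isLittleO_nhds_zero.1 (hd _ h3 x))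
    rw [Asymptotics.isLittleO_iff] at this
    filter_upwards [this h3] with v hv
    have h1 := hl _ h3 (x + v) x
    rw [add_sub_cancel_left] at h1
    have h2 : ‖(fderiv ℝ (g (ε / 3)) x - ℓ x) v‖ ≤ ε / 3 * ‖v‖ :=
      (ContinuousLinearMap.le_opNorm _ _).trans
        (mul_le_mul_of_nonneg_right (hℓ x _ h3) (norm_nonneg _))
    rw [sub_apply] at h2
    have e : G (x + v) - G x - ℓ x v = (G (x + v) - g (ε / 3) (x + v) - (G x - g (ε / 3) x)) +
      (g (ε / 3) (x + v) - g (ε / 3) x - fderiv ℝ (g (ε / 3)) x v) +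
      (fderiv ℝ (g (ε / 3)) x v - ℓ x v) := by ring
    rw [e]
    refine (norm_add₃_le).trans ?_
    rw [← Real.norm_eq_abs] at h1
    linarith
  rw [contDiff_one_iff_fderiv]
  refine ⟨fun x => (hG x).differentiableAt, ?_⟩
  refine continuous_of_uniform_approx_of_continuous fun U hU => ?_
  obtain ⟨ε, hε, hεU⟩ := Metric.mem_uniformity_dist.1 hU
  refine ⟨fderiv ℝ (g (ε / 2)), (hg _ (by positivity)).continuous_fderiv one_ne_zero,
    fun x => hεU ?_⟩
  rw [(hG x).fderiv, dist_comm, dist_eq_norm]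
  exact (hℓ x _ (by positivity)).trans_lt (by linarith)

end approx

/-! ### Second derivatives in space when α + β > 2. -/

section

variable {d : ℕ} {A : Matrix (Fin d) (Fin d) ℝ} {μ : Measure (Rd d)} {T α β M : ℝ}
  {u₀ : Rd d → ℝ} {u f : ℝ → Rd d → ℝ}

/-- The difference is the Duhamel integral over the last slice [t-η, t]. Its C^{1,1} seminorm is of
order η^κ with κ = 1-(2-β)/α, positive because α+β > 2, and uniformly for t ≥ ε. -/
theorem IsDuhamelSolution.exists_smooth_approx (S : IsDuhamelSolution A μ T M u₀ u f)
    (h : CondL1 A μ T α) (hμ : IsLevyMeasure μ) (hα : 1 < α) (hβ0 : 0 < β) (hβ1 : β ≤ 1)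
    (hαβ : 2 < α + β) (hf : LocallyHolder T β f) {ε : ℝ} (hε : ε ∈ Ioo 0 T) {γ : ℝ} (hγ : 0 < γ) :
    ∃ η ∈ Ioo 0 ε, ∀ t ∈ Icc ε T, SecondDiffBound
      (fun x => u t x - avg (heatMeasure A μ η) (u (t - η)) x) γ 1 := by
  obtain ⟨C, hC, H⟩ := h.exists_secondDiffBound_duhamel hμ hα
  obtain ⟨B, hB, hfB⟩ := hf (ε / 2) ⟨by linarith [hε.1], by linarith [hε.1, hε.2]⟩
  set κ := 1 - (1 + 1 - β) / α with hκdef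
  have hκ : 0 < κ := by rw [hκdef, sub_pos, div_lt_one (by linarith)]; linarith
  have ht0 : Tendsto (fun η : ℝ => C * B * (η ^ κ / κ)) (𝓝[>] 0) (𝓝 0) := by
    have h1 : Continuous fun η : ℝ => C * B * (η ^ κ / κ) :=
      continuous_const.mul ((Real.continuous_rpow_const hκ.le).div_const _)
    exact (h1.tendsto' 0 0 (by simp [Real.zero_rpow hκ.ne'])).mono_left nhdsWithin_le_nhds
  have hε2 : 0 < ε / 2 := by linarith [hε.1]
  obtain ⟨η, hη1, hη2⟩ := ((ht0.eventually (ge_mem_nhds hγ)).and (Ioo_mem_nhdsGT hε2)).exists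
  refine ⟨η, ⟨hη2.1, by linarith [hη2.2]⟩, fun t ht => ?_⟩
  have ht1 := ht.1
  have ht2 := ht.2
  have hη3 := hη2.1
  have hη4 := hη2.2
  have e : (fun x => u t x - avg (heatMeasure A μ η) (u (t - η)) x) =
      fun x => ∫ s in (t - η)..t, avg (heatMeasure A μ (0 + t - s)) (f s) x := by
    ext x
    rw [S.restart h hμ (a := t - η) (by linarith) (by linarith) ht2]
    simp
  rw [e]
  have := H f M S.source_continuousOn S.source_bound (t - η) t 0 β 1 B (by linarith) (by linarith)
    ht2 le_rfl (by linarith) hβ0.le hβ1 zero_le_one le_rfl (by linarith) hB fun s hs =>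
      hfB s ⟨by linarith [hs.1], by linarith [hs.2]⟩
  refine this.mono ?_
  rw [sub_sub_cancel]
  exact hη1

theorem SecondDiffBound.lipschitz_fderiv_sub {φ ψ : Rd d → ℝ} {γ : ℝ}
    (h : SecondDiffBound (fun x => φ x - ψ x) γ 1) (hφ : Differentiable ℝ φ)
    (hψ : Differentiable ℝ ψ) (v x x' : Rd d) :
    |fderiv ℝ φ x v - fderiv ℝ ψ x v - (fderiv ℝ φ x' v - fderiv ℝ ψ x' v)| ≤
      γ * ‖v‖ * ‖x - x'‖ := by
  have := h.abs_fderiv_sub_le (hφ.sub hψ) x x' v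
  rw [Real.rpow_one, fderiv_fun_sub (hφ x) (hψ x), fderiv_fun_sub (hφ x') (hψ x')] at this
  exact this

/-- Second order regularity in space, with continuity in time of the second derivatives. -/
structure HasContinuousHessian {d : ℕ} (T : ℝ) (u : ℝ → Rd d → ℝ) : Prop where
  contDiff : ∀ t ∈ Ioc 0 T, ∀ v, ContDiff ℝ 1 (fun y => fderiv ℝ (u t) y v)
  continuousOn : ∀ x v w,
    ContinuousOn (fun t => fderiv ℝ (fun y => fderiv ℝ (u t) y v) x w) (Ioc 0 T)
  bound : ∀ ε ∈ Ioo 0 T, ∀ v, ∃ c, ∀ t ∈ Icc ε T, ∀ x,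
    ‖fderiv ℝ (fun y => fderiv ℝ (u t) y v) x‖ ≤ c

theorem CondL1.contDiff_fderiv_avg (h : CondL1 A μ T α) {t : ℝ} (ht : t ∈ Ioc 0 T)
    {g : Rd d → ℝ} (hg : Continuous g) (hM : ∀ x, |g x| ≤ M) (v : Rd d) :
    ContDiff ℝ 1 fun x => fderiv ℝ (avg (heatMeasure A μ t) g) x v := by
  obtain ⟨K, hK, hv⟩ := h.integrable_hessian ht
  rw [contDiff_one_iff_fderiv]
  refine ⟨fun x => (h.hasFDerivAt_fderiv_avg ht hg hM x v).differentiableAt, ?_⟩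
  rw [show (fderiv ℝ fun x => fderiv ℝ (avg (heatMeasure A μ t) g) x v) = _ from
    funext fun x => (h.hasFDerivAt_fderiv_avg ht hg hM x v).fderiv]
  exact continuous_kernel_mul (hv v).1 hg hM

/-- Convolving the solution with a fixed integrable kernel gives a continuous function of time. -/
theorem IsDuhamelSolution.continuousOn_kernel (S : IsDuhamelSolution A μ T M u₀ u f)
    {k : Rd d → ℝ} (hk : Integrable k) (x : Rd d) :
    ContinuousOn (fun t => ∫ y, u t (x - y) • k y) (Ioc 0 T) := by
  intro t ht
  rw [ContinuousWithinAt, Metric.tendsto_nhds]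
  intro ε hε
  have hN : 0 ≤ ∫ y, ‖k y‖ := by positivity
  filter_upwards [S.close t ht (ε / (2 * (1 + ∫ y, ‖k y‖))) (by positivity),
    self_mem_nhdsWithin] with s hs hsT
  rw [dist_eq_norm, ← integral_sub
    (integrable_kernel_mul hk (S.contDiff s hsT).continuous (S.bound s hsT) x)
    (integrable_kernel_mul hk (S.contDiff t ht).continuous (S.bound t ht) x)]
  simp_rw [← sub_smul]
  refine (norm_kernel_mul_le (G := fun y => u s y - u t y) hk (fun y => (hs y).1) x).trans_lt ?_
  rw [div_mul_eq_mul_div, div_lt_iff₀ (by positivity)]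
  nlinarith

/-- The functions P_η u(t-η) have second derivatives that are continuous in space and in time, and
they approximate with an error uniform in t ≥ ε; both continuities survive uniform limits. The bound
on the Hessian is the second difference estimate with δ = 1. -/
theorem IsDuhamelSolution.hasContinuousHessian (S : IsDuhamelSolution A μ T M u₀ u f)
    (h : CondL1 A μ T α) (hμ : IsLevyMeasure μ) (hα : 1 < α) (hβ0 : 0 < β) (hβ1 : β ≤ 1)
    (hαβ : 2 < α + β) (hf : LocallyHolder T β f) : HasContinuousHessian T u := by
  have hud : ∀ t ∈ Ioc 0 T, Differentiable ℝ (u t) := fun t ht =>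
    (S.contDiff t ht).differentiable one_ne_zero
  have happ : ∀ ε ∈ Ioo 0 T, ∀ v : Rd d, ∀ γ : ℝ, 0 < γ → ∃ η ∈ Ioo 0 ε, ∀ t ∈ Icc ε T,
      ContDiff ℝ 1 (fun y => fderiv ℝ (avg (heatMeasure A μ η) (u (t - η))) y v) ∧ ∀ x x',
      |fderiv ℝ (u t) x v - fderiv ℝ (avg (heatMeasure A μ η) (u (t - η))) x v -
        (fderiv ℝ (u t) x' v - fderiv ℝ (avg (heatMeasure A μ η) (u (t - η))) x' v)| ≤
        γ * ‖x - x'‖ := by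
    intro ε hε v γ hγ
    obtain ⟨η, hη, H⟩ := S.exists_smooth_approx h hμ hα hβ0 hβ1 hαβ hf hε
      (γ := γ / (‖v‖ + 1)) (by positivity)
    refine ⟨η, hη, fun t ht => ?_⟩
    have hη' : η ∈ Ioc 0 T := ⟨hη.1, by linarith [hη.2, hε.2]⟩
    have htη : t - η ∈ Ioc 0 T := ⟨by linarith [hη.2, ht.1], by linarith [hη.1, ht.2]⟩
    have htT : t ∈ Ioc 0 T := ⟨by linarith [hε.1, ht.1], ht.2⟩
    refine ⟨h.contDiff_fderiv_avg hη' (S.contDiff _ htη).continuous (S.bound _ htη) v,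
      fun x x' => ?_⟩
    refine ((H t ht).lipschitz_fderiv_sub (hud t htT) ((h.contDiff_avg hη'
      (S.contDiff _ htη).continuous (S.bound _ htη)).differentiable one_ne_zero) v x x').trans ?_
    gcongr
    rw [div_mul_eq_mul_div, div_le_iff₀ (by positivity)]
    nlinarith [norm_nonneg v]
  have hsmall : ∀ t ∈ Ioc 0 T, ∃ ε ∈ Ioo 0 T, ε < t := fun t ht =>
    ⟨t / 2, ⟨by linarith [ht.1], by linarith [ht.1, ht.2]⟩, by linarith [ht.1]⟩
  have hC : ∀ t ∈ Ioc 0 T, ∀ v, ContDiff ℝ 1 (fun y => fderiv ℝ (u t) y v) := by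
    intro t ht v
    obtain ⟨ε, hε, hεt⟩ := hsmall t ht
    refine contDiff_one_of_lipschitz_approx fun γ hγ => ?_
    obtain ⟨η, hη, H⟩ := happ ε hε v γ hγ
    exact ⟨_, H t ⟨hεt.le, ht.2⟩⟩
  refine ⟨hC, fun x v w => ?_, fun ε hε v => ?_⟩
  · intro t ht
    obtain ⟨ε, hε, hεt⟩ := hsmall t ht
    have hloc : Icc ε T ∈ 𝓝[Ioc 0 T] t := by
      have : Ioi ε ∈ 𝓝[Ioc 0 T] t := nhdsWithin_le_nhds (Ioi_mem_nhds hεt)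
      filter_upwards [this, self_mem_nhdsWithin] with s h1 h2 using ⟨le_of_lt h1, h2.2⟩
    have : ContinuousOn (fun t => fderiv ℝ (fun y => fderiv ℝ (u t) y v) x w) (Icc ε T) := by
      refine continuousOn_of_uniform_approx_of_continuousOn fun U hU => ?_
      obtain ⟨ρ, hρ, hρU⟩ := Metric.mem_uniformity_dist.1 hU
      obtain ⟨η, hη, H⟩ := happ ε hε v (ρ / (2 * (‖w‖ + 1))) (by positivity)
      have hη' : η ∈ Ioc 0 T := ⟨hη.1, by linarith [hη.2, hε.2]⟩
      have htη : ∀ t ∈ Icc ε T, t - η ∈ Ioc 0 T := fun t ht =>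
        ⟨by linarith [hη.2, ht.1], by linarith [hη.1, ht.2]⟩
      obtain ⟨K, hK, hv⟩ := h.integrable_hessian hη'
      refine ⟨fun t => fderiv ℝ (fun y =>
        fderiv ℝ (avg (heatMeasure A μ η) (u (t - η))) y v) x w, ?_, fun s hs => hρU ?_⟩
      · refine ContinuousOn.congr (f := fun t => ∫ y, u (t - η) (x - y) •
          fderiv ℝ (fun y => fderiv ℝ (heatKernel A μ η) y v) y w) ?_ fun s hs => ?_
        · exact (S.continuousOn_kernel ((hv v).1.apply_continuousLinearMap w) x).comp
            (f := fun t => t - η) (by fun_prop) htη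
        · exact h.fderiv_fderiv_avg hη' (S.contDiff _ (htη s hs)).continuous
            (S.bound _ (htη s hs)) x v w
      · have hsT : s ∈ Ioc 0 T := ⟨by linarith [hε.1, hs.1], hs.2⟩
        have hn := norm_fderiv_sub_le_of_lipschitz (c := ρ / (2 * (‖w‖ + 1))) (by positivity)
          ((hC s hsT v).differentiable one_ne_zero x).hasFDerivAt
          ((H s hs).1.differentiable one_ne_zero x).hasFDerivAt (H s hs).2
        rw [dist_eq_norm, ← sub_apply]
        refine ((ContinuousLinearMap.le_opNorm _ _).trans
          (mul_le_mul_of_nonneg_right hn (norm_nonneg _))).trans_lt ?_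
        rw [div_mul_eq_mul_div, div_lt_iff₀ (by positivity)]
        nlinarith [norm_nonneg w]
    exact (this t ⟨hεt.le, ht.2⟩).mono_of_mem_nhdsWithin hloc
  · obtain ⟨c, hc, hsd⟩ := S.exists_secondDiffBound h hμ hα hβ0.le hβ1 zero_le_one le_rfl
      (by linarith) hf hε
    refine ⟨c * ‖v‖, fun t ht x => ?_⟩
    have htT : t ∈ Ioc 0 T := ⟨by linarith [hε.1, ht.1], ht.2⟩
    refine ((hC t htT v).differentiable one_ne_zero x).hasFDerivAt.le_of_lip' (by positivity)
      (.of_forall fun y => ?_)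
    have := (hsd t ht).abs_fderiv_sub_le (hud t htT) y x v
    rwa [Real.rpow_one] at this

end

/-! ### Domination and limits for the nonlocal integral. -/

section nonlocal

variable {d : ℕ} {μ : Measure (Rd d)} {δ c M : ℝ} {φ : Rd d → ℝ}

theorem abs_levyIntegrand_le (hφ : Differentiable ℝ φ) (hM : ∀ x, |φ x| ≤ M)
    (hsd : SecondDiffBound φ c δ) (hδ : 0 < δ) (hc : 0 ≤ c) (x z : Rd d) :
    |levyIntegrand φ x z| ≤ (c + 2 * M) * min 1 (‖z‖ ^ (1 + δ)) := by
  have hM0 : 0 ≤ M := (abs_nonneg _).trans (hM 0)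
  by_cases hz : ‖z‖ < 1
  · simp only [levyIntegrand, hz, if_true, inner_gradient_eq]
    rw [min_eq_right (Real.rpow_le_one (norm_nonneg z) hz.le (by linarith))]
    refine (hsd.taylor hφ hδ hc x z).trans ?_
    gcongr
    linarith
  · simp only [levyIntegrand, hz, if_false, sub_zero]
    rw [min_eq_left (Real.one_le_rpow (not_lt.1 hz) (by linarith)), mul_one]
    have := abs_sub (φ (x + z)) (φ x)
    linarith [hM (x + z), hM x]

theorem integrable_min_rpow (hδ : 0 ≤ 1 + δ)
    (hμ : ∫⁻ z, ENNReal.ofReal (min 1 (‖z‖ ^ (1 + δ))) ∂μ < ⊤) :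
    Integrable (fun z : Rd d => min 1 (‖z‖ ^ (1 + δ))) μ := by
  refine ⟨Continuous.aestronglyMeasurable ?_, ?_⟩
  · exact continuous_const.min (continuous_norm.rpow_const fun _ => Or.inr hδ)
  · rw [hasFiniteIntegral_iff_ofReal (.of_forall fun z => by positivity)]
    exact hμ

theorem integrable_levyIntegrand (hφ : ContDiff ℝ 1 φ) (hM : ∀ x, |φ x| ≤ M)
    (hsd : SecondDiffBound φ c δ) (hδ : 0 < δ) (hc : 0 ≤ c)
    (hμ : Integrable (fun z : Rd d => min 1 (‖z‖ ^ (1 + δ))) μ) (x : Rd d) :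
    Integrable (levyIntegrand φ x) μ :=
  (hμ.const_mul (c + 2 * M)).mono'
    ((measurable_levyIntegrand hφ).comp measurable_prodMk_left).aestronglyMeasurable
    (.of_forall fun z => abs_levyIntegrand_le (hφ.differentiable one_ne_zero) hM hsd hδ hc x z)

/-- The majorant depends only on the shared constants, so dominated convergence needs just pointwise
convergence of the functions and of their gradients at `x`. It serves both the continuity of 𝓛u in
time and the removal of the smoothing. -/
theorem tendsto_integral_levyIntegrand {ι : Type*} {l : Filter ι} [l.IsCountablyGenerated]
    {F : ι → Rd d → ℝ} (hF : ∀ᶠ n in l, ContDiff ℝ 1 (F n) ∧ (∀ x, |F n x| ≤ M) ∧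
      SecondDiffBound (F n) c δ) (hδ : 0 < δ) (hc : 0 ≤ c)
    (hμ : Integrable (fun z : Rd d => min 1 (‖z‖ ^ (1 + δ))) μ) {x : Rd d}
    (h0 : ∀ y, Tendsto (fun n => F n y) l (𝓝 (φ y)))
    (h1 : ∀ v, Tendsto (fun n => fderiv ℝ (F n) x v) l (𝓝 (fderiv ℝ φ x v))) :
    Tendsto (fun n => ∫ z, levyIntegrand (F n) x z ∂μ) l (𝓝 (∫ z, levyIntegrand φ x z ∂μ)) := by
  refine tendsto_integral_filter_of_dominated_convergence
    (fun z => (c + 2 * M) * min 1 (‖z‖ ^ (1 + δ))) ?_ ?_ (hμ.const_mul _) (.of_forall fun z => ?_)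
  · filter_upwards [hF] with n hn
    exact ((measurable_levyIntegrand hn.1).comp measurable_prodMk_left).aestronglyMeasurable
  · filter_upwards [hF] with n hn
    exact .of_forall fun z =>
      abs_levyIntegrand_le (hn.1.differentiable one_ne_zero) hn.2.1 hn.2.2 hδ hc x z
  · simp only [levyIntegrand, inner_gradient_eq]
    refine ((h0 _).sub (h0 _)).sub ?_
    by_cases hz : ‖z‖ < 1
    · simpa only [hz, if_true] using h1 z
    · simp only [hz, if_false]; exact tendsto_const_nhds

theorem abs_integral_levyIntegrand_le (hφ : Differentiable ℝ φ) (hM : ∀ x, |φ x| ≤ M)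
    (hsd : SecondDiffBound φ c δ) (hδ : 0 < δ) (hc : 0 ≤ c)
    (hμ : Integrable (fun z : Rd d => min 1 (‖z‖ ^ (1 + δ))) μ) (x : Rd d) :
    |∫ z, levyIntegrand φ x z ∂μ| ≤ ∫ z, (c + 2 * M) * min 1 (‖z‖ ^ (1 + δ)) ∂μ := by
  rw [← Real.norm_eq_abs]
  exact norm_integral_le_of_norm_le (hμ.const_mul (c + 2 * M))
    (.of_forall fun z => abs_levyIntegrand_le hφ hM hsd hδ hc x z)

end nonlocal

/-! ### Well-definedness and time continuity of 𝓛u, and stability under smoothing. -/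

section

variable {d : ℕ} {A : Matrix (Fin d) (Fin d) ℝ} {μ : Measure (Rd d)} {T α β M δ : ℝ}
  {u₀ : Rd d → ℝ} {u f : ℝ → Rd d → ℝ}

/-- The regularity of a solution under which `𝓛 u` is defined. -/
structure IsLevyRegular {d : ℕ} (A : Matrix (Fin d) (Fin d) ℝ) (μ : Measure (Rd d)) (T δ : ℝ)
    (u : ℝ → Rd d → ℝ) : Prop where
  pos : 0 < δ
  integrable : Integrable (fun z : Rd d => min 1 (‖z‖ ^ (1 + δ))) μ
  secondDiff : ∀ ε ∈ Ioo 0 T, ∃ c, 0 ≤ c ∧ ∀ t ∈ Icc ε T, SecondDiffBound (u t) c δ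
  hessian : A = 0 ∨ HasContinuousHessian T u

/-- The local part of the Lévy operator. -/
theorem sum_partialDeriv_flux_zero (φ : Rd d → ℝ) (x : Rd d) :
    ∑ i, partialDeriv i (flux (0 : Matrix (Fin d) (Fin d) ℝ) φ i) x = 0 := by
  refine Finset.sum_eq_zero fun i _ => ?_
  have : flux (0 : Matrix (Fin d) (Fin d) ℝ) φ i = fun _ => 0 := by ext x; simp [flux]
  rw [partialDeriv, this]
  simp

theorem sum_partialDeriv_flux {φ : Rd d → ℝ}
    (hφ : ∀ v, ContDiff ℝ 1 fun y => fderiv ℝ φ y v) (x : Rd d) :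
    ∑ i, partialDeriv i (flux A φ i) x = ∑ i, ∑ j, A i j *
      fderiv ℝ (fun y => fderiv ℝ φ y (EuclideanSpace.single j 1)) x
        (EuclideanSpace.single i 1) :=
  Finset.sum_congr rfl fun i _ =>
    partialDeriv_flux x i fun _ => (hφ _).differentiable one_ne_zero x

theorem IsLevyRegular.levyOpDefinedAt (R : IsLevyRegular A μ T δ u)
    (S : IsDuhamelSolution A μ T M u₀ u f) {t : ℝ} (ht : t ∈ Ioc 0 T) (x : Rd d) :
    LevyOpDefinedAt A μ (u t) x := by
  refine ⟨(S.contDiff t ht).differentiable one_ne_zero x, fun i => ?_, ?_⟩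
  · rcases R.hessian with rfl | hH
    · have : flux (0 : Matrix (Fin d) (Fin d) ℝ) (u t) i = fun _ => 0 := by ext x; simp [flux]
      rw [this]
      exact differentiableAt_const _
    · unfold flux partialDeriv
      exact DifferentiableAt.fun_sum fun j _ =>
        ((hH.contDiff t ht _).differentiable one_ne_zero x).const_mul _
  · obtain ⟨c, hc, hsd⟩ := R.secondDiff (t / 2) ⟨by linarith [ht.1], by linarith [ht.1, ht.2]⟩
    exact integrable_levyIntegrand (S.contDiff t ht) (S.bound t ht)
      (hsd t ⟨by linarith [ht.1], ht.2⟩) R.pos hc R.integrable x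

theorem IsDuhamelSolution.tendsto_apply (S : IsDuhamelSolution A μ T M u₀ u f) {t : ℝ}
    (ht : t ∈ Ioc 0 T) (x : Rd d) : Tendsto (fun s => u s x) (𝓝[Ioc 0 T] t) (𝓝 (u t x)) := by
  rw [Metric.tendsto_nhds]
  intro ε hε
  filter_upwards [S.close t ht (ε / 2) (by positivity)] with s hs
  exact (hs x).1.trans_lt (by linarith)

theorem IsDuhamelSolution.tendsto_fderiv (S : IsDuhamelSolution A μ T M u₀ u f) {t : ℝ}
    (ht : t ∈ Ioc 0 T) (x : Rd d) :
    Tendsto (fun s => fderiv ℝ (u s) x) (𝓝[Ioc 0 T] t) (𝓝 (fderiv ℝ (u t) x)) := by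
  rw [Metric.tendsto_nhds]
  intro ε hε
  filter_upwards [S.close t ht (ε / 2) (by positivity)] with s hs
  rw [dist_eq_norm]
  exact (hs x).2.trans_lt (by linarith)

theorem Icc_mem_nhdsWithin_Ioc {ε t : ℝ} (h : ε < t) : Icc ε T ∈ 𝓝[Ioc 0 T] t := by
  have : Ioi ε ∈ 𝓝[Ioc 0 T] t := nhdsWithin_le_nhds (Ioi_mem_nhds h)
  filter_upwards [this, self_mem_nhdsWithin] with s h1 h2 using ⟨le_of_lt h1, h2.2⟩

/-- `𝓛 u (t, x)` is continuous in time. -/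
theorem IsLevyRegular.continuousOn_levyOp (R : IsLevyRegular A μ T δ u)
    (S : IsDuhamelSolution A μ T M u₀ u f) (x : Rd d) :
    ContinuousOn (fun t => levyOp A μ (u t) x) (Ioc 0 T) := by
  unfold levyOp
  refine ContinuousOn.add ?_ ?_
  · rcases R.hessian with rfl | hH
    · simp_rw [sum_partialDeriv_flux_zero]
      exact continuousOn_const
    · refine ContinuousOn.congr (f := fun t => ∑ i, ∑ j, A i j *
        fderiv ℝ (fun y => fderiv ℝ (u t) y (EuclideanSpace.single j 1)) x
        (EuclideanSpace.single i 1)) ?_ fun t ht => sum_partialDeriv_flux (hH.contDiff t ht) x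
      exact continuousOn_finsetSum _ fun i _ => continuousOn_finsetSum _ fun j _ =>
        (hH.continuousOn x _ _).const_mul _
  · intro t ht
    obtain ⟨c, hc, hsd⟩ := R.secondDiff (t / 2) ⟨by linarith [ht.1], by linarith [ht.1, ht.2]⟩
    refine tendsto_integral_levyIntegrand (M := M) (c := c) ?_ R.pos hc R.integrable
      (fun y => S.tendsto_apply ht y) (fun v => ?_)
    · filter_upwards [self_mem_nhdsWithin,
        Icc_mem_nhdsWithin_Ioc (by linarith [ht.1] : t / 2 < t)] with s hs hs2
      exact ⟨S.contDiff s hs, S.bound s hs, hsd s hs2⟩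
    · exact ((ContinuousLinearMap.apply ℝ ℝ v).continuous.tendsto _).comp (S.tendsto_fderiv ht x)

theorem CondL1.tendsto_avg (h : CondL1 A μ T α) (hT : 0 < T) {g : Rd d → ℝ} {N : ℝ}
    (hg : Continuous g) (hN : ∀ x, |g x| ≤ N) (x : Rd d) :
    Tendsto (fun τ => avg (heatMeasure A μ τ) g x) (𝓝[>] 0) (𝓝 (g x)) := by
  have h1 := (h.continuousOn_avg hg hN x) 0 ⟨le_rfl, hT.le⟩
  rw [ContinuousWithinAt, avg_heatMeasure_zero] at h1
  exact h1.mono_left (nhdsWithin_le_iff.2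
    (mem_of_superset (Ioc_mem_nhdsGT hT) Ioc_subset_Icc_self))

/-- Smoothing the solution by the heat semigroup does not affect `𝓛 u` in the limit. -/
theorem IsLevyRegular.levyOp_avg (R : IsLevyRegular A μ T δ u)
    (S : IsDuhamelSolution A μ T M u₀ u f) (h : CondL1 A μ T α) {ε : ℝ} (hε : ε ∈ Ioo 0 T)
    (x : Rd d) :
    (∀ t ∈ Icc ε T, Tendsto (fun τ => levyOp A μ (avg (heatMeasure A μ τ) (u t)) x) (𝓝[>] 0)
      (𝓝 (levyOp A μ (u t) x))) ∧
    ∃ C, ∀ t ∈ Icc ε T, ∀ τ ∈ Ioc 0 T, |levyOp A μ (avg (heatMeasure A μ τ) (u t)) x| ≤ C := by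
  have hT : 0 < T := hε.1.trans hε.2
  have hmemT : ∀ t ∈ Icc ε T, t ∈ Ioc 0 T := fun t ht => ⟨by linarith [hε.1, ht.1], ht.2⟩
  obtain ⟨c, hc, hsd⟩ := R.secondDiff ε hε
  have hsd' : ∀ t ∈ Icc ε T, ∀ τ ∈ Ioc 0 T, ContDiff ℝ 1 (avg (heatMeasure A μ τ) (u t)) ∧
      (∀ x, |avg (heatMeasure A μ τ) (u t) x| ≤ M) ∧
      SecondDiffBound (avg (heatMeasure A μ τ) (u t)) c δ := fun t ht τ hτ => by
    have := h.isProbabilityMeasure (t := τ) ⟨hτ.1.le, hτ.2⟩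
    have hut := (S.contDiff t (hmemT t ht)).continuous
    have hub := S.bound t (hmemT t ht)
    exact ⟨h.contDiff_avg hτ hut hub, abs_avg_le hub, (hsd t ht).avg hut hub⟩
  have hlim : ∀ {g : Rd d → ℝ} {N : ℝ}, Continuous g → (∀ x, |g x| ≤ N) → ∀ x,
      Tendsto (fun τ => avg (heatMeasure A μ τ) g x) (𝓝[>] 0) (𝓝 (g x)) := h.tendsto_avg hT
  have hIoc : Ioc 0 T ∈ 𝓝[>] (0 : ℝ) := Ioc_mem_nhdsGT hT
  -- Differentiation commutes with averaging, so derivatives of the smoothed solution inherit the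
  -- bounds of those of `u`, uniformly in τ.
  have hd1 : ∀ t ∈ Icc ε T, ∀ τ ∈ Ioc 0 T, ∀ v,
      (fun y => fderiv ℝ (avg (heatMeasure A μ τ) (u t)) y v) =
        avg (heatMeasure A μ τ) (fun y => fderiv ℝ (u t) y v) := fun t ht τ hτ v => by
    have := h.isProbabilityMeasure (t := τ) ⟨hτ.1.le, hτ.2⟩
    exact funext fun y => fderiv_avg_apply (S.contDiff t (hmemT t ht)) (S.bound t (hmemT t ht))
      (S.fderiv_bound t (hmemT t ht)) y v
  have hfb : ∀ t ∈ Icc ε T, ∀ v y, |fderiv ℝ (u t) y v| ≤ M * ‖v‖ := fun t ht v y =>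
    (ContinuousLinearMap.le_opNorm (fderiv ℝ (u t) y) v).trans
      (mul_le_mul_of_nonneg_right (S.fderiv_bound t (hmemT t ht) y) (norm_nonneg _))
  constructor
  · intro t ht
    unfold levyOp
    have hft : Continuous (fderiv ℝ (u t)) :=
      (S.contDiff t (hmemT t ht)).continuous_fderiv one_ne_zero
    refine Tendsto.add ?_ ?_
    · rcases R.hessian with rfl | hH
      · simp_rw [sum_partialDeriv_flux_zero]
        exact tendsto_const_nhds
      · rw [sum_partialDeriv_flux (hH.contDiff t (hmemT t ht))]
        have key : ∀ v w : Rd d, Tendsto (fun τ => fderiv ℝ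
            (fun y => fderiv ℝ (avg (heatMeasure A μ τ) (u t)) y v) x w) (𝓝[>] 0)
            (𝓝 (fderiv ℝ (fun y => fderiv ℝ (u t) y v) x w)) := by
          intro v w
          obtain ⟨K, hK⟩ := hH.bound ε hε v
          have h2 := hH.contDiff t (hmemT t ht) v
          have h2c := h2.continuous_fderiv one_ne_zero
          refine (hlim (g := fun y => fderiv ℝ (fun y => fderiv ℝ (u t) y v) y w) (N := K * ‖w‖)
            (by fun_prop) (fun y => (ContinuousLinearMap.le_opNorm _ w).trans
              (mul_le_mul_of_nonneg_right (hK t ht y) (norm_nonneg _))) x).congr' ?_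
          filter_upwards [hIoc] with τ hτ
          have := h.isProbabilityMeasure (t := τ) ⟨hτ.1.le, hτ.2⟩
          rw [hd1 t ht τ hτ, fderiv_avg_apply h2 (hfb t ht v) (hK t ht)]
        refine Tendsto.congr' (f₁ := fun τ => ∑ i, ∑ j, A i j * fderiv ℝ (fun y =>
          fderiv ℝ (avg (heatMeasure A μ τ) (u t)) y (EuclideanSpace.single j 1)) x
          (EuclideanSpace.single i 1)) ?_ ?_
        · filter_upwards [hIoc] with τ hτ
          exact (sum_partialDeriv_flux (fun v => h.contDiff_fderiv_avg hτ
            (S.contDiff t (hmemT t ht)).continuous (S.bound t (hmemT t ht)) v) x).symm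
        · exact tendsto_finsetSum _ fun i _ => tendsto_finsetSum _ fun j _ =>
            (key _ _).const_mul _
    · refine tendsto_integral_levyIntegrand (M := M) (c := c) ?_ R.pos hc R.integrable
        (fun y => hlim (S.contDiff t (hmemT t ht)).continuous (S.bound t (hmemT t ht)) y)
        (fun v => ?_)
      · filter_upwards [hIoc] with τ hτ using hsd' t ht τ hτ
      · refine (hlim (g := fun y => fderiv ℝ (u t) y v) (by fun_prop) (hfb t ht v) x).congr' ?_
        filter_upwards [hIoc] with τ hτ
        exact (congrFun (hd1 t ht τ hτ v) x).symm
  · have hN : ∀ t ∈ Icc ε T, ∀ τ ∈ Ioc 0 T,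
        |∫ z, levyIntegrand (avg (heatMeasure A μ τ) (u t)) x z ∂μ| ≤
          ∫ z, (c + 2 * M) * min 1 (‖z‖ ^ (1 + δ)) ∂μ := fun t ht τ hτ =>
      abs_integral_levyIntegrand_le ((hsd' t ht τ hτ).1.differentiable one_ne_zero)
        (hsd' t ht τ hτ).2.1 (hsd' t ht τ hτ).2.2 R.pos hc R.integrable x
    rcases R.hessian with rfl | hH
    · refine ⟨∫ z, (c + 2 * M) * min 1 (‖z‖ ^ (1 + δ)) ∂μ, fun t ht τ hτ => ?_⟩
      rw [levyOp, sum_partialDeriv_flux_zero, zero_add]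
      exact hN t ht τ hτ
    · choose K hK using fun v => hH.bound ε hε v
      refine ⟨(∑ i, ∑ j, |A i j| * (K (EuclideanSpace.single j 1) *
        ‖(EuclideanSpace.single i 1 : Rd d)‖)) +
          ∫ z, (c + 2 * M) * min 1 (‖z‖ ^ (1 + δ)) ∂μ, fun t ht τ hτ => ?_⟩
      have := h.isProbabilityMeasure (t := τ) ⟨hτ.1.le, hτ.2⟩
      rw [levyOp]
      refine (abs_add_le _ _).trans (add_le_add ?_ (hN t ht τ hτ))
      rw [sum_partialDeriv_flux (fun v => h.contDiff_fderiv_avg hτ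
        (S.contDiff t (hmemT t ht)).continuous (S.bound t (hmemT t ht)) v) x]
      refine (Finset.abs_sum_le_sum_abs _ _).trans (Finset.sum_le_sum fun i _ => ?_)
      refine (Finset.abs_sum_le_sum_abs _ _).trans (Finset.sum_le_sum fun j _ => ?_)
      rw [abs_mul, hd1 t ht τ hτ, fderiv_avg_apply (hH.contDiff t (hmemT t ht) _) (hfb t ht _)
        (hK _ t ht)]
      gcongr
      exact abs_avg_le (fun y => (ContinuousLinearMap.le_opNorm _ _).trans
        (mul_le_mul_of_nonneg_right (hK _ t ht y) (norm_nonneg _))) x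

end

/-! ### The equation for the smoothed solution and the limit τ → 0. -/

section

variable {d : ℕ} {A : Matrix (Fin d) (Fin d) ℝ} {μ : Measure (Rd d)} {T α β M δ : ℝ}
  {u₀ : Rd d → ℝ} {u f : ℝ → Rd d → ℝ}

/-- Separates a time step of the smoothed solution into pure heat flow, governed by Kolmogorov's
equation, and the source collected over the step. -/
theorem IsDuhamelSolution.avg_add (S : IsDuhamelSolution A μ T M u₀ u f) (h : CondL1 A μ T α)
    (hμ : IsLevyMeasure μ) {τ t r : ℝ} (hτ : 0 ≤ τ) (ht : 0 < t) (hr : 0 ≤ r) (htr : t + r ≤ T)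
    (hτr : τ + r ≤ T) (x : Rd d) :
    avg (heatMeasure A μ τ) (u (t + r)) x = avg (heatMeasure A μ (τ + r)) (u t) x +
      ∫ s in t..t + r, avg (heatMeasure A μ (τ + (t + r) - s)) (f s) x := by
  have htT : t ∈ Ioc 0 T := ⟨ht, by linarith⟩
  have hut := (S.contDiff t htT).continuous
  have := h.isProbabilityMeasure (t := τ) ⟨hτ, by linarith⟩
  have := h.isProbabilityMeasure (t := r) ⟨hr, by linarith⟩
  have hcont := h.continuous_duhamel hμ S.source_continuousOn S.source_bound (a := t) (b := t + r)
    (c := 0) ht.le (by linarith) htr le_rfl (by linarith)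
  have hbd := S.abs_integral_le h (a := t) (b := t + r) (c := 0) ht.le (by linarith) htr le_rfl
    (by linarith)
  simp only [zero_add] at hcont hbd
  have e : u (t + r) = fun x => avg (heatMeasure A μ r) (u t) x +
      ∫ s in t..t + r, avg (heatMeasure A μ (t + r - s)) (f s) x := funext fun x => by
    simpa only [add_sub_cancel_left] using S.restart h hμ ht (by linarith) htr x
  rw [e, ViscousHJ.avg_add (continuous_avg hut (S.bound t htT)) (abs_avg_le (S.bound t htT))
    hcont hbd, h.avg_avg hτ hr hτr hut (S.bound t htT),
    h.avg_duhamel hμ S.source_continuousOn S.source_bound ht.le (by linarith) htr hτ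
      (by linarith)]

/-- Both the upper limit and the heat time move with `r`. Since τ > 0, the integrand is jointly
continuous at (τ, t), so over a short interval it can be frozen at its value there. -/
theorem IsDuhamelSolution.hasDerivWithinAt_integral (S : IsDuhamelSolution A μ T M u₀ u f)
    (h : CondL1 A μ T α) (hμ : IsLevyMeasure μ) {τ t : ℝ} (hτ : τ ∈ Ioo 0 T) (ht : t ∈ Ioo 0 T)
    (x : Rd d) :
    HasDerivWithinAt (fun r => ∫ s in t..t + r, avg (heatMeasure A μ (τ + (t + r) - s)) (f s) x)
      (avg (heatMeasure A μ τ) (f t) x) (Ici 0) 0 := by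
  rw [hasDerivWithinAt_iff_isLittleO, Asymptotics.isLittleO_iff]
  intro ε hε
  have hc := h.continuousOn_avg_slice hμ S.source_continuousOn S.source_bound (τ, t, x)
    ⟨⟨hτ.1, hτ.2.le⟩, ⟨ht.1, ht.2.le⟩, mem_univ _⟩
  obtain ⟨ρ, hρ, hclose⟩ := Metric.continuousWithinAt_iff.1 hc ε hε
  have hpos : 0 < min ρ (min (T - τ) (T - t)) :=
    lt_min hρ (lt_min (sub_pos.2 hτ.2) (sub_pos.2 ht.2))
  filter_upwards [self_mem_nhdsWithin, nhdsWithin_le_nhds (Iio_mem_nhds hpos)] with r hr hr'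
  rw [mem_Ici] at hr
  rw [mem_Iio, lt_min_iff, lt_min_iff] at hr'
  obtain ⟨hr1, hr2, hr3⟩ := hr'
  have hi := h.intervalIntegrable_duhamel hμ S.source_continuousOn S.source_bound (a := t)
    (b := t + r) (c := τ) ht.1.le (by linarith) (by linarith) hτ.1.le (by linarith) x
  have e : (r - 0) • avg (heatMeasure A μ τ) (f t) x =
      ∫ _ in t..t + r, avg (heatMeasure A μ τ) (f t) x := by
    simp
  rw [add_zero, intervalIntegral.integral_same, sub_zero, e,
    ← intervalIntegral.integral_sub hi intervalIntegrable_const]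
  refine (intervalIntegral.norm_integral_le_of_norm_le_const (C := ε) fun s hs => ?_).trans ?_
  · rw [uIoc_of_le (by linarith)] at hs
    have := hclose (x := (τ + (t + r) - s, s, x))
      ⟨⟨by linarith [hs.2, hτ.1], by linarith [hs.1]⟩,
        ⟨by linarith [hs.1, ht.1], by linarith [hs.2]⟩, mem_univ _⟩ ?_
    · rw [dist_eq_norm] at this
      exact this.le
    · rw [Prod.dist_eq, Prod.dist_eq, dist_self, Real.dist_eq, Real.dist_eq]
      refine max_lt ?_ (max_lt ?_ hρ) <;> rw [abs_lt] <;> constructor <;>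
        simp only <;> linarith [hs.1, hs.2]
  · rw [add_sub_cancel_left, sub_zero, Real.norm_eq_abs]

/-- The equation solved by the smoothed solution. -/
theorem IsDuhamelSolution.hasDerivWithinAt_avg (S : IsDuhamelSolution A μ T M u₀ u f)
    (h : CondL1 A μ T α) (hμ : IsLevyMeasure μ) {τ t : ℝ} (hτ : τ ∈ Ioo 0 T) (ht : t ∈ Ioo 0 T)
    (x : Rd d) :
    HasDerivWithinAt (fun s => avg (heatMeasure A μ τ) (u s) x)
      (levyOp A μ (avg (heatMeasure A μ τ) (u t)) x + avg (heatMeasure A μ τ) (f t) x)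
      (Ioi t) t := by
  have htT : t ∈ Ioc 0 T := ⟨ht.1, ht.2.le⟩
  have h1 := (h.hasDerivWithinAt_avg hμ hτ.1 hτ.2 (S.contDiff t htT).continuous
    (S.bound t htT) x).add (S.hasDerivWithinAt_integral h hμ hτ ht x)
  have h2 : HasDerivWithinAt (fun r => avg (heatMeasure A μ τ) (u (t + r)) x)
      (levyOp A μ (avg (heatMeasure A μ τ) (u t)) x + avg (heatMeasure A μ τ) (f t) x)
      (Ici 0) 0 := by
    have hpos : 0 < min (T - τ) (T - t) := lt_min (sub_pos.2 hτ.2) (sub_pos.2 ht.2)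
    refine h1.congr_of_eventuallyEq_of_mem ?_ self_mem_Ici
    filter_upwards [self_mem_nhdsWithin, nhdsWithin_le_nhds (Iio_mem_nhds hpos)] with r hr hr'
    rw [mem_Iio, lt_min_iff] at hr'
    exact S.avg_add h hμ hτ.1.le ht.1 hr (by linarith) (by linarith) x
  have h3 : HasDerivWithinAt (fun s : ℝ => s - t) 1 (Ioi t) t :=
    ((hasDerivAt_id t).sub_const t).hasDerivWithinAt
  have h4 := HasDerivWithinAt.comp_of_eq t h2 h3 (fun s hs =>
    mem_Ici.2 (sub_pos.2 (mem_Ioi.1 hs)).le) (sub_self t).symm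
  simpa [Function.comp_def] using h4

theorem IsDuhamelSolution.continuousOn_avg_apply (S : IsDuhamelSolution A μ T M u₀ u f)
    (ρ : Measure (Rd d)) [IsFiniteMeasure ρ] (x : Rd d) :
    ContinuousOn (fun t => avg ρ (u t) x) (Ioc 0 T) := by
  intro t ht
  refine tendsto_integral_filter_of_dominated_convergence (fun _ => M) ?_ ?_
    (integrable_const _) (.of_forall fun y => S.tendsto_apply ht _)
  · filter_upwards [self_mem_nhdsWithin] with s hs
    have := (S.contDiff s hs).continuous
    fun_prop
  · filter_upwards [self_mem_nhdsWithin] with s hs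
    exact .of_forall fun y => S.bound s hs _

theorem IsDuhamelSolution.continuousOn_avg_source (S : IsDuhamelSolution A μ T M u₀ u f)
    (ρ : Measure (Rd d)) [IsFiniteMeasure ρ] (x : Rd d) :
    ContinuousOn (fun t => avg ρ (f t) x) (Ioc 0 T) := by
  intro t ht
  refine (tendsto_avg_slice S.source_continuousOn S.source_bound ρ ht x).comp
    (f := fun s : ℝ => (s, x)) (tendsto_nhdsWithin_iff.2 ⟨?_, ?_⟩)
  · exact (Continuous.tendsto (by fun_prop) t).mono_left nhdsWithin_le_nhds
  · filter_upwards [self_mem_nhdsWithin] with s hs using ⟨hs, mem_univ _⟩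

theorem IsDuhamelSolution.continuousOn_levyOp_avg (S : IsDuhamelSolution A μ T M u₀ u f)
    (h : CondL1 A μ T α) (hμ : IsLevyMeasure μ) {τ : ℝ} (hτ : τ ∈ Ioc 0 T) (x : Rd d) :
    ContinuousOn (fun t => levyOp A μ (avg (heatMeasure A μ τ) (u t)) x) (Ioc 0 T) :=
  (S.continuousOn_kernel (h.integral_levyOp_heatKernel hμ hτ).1 x).congr fun t ht =>
    h.levyOp_avg hμ hτ (S.contDiff t ht).continuous (S.bound t ht) x

/-- A right derivative is enough: the fundamental theorem of calculus holds for a continuous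
function whose right derivative is integrable. -/
theorem IsDuhamelSolution.integral_avg_eq_sub (S : IsDuhamelSolution A μ T M u₀ u f)
    (h : CondL1 A μ T α) (hμ : IsLevyMeasure μ) {τ a b : ℝ} (hτ : τ ∈ Ioo 0 T) (ha : 0 < a)
    (hab : a ≤ b) (hb : b ≤ T) (x : Rd d) :
    ∫ t in a..b, (levyOp A μ (avg (heatMeasure A μ τ) (u t)) x + avg (heatMeasure A μ τ) (f t) x) =
      avg (heatMeasure A μ τ) (u b) x - avg (heatMeasure A μ τ) (u a) x := by
  have := h.isProbabilityMeasure (t := τ) ⟨hτ.1.le, hτ.2.le⟩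
  have hsub : uIcc a b ⊆ Ioc 0 T := by
    rw [uIcc_of_le hab]
    exact fun s hs => ⟨ha.trans_le hs.1, hs.2.trans hb⟩
  refine intervalIntegral.integral_eq_sub_of_hasDeriv_right
    ((S.continuousOn_avg_apply _ x).mono hsub) (fun t ht => ?_) ?_
  · rw [min_eq_left hab, max_eq_right hab] at ht
    exact S.hasDerivWithinAt_avg h hμ hτ ⟨ha.trans ht.1, ht.2.trans_le hb⟩ x
  · exact (((S.continuousOn_levyOp_avg h hμ ⟨hτ.1, hτ.2.le⟩ x).add
      (S.continuousOn_avg_source _ x)).mono hsub).intervalIntegrable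

/-- Let τ → 0 in the smoothed identity; `IsLevyRegular.levyOp_avg` provides both the pointwise limit
and the bound uniform in time and τ. -/
theorem IsLevyRegular.integral_eq_sub (R : IsLevyRegular A μ T δ u)
    (S : IsDuhamelSolution A μ T M u₀ u f) (h : CondL1 A μ T α) (hμ : IsLevyMeasure μ) {a b : ℝ}
    (ha : 0 < a) (hab : a ≤ b) (hb : b ≤ T) (x : Rd d) :
    ∫ t in a..b, (levyOp A μ (u t) x + f t x) = u b x - u a x := by
  rcases hab.eq_or_lt with rfl | hab'
  · simp
  have hT : 0 < T := by linarith
  obtain ⟨hlim, C, hC⟩ := R.levyOp_avg S h ⟨ha, hab'.trans_le hb⟩ x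
  have hmem : ∀ {t}, t ∈ Ioc a b → t ∈ Icc a T ∧ t ∈ Ioc 0 T := fun {t} ht =>
    ⟨⟨ht.1.le, ht.2.trans hb⟩, ha.trans ht.1, ht.2.trans hb⟩
  have hu : ∀ {t}, t ∈ Ioc 0 T →
      Tendsto (fun τ => avg (heatMeasure A μ τ) (u t) x) (𝓝[>] 0) (𝓝 (u t x)) := fun {t} ht =>
    h.tendsto_avg hT (S.contDiff t ht).continuous (S.bound t ht) x
  have hIoo : ∀ᶠ τ in 𝓝[>] (0 : ℝ), τ ∈ Ioo 0 T := Ioo_mem_nhdsGT hT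
  have key : Tendsto (fun τ => ∫ t in a..b, (levyOp A μ (avg (heatMeasure A μ τ) (u t)) x +
      avg (heatMeasure A μ τ) (f t) x)) (𝓝[>] 0)
      (𝓝 (∫ t in a..b, (levyOp A μ (u t) x + f t x))) := by
    refine intervalIntegral.tendsto_integral_filter_of_dominated_convergence (fun _ => C + M)
      ?_ ?_ intervalIntegrable_const (.of_forall fun t ht => ?_)
    · filter_upwards [hIoo] with τ hτ
      have := h.isProbabilityMeasure (t := τ) ⟨hτ.1.le, hτ.2.le⟩
      rw [uIoc_of_le hab]
      exact (((S.continuousOn_levyOp_avg h hμ ⟨hτ.1, hτ.2.le⟩ x).add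
        (S.continuousOn_avg_source _ x)).mono fun s hs => (hmem hs).2).aestronglyMeasurable
          measurableSet_Ioc
    · filter_upwards [hIoo] with τ hτ
      have := h.isProbabilityMeasure (t := τ) ⟨hτ.1.le, hτ.2.le⟩
      refine .of_forall fun t ht => ?_
      rw [uIoc_of_le hab] at ht
      exact (abs_add_le _ _).trans (add_le_add (hC t (hmem ht).1 τ ⟨hτ.1, hτ.2.le⟩)
        (abs_avg_le (S.source_bound t (hmem ht).2) x))
    · rw [uIoc_of_le hab] at ht
      exact (hlim t (hmem ht).1).add (h.tendsto_avg hT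
        (continuous_slice S.source_continuousOn (hmem ht).2) (S.source_bound t (hmem ht).2) x)
  refine tendsto_nhds_unique key (((hu ⟨ha.trans hab', hb⟩).sub (hu ⟨ha, hab.trans hb⟩)).congr' ?_)
  filter_upwards [hIoo] with τ hτ
  exact (S.integral_avg_eq_sub h hμ hτ ha hab hb x).symm

/-- Composing `g` with `min · T` extends it continuously beyond `T`, so the two-sided fundamental
theorem also covers t = T. -/
theorem hasDerivWithinAt_of_integral_eq_sub {v g : ℝ → ℝ} (hg : ContinuousOn g (Ioc 0 T))
    (hv : ∀ a b, 0 < a → a ≤ b → b ≤ T → ∫ t in a..b, g t = v b - v a) {t : ℝ}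
    (ht : t ∈ Ioc 0 T) : HasDerivWithinAt v (g t) (Ioc 0 T) t := by
  have hT : 0 < T := ht.1.trans_le ht.2
  have hG : ContinuousOn (fun s => g (min s T)) (Ioi 0) :=
    hg.comp (by fun_prop) fun s hs => ⟨lt_min hs hT, min_le_right _ _⟩
  have h1 : HasDerivAt (fun b => ∫ s in t / 2..b, g (min s T)) (g (min t T)) t := by
    refine intervalIntegral.integral_hasDerivAt_right (ContinuousOn.intervalIntegrable
      (hG.mono fun s hs => ?_)) (hG.stronglyMeasurableAtFilter isOpen_Ioi t ht.1)
      (hG.continuousAt (Ioi_mem_nhds ht.1))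
    rw [uIcc_of_le (by linarith [ht.1])] at hs
    exact (half_pos ht.1).trans_le hs.1
  rw [min_eq_left ht.2] at h1
  refine (h1.add_const (v (t / 2))).hasDerivWithinAt.congr_of_eventuallyEq_of_mem ?_ ht
  filter_upwards [Icc_mem_nhdsWithin_Ioc (half_lt_self ht.1)] with b hb
  have : ∫ s in t / 2..b, g (min s T) = ∫ s in t / 2..b, g s :=
    intervalIntegral.integral_congr fun s hs => by
      rw [uIcc_of_le hb.1] at hs
      simp only [min_eq_left (hs.2.trans hb.2)]
  rw [this, hv _ _ (half_pos ht.1) hb.1 hb.2, sub_add_cancel]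

theorem IsLevyRegular.hasDerivWithinAt (R : IsLevyRegular A μ T δ u)
    (S : IsDuhamelSolution A μ T M u₀ u f) (h : CondL1 A μ T α) (hμ : IsLevyMeasure μ) {t : ℝ}
    (ht : t ∈ Ioc 0 T) (x : Rd d) :
    HasDerivWithinAt (fun s => u s x) (levyOp A μ (u t) x + f t x) (Ioc 0 T) t :=
  hasDerivWithinAt_of_integral_eq_sub ((R.continuousOn_levyOp S x).add
    (S.source_continuousOn.comp (f := fun s => (s, x)) (by fun_prop) fun _ hs => ⟨hs, mem_univ _⟩))
    (fun _ _ ha hab hb => R.integral_eq_sub S h hμ ha hab hb x) ht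

theorem IsDuhamelSolution.tendsto_initial (S : IsDuhamelSolution A μ T M u₀ u f)
    (h : CondL1 A μ T α) (hT : 0 < T) (x : Rd d) :
    Tendsto (fun t => u t x) (𝓝[>] 0) (𝓝 (u₀ x)) := by
  have h1 := h.tendsto_avg hT S.initial_continuous S.initial_bound x
  have hIoc : ∀ᶠ τ in 𝓝[>] (0 : ℝ), τ ∈ Ioc 0 T := Ioc_mem_nhdsGT hT
  have h2 : Tendsto (fun t => ∫ s in (0 : ℝ)..t, avg (heatMeasure A μ (t - s)) (f s) x) (𝓝[>] 0)
      (𝓝 0) := by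
    refine squeeze_zero_norm' (a := fun t => M * t) ?_ ?_
    · filter_upwards [hIoc] with t ht
      have := S.abs_integral_le h (a := 0) (b := t) (c := 0) le_rfl ht.1.le ht.2 le_rfl
        (by linarith [ht.2]) x
      simpa using this
    · exact (Continuous.tendsto' (by fun_prop) _ _ (mul_zero M)).mono_left nhdsWithin_le_nhds
  have h3 := h1.add h2
  rw [add_zero] at h3
  refine h3.congr' ?_
  filter_upwards [hIoc] with t ht
  exact (S.duhamel t ht x).symm

/-- With a β-Hölder source every δ ≤ 1 with 1+δ < α+β is available: δ = 1 when α+β > 2, matching the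
weight |z|², and otherwise δ = σ-1, matching |z|^σ, where σ < α+β ≤ 2. -/
theorem IsDuhamelSolution.exists_isLevyRegular (S : IsDuhamelSolution A μ T M u₀ u f)
    (h : CondL1 A μ T α) (hμ : IsLevyMeasure μ) (hα : α ∈ Ioc (1 : ℝ) 2) (hβ : β ∈ Ioc (0 : ℝ) 1)
    (hf : LocallyHolder T β f) (horder : 2 < α + β ∨ CondL2 A μ α β) :
    ∃ δ, IsLevyRegular A μ T δ u := by
  by_cases h2 : 2 < α + β
  · refine ⟨1, one_pos, ?_, fun ε hε => ?_,
      Or.inr (S.hasContinuousHessian h hμ hα.1 hβ.1 hβ.2 h2 hf)⟩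
    · have := hμ.integrable
      norm_num
      exact this
    · exact S.exists_secondDiffBound h hμ hα.1 hβ.1.le hβ.2 zero_le_one le_rfl (by linarith) hf hε
  · obtain ⟨hA, σ, hσ, hσμ⟩ := horder.resolve_left h2
    refine ⟨σ - 1, by linarith [hσ.1, hα.1], ?_, fun ε hε => ?_, Or.inl hA⟩
    · exact integrable_min_rpow (by linarith [hσ.1, hα.1]) (by simpa using hσμ)
    · exact S.exists_secondDiffBound h hμ hα.1 hβ.1.le hβ.2 (by linarith [hσ.1, hα.1])
        (by linarith [hσ.2]) (by linarith [hσ.2]) hf hε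

end

end ViscousHJ


/-! ### Conclusion. -/

open MeasureTheory ViscousHJ

theorem mainTheorem7 {d : ℕ} (hd : 0 < d)
    (A : Matrix (Fin d) (Fin d) ℝ) (hA : A.PosSemidef)
    (μ : Measure (Rd d)) (hμ : IsLevyMeasure μ)
    (T : ℝ) (hT : 0 < T)
    (α β : ℝ) (hα : α ∈ Set.Ioc (1 : ℝ) 2) (hβ : β ∈ Set.Ioc (0 : ℝ) 1)
    (hαβ : ∀ n : ℕ, α + β ≠ n)
    (hL1 : CondL1 A μ T α)
    (H : ℝ → Rd d → Rd d → ℝ) (hHp : CondHp T H) (hHx : CondHx T β H)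
    (u₀ : Rd d → ℝ) (hu₀ : CondU0 u₀)
    (horder : 2 < α + β ∨ CondL2 A μ α β)
    (u : ℝ → Rd d → ℝ) (hu : MemCbCb1 T u) (hmild : IsMildSolution A μ T H u₀ u) :
    IsClassicalSolution A μ T H u₀ u := by
  obtain ⟨M, -, S⟩ := isDuhamelSolution_of_mild hL1 hT hHp hu₀ hu hmild
  have hf := S.locallyHolder hL1 hμ hα.1 hβ.1 hβ.2 fun δ hδ0 hδβ hsd =>
    locallyHolder_hamiltonian hT hHp hHx hδ0 hδβ S hsd
  obtain ⟨δ, R⟩ := S.exists_isLevyRegular hL1 hμ hα hβ hf horder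
  exact ⟨fun t ht x => R.levyOpDefinedAt S ht x, fun t ht x => R.hasDerivWithinAt S hL1 hμ ht x,
    fun x => S.tendsto_initial hL1 hT x⟩
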